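/- Let $n\ge 2$, $m>1-\frac2n$, $\lambda>0$, $B=2-n<A\le 2$, and let $$U(x)=\frac{|x|^A}{A}-\lambda\frac{|x|^B}{B},\qquad x\in\mathbb R^n\setminus\{0\},$$ with the convention $\frac{|x|^0}{0}:=\log|x|$. Consider the Cauchy problem $$\rho_t=\Delta\rho^m+\operatorname{div}\big(\rho\,\nabla(U*\rho)\big)\quad\text{in }\mathbb R^n\times(0,\infty),\qquad \rho(\cdot,0)=\rho_0, \tag{1}$$ with $0\le\rho_0\in L^1(\mathbb R^n)\cap L^\infty(\mathbb R^n)$, where $\nabla(U*\rho)$ stands for the convolution $(\nabla U)*\rho$ in $x$. A measurable function $\rho\ge 0$ on $(0,\infty)\times\mathbb R^n$ is called a global weak solution of (1) if, for every $T>0$, * $\rho\in L^\infty((0,T)\times\mathbb R^n)$, and $\rho(t)\in L^1(\mathbb R^n)$ with $\int_{\mathbb R^n}\rho(t,x)\,dx=\int_{\mathbb R^n}\rho_0(x)\,dx$ for a.e. $t>0$; * $\rho^m$ has a weak gradient in $x$ with $\nabla\rho^m\in L^2((0,T)\times\mathbb R^n)$; * the drift is well defined: $\int_{\mathbb R^n}|\nabla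 U(x-y)|\,\rho(t,y)\,dy$ is essentially bounded for $(t,x)$ in $(0,T)\times B_R$, for every $R>0$ (this is automatic if $A\le 1$); * for every $\psi\in C_c^\infty(\mathbb R\times\mathbb R^n)$, $$\int_0^\infty\!\!\int_{\mathbb R^n}\Big(\rho\,\partial_t\psi-\nabla\rho^m\cdot\nabla\psi-\rho\,\nabla(U*\rho)\cdot\nabla\psi\Big)dx\,dt+\int_{\mathbb R^n}\rho_0(x)\,\psi(0,x)\,dx=0 .$$ Theorem. For all $M,K\ge 0$ there is a constant $C$, depending only on $n,m,A,\lambda,M,K$, such that for every $\rho_0$ as above with $\|\rho_0\|_{L^1}\le M$ and $\|\rho_0\|_{L^\infty}\le K$, every global weak solution $\rho$ of (1) satisfies $$\|\rho\|_{L^\infty(\mathbb R_+;L^\infty(\mathbb R^n))}\le C .$$ -/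

import Mathlib

open MeasureTheory Set
open scoped ENNReal NNReal ContDiff

noncomputable section

namespace AggregationDiffusion

/-- The Euclidean space `ℝⁿ`. -/
abbrev E (n : ℕ) : Type := EuclideanSpace ℝ (Fin n)

/-- The power law `r ↦ r ^ a / a`, with the convention `r ^ 0 / 0 := log r`. -/
def powerLaw (a r : ℝ) : ℝ := if a = 0 then Real.log r else r ^ a / a

/-- The interaction potential `U(x) = |x| ^ A / A - lam * |x| ^ B / B`. -/
def potential {n : ℕ} (A B lam : ℝ) (x : E n) : ℝ :=
  powerLaw A ‖x‖ - lam * powerLaw B ‖x‖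

/-- The field `∇(U ∗ u) = (∇U) ∗ u`, that is, `x ↦ ∫ u(y) ∇U(x - y) dy`. -/
def drift {n : ℕ} (A B lam : ℝ) (u : E n → ℝ) (x : E n) : E n :=
  ∫ y, u y • gradient (potential A B lam) (x - y)

/-- `g` is the weak (distributional) gradient of `f` on `ℝⁿ`. -/
def HasWeakGradient {n : ℕ} (f : E n → ℝ) (g : E n → E n) : Prop :=
  LocallyIntegrable f ∧ LocallyIntegrable g ∧
    ∀ φ : E n → ℝ, ContDiff ℝ ∞ φ → HasCompactSupport φ →
      ∫ x, f x • gradient φ x = - ∫ x, φ x • g x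

/-- The Lebesgue measure on the space-time slab `(0,T) × ℝⁿ`. -/
def slab (n : ℕ) (T : ℝ) : Measure (ℝ × E n) :=
  (volume.restrict (Ioo 0 T)).prod volume

/-- The Lebesgue measure on `(0,∞) × ℝⁿ`. -/
def spaceTime (n : ℕ) : Measure (ℝ × E n) :=
  (volume.restrict (Ioi 0)).prod volume

/-- `ρ` (a function of `t` and `x`, only its values for `t > 0` matter) is a global weak solution
of `∂ₜρ = Δ(ρ ^ m) + div(ρ ∇(U ∗ ρ))` in `ℝⁿ × (0,∞)` with initial datum `ρ₀`. -/
structure IsGlobalWeakSolution {n : ℕ} (m A B lam : ℝ) (ρ₀ : E n → ℝ) (ρ : ℝ → E n → ℝ) :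
    Prop where
  /-- `ρ` is non-negative. -/
  nonneg : ∀ᵐ z ∂(spaceTime n), 0 ≤ ρ z.1 z.2
  /-- `ρ` is measurable and essentially bounded on `(0,T) × ℝⁿ` for every finite `T`;
  the bound may depend on `T`. -/
  bounded : ∀ T : ℝ, 0 < T → MemLp (fun z : ℝ × E n => ρ z.1 z.2) ∞ (slab n T)
  /-- `ρ(t)` is integrable with the mass of the initial datum. -/
  mass : ∀ᵐ t ∂(volume.restrict (Ioi (0 : ℝ))), Integrable (ρ t) ∧ ∫ x, ρ t x = ∫ x, ρ₀ x
  /-- The integral that defines the drift `∇(U ∗ ρ)` converges absolutely, and is bounded on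
  bounded sets of space-time. (For `A ≤ 1` this follows from the previous fields; for `A > 1`
  it says that the moment of order `A - 1` of `ρ(t)` is finite, and bounded on `(0,T)`.) -/
  drift_finite : ∀ T R : ℝ, 0 < T → 0 < R → ∃ L : ℝ≥0, ∀ᵐ z ∂(slab n T), ‖z.2‖ < R →
    ∫⁻ y, ‖ρ z.1 y • gradient (potential A B lam) (z.2 - y)‖ₑ ≤ L
  /-- `ρ ^ m` has a weak gradient `G` in the space variable, in `L²((0,T) × ℝⁿ)` for all `T`, and
  the equation and the initial condition hold in the weak sense. -/
  weak_form : ∃ G : ℝ → E n → E n,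
    (∀ T : ℝ, 0 < T → MemLp (fun z : ℝ × E n => G z.1 z.2) 2 (slab n T)) ∧
    (∀ᵐ t ∂(volume.restrict (Ioi (0 : ℝ))), HasWeakGradient (fun x => ρ t x ^ m) (G t)) ∧
    ∀ ψ : ℝ × E n → ℝ, ContDiff ℝ ∞ ψ → HasCompactSupport ψ →
      (∫ z, (ρ z.1 z.2 * deriv (fun s => ψ (s, z.2)) z.1
          - inner ℝ (G z.1 z.2) (gradient (fun x => ψ (z.1, x)) z.2)
          - ρ z.1 z.2 * inner ℝ (drift A B lam (ρ z.1) z.2)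
              (gradient (fun x => ψ (z.1, x)) z.2)) ∂(spaceTime n))
        + ∫ x, ρ₀ x * ψ (0, x) = 0

end AggregationDiffusion

end

/-! Write V = ∇(U ∗ ρ), and let σ be the area of the unit sphere. In the sense of distributions ΔU =
(A+n-2)|x|^(A-2) - λσδ₀, so div V(x) = (A+n-2) ∫ ρ(y)|x-y|^(A-2) dy - λσρ(x)
(`integral_fderiv_drift`): the repulsion is local and linear in ρ. The attraction is of lower order.
Since -n < A-2 ≤ 0, splitting its integral at a small radius bounds it by ηS + D, where S is the
supremum of ρ on a time slab, η > 0 is as small as desired, and D does not involve S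
(`exists_attraction_le`). With η = λσ/(2(A+n-2)) this makes div V ≤ 0 wherever ρ ≥ S/2 + D'.

If k ≥ ‖ρ₀‖_∞ and div V ≤ 0 on {ρ ≥ k}, then the constant k is a supersolution where it matters, and
ρ ≤ k (`IsSlabSolution.ae_le`). Taking k = max(K, S/2 + D') gives S ≤ max(K, S/2 + D'). As S is
finite on each slab, S ≤ max(K, 2D'), a bound independent of the length of the slab
(`exists_slabSup_le`).

The comparison is a weak argument that uses only ∇ρ^m ∈ L². The equation is tested with (T'-t) φ(x)
h(ρ^m), where φ is a cutoff and h is increasing and vanishes up to k^m. Diffusion contributes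
h'(ρ^m)|∇ρ^m|² ≥ 0. The drift term ρ h'(ρ^m) ∇ρ^m·V equals ∇P(ρ^m)·V with P' = s^(1/m) h', and
integrating by parts turns it into -div V · P(ρ^m) ≥ 0. In time ρ has no regularity, so ∂ₜρ is
replaced by backward difference quotients, whose limit is read off from the equation
(`tendsto_difference_quotient`); convexity of the primitive Φ of x ↦ h(x^m) then plays the role of
the chain rule. The flux through ∇φ disappears as φ ↑ 1, because |∇φ| = O(1/(1+|x|)) while |V| =
O(1+|x|). -/

open MeasureTheory Set
open scoped ENNReal NNReal ContDiff

noncomputable section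

namespace AggregationDiffusion

open Filter Topology Convolution ContinuousLinearMap

set_option linter.unusedSectionVars false

/-! ### Correlations of L² functions and weak directional derivatives. -/

section WeakDerivative

variable {X : Type*} [NormedAddCommGroup X] [NormedSpace ℝ X] [FiniteDimensional ℝ X]
  [MeasurableSpace X] [BorelSpace X] {μ : Measure X} [μ.IsAddHaarMeasure]

/-- The correlation `z ↦ ∫ f(w + z) b(w) dw` of two functions. -/
def corr (μ : Measure X) (f b : X → ℝ) (z : X) : ℝ := ∫ w, f (w + z) * b w ∂μ

lemma memLp_comp_add_right {f : X → ℝ} (hf : MemLp f 2 μ) (z : X) :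
    MemLp (fun w => f (w + z)) 2 μ :=
  hf.comp_measurePreserving (measurePreserving_add_right μ z)

/-- As an L² pairing with a translate, the correlation inherits continuity from the strong
continuity of translations, and a uniform bound from Cauchy–Schwarz. -/
lemma corr_eq_inner {f b : X → ℝ} (hf : MemLp f 2 μ) (hb : MemLp b 2 μ) (z : X) :
    corr μ f b z = inner ℝ (hb.toLp b)
      (Lp.compMeasurePreserving (fun w => w + z) (measurePreserving_add_right μ z)
        (hf.toLp f)) := by
  rw [Lp.toLp_compMeasurePreserving, L2.inner_def, corr]
  refine integral_congr_ae ?_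
  filter_upwards [hb.coeFn_toLp,
    (hf.comp_measurePreserving (measurePreserving_add_right μ z)).coeFn_toLp] with w h1 h2
  rw [h1, h2]
  simp

lemma continuous_corr {f b : X → ℝ} (hf : MemLp f 2 μ) (hb : MemLp b 2 μ) :
    Continuous (corr μ f b) := by
  have h : Continuous fun z : X => Lp.compMeasurePreserving (p := 2) (fun w => w + z)
      (measurePreserving_add_right μ z) (hf.toLp f) := by
    let g : C(X, C(X, X)) :=
      (ContinuousMap.mk (fun a : X × X => a.2 + a.1) (by fun_prop)).curry
    exact (continuous_const (y := hf.toLp f)).compMeasurePreservingLp g.continuous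
      (fun z => measurePreserving_add_right μ z) (by simp)
  have : corr μ f b = fun z => _ := funext fun z => corr_eq_inner hf hb z
  rw [this]
  exact continuous_const.inner h

lemma abs_corr_le {f b : X → ℝ} (hf : MemLp f 2 μ) (hb : MemLp b 2 μ) (z : X) :
    |corr μ f b z| ≤ (eLpNorm f 2 μ).toReal * (eLpNorm b 2 μ).toReal := by
  rw [corr_eq_inner hf hb]
  refine (abs_real_inner_le_norm _ _).trans ?_
  rw [Lp.norm_compMeasurePreserving, Lp.norm_toLp, Lp.norm_toLp, mul_comm]

/-- Cauchy–Schwarz bounds the inner integral uniformly in the shift, so integrability of `κ` is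
enough for Fubini. -/
lemma integrable_corr_prod {κ f b : X → ℝ} (hκ : Integrable κ μ) (hf : MemLp f 2 μ)
    (hb : MemLp b 2 μ) :
    Integrable (fun p : X × X => κ p.1 * (f (p.2 + p.1) * b p.2)) (μ.prod μ) := by
  have hm : AEStronglyMeasurable (fun p : X × X => κ p.1 * (f (p.2 + p.1) * b p.2))
      (μ.prod μ) := by
    refine hκ.1.comp_fst.mul (AEStronglyMeasurable.mul ?_ hb.1.comp_snd)
    have : Measure.QuasiMeasurePreserving (fun p : X × X => p.2 + p.1) (μ.prod μ) μ := by
      have h := (measurePreserving_prod_add_right μ μ).quasiMeasurePreserving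
      exact (Measure.quasiMeasurePreserving_snd (μ := μ) (ν := μ)).comp h
    exact hf.1.comp_quasiMeasurePreserving this
  rw [integrable_prod_iff hm]
  constructor
  · refine Eventually.of_forall fun z => ?_
    exact ((memLp_comp_add_right hf z).integrable_mul hb).const_mul (κ z)
  · refine Integrable.mono' (hκ.norm.mul_const
      ((eLpNorm f 2 μ).toReal * (eLpNorm b 2 μ).toReal)) hm.norm.integral_prod_right' ?_
    refine Eventually.of_forall fun z => ?_
    have h := abs_corr_le hf.norm hb.norm z
    rw [eLpNorm_norm, eLpNorm_norm] at h
    rw [Real.norm_of_nonneg (by positivity)]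
    simp only [norm_mul]
    rw [integral_const_mul]
    exact mul_le_mul_of_nonneg_left ((le_abs_self _).trans h) (norm_nonneg _)

/-- Fubini moves the mollifier onto the correlation. Limits of mollified pairings thereby reduce to
the continuity of a correlation at `0`. -/
lemma integral_mul_convolution {κ f b : X → ℝ} (hκ : Integrable κ μ) (hf : MemLp f 2 μ)
    (hb : MemLp b 2 μ) :
    ∫ u, f u * (κ ⋆[lsmul ℝ ℝ, μ] b) u ∂μ = ∫ z, κ z * corr μ f b z ∂μ := by
  have h1 := integrable_corr_prod hκ hf hb
  have h2 : Integrable (fun p : X × X => κ p.1 * (f p.2 * b (p.2 - p.1))) (μ.prod μ) := by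
    have := (measurePreserving_prod_sub μ μ).integrable_comp_of_integrable h1
    simpa [Function.comp_def] using this
  calc ∫ u, f u * (κ ⋆[lsmul ℝ ℝ, μ] b) u ∂μ
      = ∫ u, ∫ z, κ z * (f u * b (u - z)) ∂μ ∂μ := by
        refine integral_congr_ae (Eventually.of_forall fun u => ?_)
        simp only [convolution_def, lsmul_apply, smul_eq_mul]
        rw [← integral_const_mul]
        congr 1
        ext z
        ring
    _ = ∫ z, ∫ u, κ z * (f u * b (u - z)) ∂μ ∂μ := (integral_integral_swap h2).symm
    _ = ∫ z, κ z * corr μ f b z ∂μ := by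
        refine integral_congr_ae (Eventually.of_forall fun z => ?_)
        simp only [corr]
        rw [integral_const_mul, ← integral_add_right_eq_self _ z]
        simp

lemma tendsto_integral_bump_mul {ι : Type*} {l : Filter ι} {φ : ι → ContDiffBump (0 : X)}
    (hφ : Tendsto (fun i => (φ i).rOut) l (𝓝 0)) {q : X → ℝ} (hq : Continuous q) :
    Tendsto (fun i => ∫ z, (φ i).normed μ z * q z ∂μ) l (𝓝 (q 0)) := by
  have h := ContDiffBump.convolution_tendsto_right_of_continuous (μ := μ) hφ
    (g := fun z => q (-z)) (hq.comp continuous_neg) 0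
  simpa [convolution_def] using h

/-- `g` is the weak derivative of `f` in the direction `v`. -/
def HasWeakDeriv (μ : Measure X) (v : X) (f g : X → ℝ) : Prop :=
  ∀ χ : X → ℝ, ContDiff ℝ ∞ χ → HasCompactSupport χ →
    ∫ x, f x * fderiv ℝ χ x v ∂μ = - ∫ x, χ x * g x ∂μ

lemma fderiv_convolution_apply {κ f : X → ℝ} (hκ : ContDiff ℝ ∞ κ) (hc : HasCompactSupport κ)
    (hf : LocallyIntegrable f μ) (v x : X) :
    fderiv ℝ (κ ⋆[lsmul ℝ ℝ, μ] f) x v = ((fun y => fderiv ℝ κ y v) ⋆[lsmul ℝ ℝ, μ] f) x := by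
  have h1 : ContDiff ℝ 1 κ := hκ.of_le (by norm_cast)
  rw [(hc.hasFDerivAt_convolution_left (lsmul ℝ ℝ) h1 hf x).fderiv]
  have hint : ConvolutionExistsAt (fderiv ℝ κ) f x (precompL X (lsmul ℝ ℝ)) μ :=
    (hc.fderiv ℝ).convolutionExists_left _ (h1.continuous_fderiv one_ne_zero) hf x
  rw [convolution_def, convolution_def]
  exact ContinuousLinearMap.integral_apply hint v

/-- This is the definition of the weak derivative with the test function `y ↦ κ (x - y)`. -/
lemma HasWeakDeriv.fderiv_convolution {κ f g : X → ℝ} {v : X} (h : HasWeakDeriv μ v f g)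
    (hκ : ContDiff ℝ ∞ κ) (hc : HasCompactSupport κ) (hf : LocallyIntegrable f μ) (x : X) :
    fderiv ℝ (κ ⋆[lsmul ℝ ℝ, μ] f) x v = (κ ⋆[lsmul ℝ ℝ, μ] g) x := by
  rw [fderiv_convolution_apply hκ hc hf, convolution_eq_swap, convolution_eq_swap]
  have h1 := h (fun y => κ (x - y)) (hκ.comp (contDiff_const.sub contDiff_id))
    (hc.comp_homeomorph (Homeomorph.subLeft x))
  have h2 : ∀ y, fderiv ℝ (fun y => κ (x - y)) y v = - fderiv ℝ κ (x - y) v := by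
    intro y
    have hd : HasFDerivAt κ (fderiv ℝ κ (x - y)) (x - y) :=
      (hκ.differentiable (by simp)).differentiableAt.hasFDerivAt
    have := hd.comp y ((hasFDerivAt_id y).const_sub x)
    change fderiv ℝ (κ ∘ fun y => x - y) y v = _
    rw [this.fderiv]
    simp
  simp only [h2, mul_neg, integral_neg, neg_inj] at h1
  simpa [mul_comm] using h1

end WeakDerivative

end AggregationDiffusion

end

noncomputable section

namespace AggregationDiffusion

open Filter Topology Convolution ContinuousLinearMap

set_option linter.unusedSectionVars false

/-! ### Product and chain rules, and admissible test functions for distributional equations. -/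

section WeakDerivativeCalculus

variable {X : Type*} [NormedAddCommGroup X] [NormedSpace ℝ X] [FiniteDimensional ℝ X]
  [MeasurableSpace X] [BorelSpace X] {μ : Measure X} [μ.IsAddHaarMeasure]

/-- A sequence of bump functions at `0` whose supports shrink to `0`. -/
def bumpSeq (X : Type*) [NormedAddCommGroup X] (k : ℕ) : ContDiffBump (0 : X) where
  rIn := 1 / (k + 1)
  rOut := 2 / (k + 1)
  rIn_pos := by positivity
  rIn_lt_rOut := by gcongr; norm_num

lemma tendsto_bumpSeq_rOut : Tendsto (fun k => (bumpSeq X k).rOut) atTop (𝓝 0) := by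
  have h := (tendsto_one_div_add_atTop_nhds_zero_nat (𝕜 := ℝ)).const_mul 2
  simp only [mul_zero] at h
  exact h.congr fun k => by simp [bumpSeq]; ring

lemma tendsto_eLpNorm_two_zero {α : Type*} [MeasurableSpace α] {ν : Measure α}
    {d : ℕ → α → ℝ} {D : α → ℝ} (hd : ∀ k, AEStronglyMeasurable (d k) ν) (hD : MemLp D 2 ν)
    (hb : ∀ k, ∀ᵐ x ∂ν, ‖d k x‖ ≤ D x)
    (ht : ∀ᵐ x ∂ν, Tendsto (fun k => d k x) atTop (𝓝 0)) :
    Tendsto (fun k => eLpNorm (d k) 2 ν) atTop (𝓝 0) := by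
  have h0 : Tendsto (fun k => ∫⁻ x, ‖d k x‖ₑ ^ (2 : ℝ) ∂ν) atTop (𝓝 (∫⁻ _, 0 ∂ν)) := by
    refine tendsto_lintegral_of_dominated_convergence' (fun x => ‖D x‖ₑ ^ (2 : ℝ))
      (fun k => (hd k).enorm.pow_const _) (fun k => ?_) ?_ ?_
    · filter_upwards [hb k] with x hx
      gcongr
      rw [enorm_le_iff_norm_le]
      exact hx.trans (le_abs_self _)
    · have := lintegral_rpow_enorm_lt_top_of_eLpNorm_lt_top (p := 2) (by simp) (by simp) hD.2
      simpa using this.ne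
    · filter_upwards [ht] with x hx
      have h1 : Tendsto (fun k => ‖d k x‖ₑ) atTop (𝓝 0) := by simpa using hx.enorm
      have h2 := (ENNReal.continuous_rpow_const (y := 2)).tendsto 0
      simp only [ENNReal.zero_rpow_of_pos (zero_lt_two (α := ℝ))] at h2
      exact h2.comp h1
  simp only [lintegral_zero] at h0
  have h2 := (ENNReal.continuous_rpow_const (y := 1 / 2)).tendsto 0
  rw [ENNReal.zero_rpow_of_pos (by norm_num)] at h2
  refine (h2.comp h0).congr fun k => ?_
  rw [eLpNorm_eq_lintegral_rpow_enorm_toReal (by simp) (by simp)]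
  simp

/-- Product rule: multiplication of a weakly differentiable function by a smooth one. -/
lemma HasWeakDeriv.smooth_mul {α f g : X → ℝ} {v : X} (h : HasWeakDeriv μ v f g)
    (hα : ContDiff ℝ ∞ α) (hf : LocallyIntegrable f μ) (hg : LocallyIntegrable g μ) :
    HasWeakDeriv μ v (fun x => α x * f x) (fun x => α x * g x + fderiv ℝ α x v * f x) := by
  intro χ hχ hc
  have h1 := h (fun x => α x * χ x) (hα.mul hχ) hc.mul_left
  have hd : ∀ x, fderiv ℝ (fun x => α x * χ x) x v = α x * fderiv ℝ χ x v
      + χ x * fderiv ℝ α x v := fun x => by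
    rw [fderiv_fun_mul (hα.differentiable (by simp)).differentiableAt
      (hχ.differentiable (by simp)).differentiableAt]
    simp
  simp only [hd, mul_add] at h1
  have ca : Continuous fun x => fderiv ℝ α x v :=
    (hα.continuous_fderiv (by simp)).clm_apply continuous_const
  have cχ : Continuous fun x => fderiv ℝ χ x v :=
    (hχ.continuous_fderiv (by simp)).clm_apply continuous_const
  have hcd : HasCompactSupport fun x => fderiv ℝ χ x v := hc.fderiv_apply ℝ v
  have i1 : Integrable (fun x => f x * (α x * fderiv ℝ χ x v)) μ :=
    hf.integrable_smul_right_of_hasCompactSupport (hα.continuous.mul cχ) hcd.mul_left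
  have i2 : Integrable (fun x => f x * (χ x * fderiv ℝ α x v)) μ :=
    hf.integrable_smul_right_of_hasCompactSupport (hχ.continuous.mul ca) hc.mul_right
  have i3 : Integrable (fun x => α x * χ x * g x) μ :=
    hg.integrable_smul_left_of_hasCompactSupport (hα.continuous.mul hχ.continuous) hc.mul_left
  rw [integral_add i1 i2] at h1
  have e1 : ∫ x, α x * f x * fderiv ℝ χ x v ∂μ = ∫ x, f x * (α x * fderiv ℝ χ x v) ∂μ := by
    congr 1; ext x; ring
  have e2 : ∫ x, χ x * (α x * g x + fderiv ℝ α x v * f x) ∂μ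
      = ∫ x, α x * χ x * g x ∂μ + ∫ x, f x * (χ x * fderiv ℝ α x v) ∂μ := by
    rw [← integral_add i3 i2]
    congr 1; ext x; ring
  rw [e1, e2]
  linarith

/-- Chain rule for weak derivatives. -/
lemma HasWeakDeriv.comp {f g : X → ℝ} {v : X} (h : HasWeakDeriv μ v f g)
    (hf : LocallyIntegrable f μ) (hg : MemLp g 2 μ) {p p' : ℝ → ℝ}
    (hp : ∀ s, HasDerivAt p (p' s) s) (hp' : Continuous p') {C₀ C₁ : ℝ}
    (hC₀ : ∀ s, |p s| ≤ C₀) (hC₁ : ∀ s, |p' s| ≤ C₁) :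
    HasWeakDeriv μ v (fun x => p (f x)) (fun x => p' (f x) * g x) := by
  intro χ hχ hc
  have pc : Continuous p := continuous_iff_continuousAt.2 fun s => (hp s).continuousAt
  set κ : ℕ → X → ℝ := fun k => (bumpSeq X k).normed μ with hκ
  have κs : ∀ k, ContDiff ℝ ∞ (κ k) := fun k => (bumpSeq X k).contDiff_normed
  have κc : ∀ k, HasCompactSupport (κ k) := fun k => (bumpSeq X k).hasCompactSupport_normed
  have κi : ∀ k, Integrable (κ k) μ := fun k => (bumpSeq X k).integrable_normed
  set F : ℕ → X → ℝ := fun k => κ k ⋆[lsmul ℝ ℝ, μ] f with hF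
  have Fs : ∀ k, ContDiff ℝ ∞ (F k) := fun k => (κc k).contDiff_convolution_left _ (κs k) hf
  -- Almost everywhere convergence needs bumps with `rOut ≤ K * rIn`; here the ratio is exactly 2.
  have Ft : ∀ᵐ x ∂μ, Tendsto (fun k => F k x) atTop (𝓝 (f x)) :=
    ContDiffBump.ae_convolution_tendsto_right_of_locallyIntegrable (K := 2)
      tendsto_bumpSeq_rOut (Eventually.of_forall fun k => by simp [bumpSeq]; rfl) hf
  have cχ : Continuous fun x => fderiv ℝ χ x v :=
    (hχ.continuous_fderiv (by simp)).clm_apply continuous_const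
  have hcd : HasCompactSupport fun x => fderiv ℝ χ x v := hc.fderiv_apply ℝ v
  have χ2 : MemLp χ 2 μ := hχ.continuous.memLp_of_hasCompactSupport hc
  have bm : ∀ k, MemLp (fun x => χ x * p' (F k x)) 2 μ := fun k =>
    (hχ.continuous.mul (hp'.comp (Fs k).continuous)).memLp_of_hasCompactSupport hc.mul_right
  have fm : AEStronglyMeasurable f μ := hf.aestronglyMeasurable
  have b0 : MemLp (fun x => χ x * p' (f x)) 2 μ := by
    refine (χ2.norm.const_mul C₁).mono
      (χ2.1.mul (hp'.comp_aestronglyMeasurable fm)) (Eventually.of_forall fun x => ?_)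
    have h1 := hC₁ (f x)
    have h0 : 0 ≤ C₁ := (abs_nonneg _).trans h1
    simp only [norm_mul, Real.norm_eq_abs, abs_abs, abs_of_nonneg h0]
    nlinarith [abs_nonneg (χ x)]
  -- The classical chain rule for the mollification `F k` has derivative `p' (F k)` times the
  -- mollified `g`. Replacing `p' (F k)` by `p' f` leaves a correlation with a fixed function, plus
  -- an error that is small in L².
  have key : ∀ k, ∫ x, p (F k x) * fderiv ℝ χ x v ∂μ
      = - ((∫ z, κ k z * corr μ (fun x => χ x * p' (f x)) g z ∂μ)
        + ∫ z, κ k z * corr μ (fun x => χ x * p' (F k x) - χ x * p' (f x)) g z ∂μ) := by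
    intro k
    have hd : ∀ x, fderiv ℝ (fun x => p (F k x)) x v
        = p' (F k x) * (κ k ⋆[lsmul ℝ ℝ, μ] g) x := by
      intro x
      have h1 : HasFDerivAt (F k) (fderiv ℝ (F k) x) x :=
        ((Fs k).differentiable (by simp)).differentiableAt.hasFDerivAt
      have h2 := (hp (F k x)).comp_hasFDerivAt x h1
      change fderiv ℝ (p ∘ F k) x v = _
      rw [h2.fderiv, ← h.fderiv_convolution (κs k) (κc k) hf x]
      rfl
    have pF : Continuous fun x => p (F k x) := pc.comp (Fs k).continuous
    have cκg : Continuous (κ k ⋆[lsmul ℝ ℝ, μ] g) :=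
      (κc k).continuous_convolution_left _ (κs k).continuous (hg.locallyIntegrable (by simp))
    have ibp := integral_mul_fderiv_eq_neg_fderiv_mul_of_integrable (μ := μ)
      (f := fun x => p (F k x)) (g := χ) (v := v)
      (by
        simp only [hd]
        exact (((hp'.comp (Fs k).continuous).mul cκg).mul
          hχ.continuous).integrable_of_hasCompactSupport hc.mul_left)
      ((pF.mul cχ).integrable_of_hasCompactSupport hcd.mul_left)
      ((pF.mul hχ.continuous).integrable_of_hasCompactSupport hc.mul_left)
      (fun x _ => ((hp (F k x)).comp_hasFDerivAt x
        ((Fs k).differentiable (by simp)).differentiableAt.hasFDerivAt).differentiableAt)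
      (fun x _ => (hχ.differentiable (by simp)).differentiableAt)
    have e1 := integral_mul_convolution (κi k)
      (f := fun x => χ x * p' (F k x) - χ x * p' (f x)) ((bm k).sub b0) hg
    have i0 : Integrable (fun x => χ x * (κ k ⋆[lsmul ℝ ℝ, μ] g) x) μ :=
      (hχ.continuous.mul cκg).integrable_of_hasCompactSupport hc.mul_right
    have i1 : Integrable (fun x => χ x * p' (f x) * (κ k ⋆[lsmul ℝ ℝ, μ] g) x) μ := by
      refine (i0.bdd_mul (c := C₁) (hp'.comp_aestronglyMeasurable fm)
        (Eventually.of_forall fun x => hC₁ (f x))).congr (Eventually.of_forall fun x => ?_)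
      simp only []
      ring
    have i2 : Integrable (fun x => χ x * p' (F k x) * (κ k ⋆[lsmul ℝ ℝ, μ] g) x) μ := by
      refine (i0.bdd_mul (c := C₁) (hp'.comp (Fs k).continuous).aestronglyMeasurable
        (Eventually.of_forall fun x => hC₁ (F k x))).congr (Eventually.of_forall fun x => ?_)
      simp only [Function.comp_apply]
      ring
    rw [ibp, ← integral_mul_convolution (κi k) b0 hg, ← e1, ← integral_add i1]
    · congr 1
      refine integral_congr_ae (Eventually.of_forall fun x => ?_)
      simp only [hd]
      ring
    · refine (i2.sub i1).congr (Eventually.of_forall fun x => ?_)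
      simp only [Pi.sub_apply]
      ring
  have c1 : Tendsto (fun k => ∫ x, p (F k x) * fderiv ℝ χ x v ∂μ) atTop
      (𝓝 (∫ x, p (f x) * fderiv ℝ χ x v ∂μ)) := by
    refine tendsto_integral_of_dominated_convergence (fun x => C₀ * ‖fderiv ℝ χ x v‖)
      (fun k => ((pc.comp (Fs k).continuous).mul cχ).aestronglyMeasurable)
      ((cχ.norm.integrable_of_hasCompactSupport hcd.norm).const_mul _)
      (fun k => Eventually.of_forall fun x => ?_) ?_
    · rw [norm_mul]
      exact mul_le_mul_of_nonneg_right (hC₀ _) (norm_nonneg _)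
    · filter_upwards [Ft] with x hx
      exact ((pc.tendsto _).comp hx).mul_const _
  have c2 : Tendsto (fun k => ∫ z, κ k z * corr μ (fun x => χ x * p' (f x)) g z ∂μ) atTop
      (𝓝 (corr μ (fun x => χ x * p' (f x)) g 0)) :=
    tendsto_integral_bump_mul tendsto_bumpSeq_rOut (continuous_corr b0 hg)
  -- The error correlation is bounded, uniformly in the shift, by a product of L² norms whose first
  -- factor tends to zero by dominated convergence.
  have c3 : Tendsto (fun k => ∫ z, κ k z *
      corr μ (fun x => χ x * p' (F k x) - χ x * p' (f x)) g z ∂μ) atTop (𝓝 0) := by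
    have hn : Tendsto (fun k => eLpNorm (fun x => χ x * p' (F k x) - χ x * p' (f x)) 2 μ)
        atTop (𝓝 0) := by
      refine tendsto_eLpNorm_two_zero (D := fun x => 2 * C₁ * |χ x|)
        (fun k => ((bm k).sub b0).1) (χ2.norm.const_mul _) (fun k => ?_) ?_
      · refine Eventually.of_forall fun x => ?_
        have h1 := hC₁ (f x)
        have h2 := hC₁ (F k x)
        rw [← mul_sub, norm_mul, mul_comm, Real.norm_eq_abs, Real.norm_eq_abs]
        refine mul_le_mul_of_nonneg_right ?_ (abs_nonneg _)
        rw [two_mul]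
        exact (abs_sub _ _).trans (add_le_add h2 h1)
      · filter_upwards [Ft] with x hx
        have := (((hp'.tendsto _).comp hx).const_mul (χ x)).sub_const (χ x * p' (f x))
        simpa using this
    have hn2 := ((ENNReal.tendsto_toReal ENNReal.zero_ne_top).comp hn).mul_const
      (eLpNorm g 2 μ).toReal
    simp only [ENNReal.toReal_zero, zero_mul] at hn2
    refine squeeze_zero_norm (fun k => ?_) hn2
    have hb := fun z => abs_corr_le ((bm k).sub b0) hg z
    refine (norm_integral_le_integral_norm _).trans ?_
    have : ∀ z, ‖κ k z * corr μ (fun x => χ x * p' (F k x) - χ x * p' (f x)) g z‖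
        ≤ κ k z * ((eLpNorm (fun x => χ x * p' (F k x) - χ x * p' (f x)) 2 μ).toReal
          * (eLpNorm g 2 μ).toReal) := fun z => by
      have h0 : 0 ≤ κ k z := (bumpSeq X k).nonneg_normed z
      rw [norm_mul, Real.norm_of_nonneg h0]
      exact mul_le_mul_of_nonneg_left (hb z) h0
    refine (integral_mono_of_nonneg (Eventually.of_forall fun z => norm_nonneg _)
      ((κi k).mul_const _) (Eventually.of_forall this)).trans ?_
    rw [integral_mul_const, (bumpSeq X k).integral_normed, one_mul]
    rfl
  have := tendsto_nhds_unique c1 (((c2.add c3).neg).congr fun k => (key k).symm)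
  rw [this, add_zero, corr]
  simp [mul_assoc]

/-- Mollification turns weak derivatives into correlations. -/
lemma integral_mul_corr_eq {f ξ H : X → ℝ} {v : X} (hf : MemLp f 2 μ) (hξ : MemLp ξ 2 μ)
    (hH : MemLp H 2 μ) (hw : HasWeakDeriv μ v ξ H) {κ : X → ℝ} (hκ : ContDiff ℝ ∞ κ)
    (hc : HasCompactSupport κ) :
    ∫ z, κ z * corr μ f H z ∂μ
      = ∫ x, f x * fderiv ℝ (κ ⋆[lsmul ℝ ℝ, μ] ξ) x v ∂μ := by
  rw [← integral_mul_convolution (hκ.continuous.integrable_of_hasCompactSupport hc) hf hH]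
  simp only [hw.fderiv_convolution hκ hc (hξ.locallyIntegrable (by simp))]

lemma tsupport_convolution_subset {κ ξ : X → ℝ} {Q Z : Set X} {r : ℝ}
    (hQ : Function.support ξ ⊆ Q) (hZ : Metric.cthickening r Q ⊆ Z)
    (hκ : Function.support κ ⊆ Metric.ball 0 r) :
    tsupport (κ ⋆[lsmul ℝ ℝ, μ] ξ) ⊆ Z := by
  refine (closure_mono ?_).trans ((Metric.closure_thickening_subset_cthickening r Q).trans hZ)
  refine (support_convolution_subset (lsmul ℝ ℝ)).trans ?_
  rintro _ ⟨a, ha, b, hb, rfl⟩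
  refine Metric.mem_thickening_iff.2 ⟨b, hQ hb, ?_⟩
  have := hκ ha
  simpa [dist_eq_norm] using this

lemma contDiff_convolution_compact {κ ξ : X → ℝ} {Q : Set X} (hQ : Function.support ξ ⊆ Q)
    (hQc : IsCompact Q) (hξ : MemLp ξ 2 μ) (hκ : ContDiff ℝ ∞ κ) (hc : HasCompactSupport κ) :
    ContDiff ℝ ∞ (κ ⋆[lsmul ℝ ℝ, μ] ξ) ∧ HasCompactSupport (κ ⋆[lsmul ℝ ℝ, μ] ξ) :=
  ⟨hc.contDiff_convolution_left _ hκ (hξ.locallyIntegrable (by simp)),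
    hc.convolution _ (HasCompactSupport.of_support_subset_isCompact hQc hQ)⟩

variable {ι : Type*} [Fintype ι]

/-- A distributional identity `div F = g` may be tested against compactly supported weakly
differentiable functions. -/
lemma sum_integral_mul_weakDeriv {F H : ι → X → ℝ} {v : ι → X} {g ξ : X → ℝ} {Q Z : Set X}
    {r : ℝ} (hr : 0 < r) (hQc : IsCompact Q) (hQ : Function.support ξ ⊆ Q)
    (hZ : Metric.cthickening r Q ⊆ Z) (hF : ∀ i, MemLp (F i) 2 μ) (hg : MemLp g 2 μ)
    (hξ : MemLp ξ 2 μ) (hH : ∀ i, MemLp (H i) 2 μ) (hw : ∀ i, HasWeakDeriv μ (v i) ξ (H i))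
    (hid : ∀ χ : X → ℝ, ContDiff ℝ ∞ χ → HasCompactSupport χ → tsupport χ ⊆ Z →
      ∑ i, ∫ x, F i x * fderiv ℝ χ x (v i) ∂μ = - ∫ x, g x * χ x ∂μ) :
    ∑ i, ∫ x, F i x * H i x ∂μ = - ∫ x, g x * ξ x ∂μ := by
  have t1 : Tendsto (fun k => ∑ i, ∫ z, (bumpSeq X k).normed μ z * corr μ (F i) (H i) z ∂μ)
      atTop (𝓝 (∑ i, corr μ (F i) (H i) 0)) :=
    tendsto_finsetSum _ fun i _ =>
      tendsto_integral_bump_mul tendsto_bumpSeq_rOut (continuous_corr (hF i) (hH i))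
  have t2 : Tendsto (fun k => - ∫ z, (bumpSeq X k).normed μ z * corr μ g ξ z ∂μ)
      atTop (𝓝 (- corr μ g ξ 0)) :=
    (tendsto_integral_bump_mul tendsto_bumpSeq_rOut (continuous_corr hg hξ)).neg
  have he : ∀ᶠ k in atTop,
      - ∫ z, (bumpSeq X k).normed μ z * corr μ g ξ z ∂μ
        = ∑ i, ∫ z, (bumpSeq X k).normed μ z * corr μ (F i) (H i) z ∂μ := by
    -- Once the bump radius is below `r`, the mollified `ξ` is a smooth test function supported in
    -- `Z`.
    filter_upwards [(tendsto_bumpSeq_rOut (X := X)).eventually_lt_const hr] with k hk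
    have κs : ContDiff ℝ ∞ ((bumpSeq X k).normed μ) := (bumpSeq X k).contDiff_normed
    have κc := (bumpSeq X k).hasCompactSupport_normed (μ := μ)
    obtain ⟨h1, h2⟩ := contDiff_convolution_compact hQ hQc hξ κs κc
    simp only [fun i => integral_mul_corr_eq (hF i) hξ (hH i) (hw i) κs κc]
    rw [hid _ h1 h2 (tsupport_convolution_subset hQ hZ ?_),
      integral_mul_convolution (bumpSeq X k).integrable_normed hg hξ]
    rw [ContDiffBump.support_normed_eq]
    exact Metric.ball_subset_ball hk.le
  have := tendsto_nhds_unique t1 (t2.congr' he)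
  simpa [corr] using this

/-- If `∂ₑ a = div F` in the sense of distributions, then the difference quotients of `a` in the
direction `e`, tested against a compactly supported weakly differentiable function, converge to
the value that the equation predicts. -/
lemma tendsto_difference_quotient {F H : ι → X → ℝ} {v : ι → X} {e : X} {a ζ : X → ℝ}
    {Q Z : Set X} {r : ℝ} (hr : 0 < r) (hQc : IsCompact Q) (hQ : Function.support ζ ⊆ Q)
    (hZ : Metric.cthickening r Q ⊆ Z) (hF : ∀ i, MemLp (F i) 2 μ) (ha : MemLp a 2 μ)
    (hζ : MemLp ζ 2 μ) (hH : ∀ i, MemLp (H i) 2 μ) (hw : ∀ i, HasWeakDeriv μ (v i) ζ (H i))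
    (hid : ∀ χ : X → ℝ, ContDiff ℝ ∞ χ → HasCompactSupport χ → tsupport χ ⊆ Z →
      ∑ i, ∫ x, F i x * fderiv ℝ χ x (v i) ∂μ = ∫ x, a x * fderiv ℝ χ x e ∂μ) :
    Tendsto (fun δ : ℝ => δ⁻¹ * (corr μ a ζ 0 - corr μ a ζ (-(δ • e)))) (𝓝[>] 0)
      (𝓝 (- ∑ i, ∫ x, F i x * H i x ∂μ)) := by
  set R : X → ℝ := corr μ a ζ with hR
  set q : X → ℝ := fun z => ∑ i, corr μ (F i) (H i) z with hq
  have Rc : Continuous R := continuous_corr ha hζ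
  have qc : Continuous q := continuous_finsetSum _ fun i _ => continuous_corr (hF i) (hH i)
  have q0 : q 0 = ∑ i, ∫ x, F i x * H i x ∂μ := by simp [hq, corr]
  rw [← q0]
  set κ : ℕ → X → ℝ := fun k => (bumpSeq X k).normed μ with hκ
  have κs : ∀ k, ContDiff ℝ ∞ (κ k) := fun k => (bumpSeq X k).contDiff_normed
  have κc : ∀ k, HasCompactSupport (κ k) := fun k => (bumpSeq X k).hasCompactSupport_normed
  have κi : ∀ k, Integrable (κ k) μ := fun k => (bumpSeq X k).integrable_normed
  -- Testing the equation with mollifications of `ζ` by the shifted bump shows that `R` has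
  -- derivative `-q` along `e` near `0`, after mollification. The condition on `x` keeps these test
  -- functions supported in `Z`.
  have hder : ∀ k x, ‖x‖ + (bumpSeq X k).rOut < r →
      fderiv ℝ (κ k ⋆[lsmul ℝ ℝ, μ] R) x e = - (κ k ⋆[lsmul ℝ ℝ, μ] q) x := by
    intro k x hx
    rw [fderiv_convolution_apply (κs k) (κc k) Rc.locallyIntegrable, convolution_eq_swap,
      convolution_eq_swap]
    set K : X → ℝ := fun z => κ k (x - z) with hK
    have Ks : ContDiff ℝ ∞ K := (κs k).comp (contDiff_const.sub contDiff_id)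
    have Kc : HasCompactSupport K := (κc k).comp_homeomorph (Homeomorph.subLeft x)
    have Ki : Integrable K μ := Ks.continuous.integrable_of_hasCompactSupport Kc
    have Ksupp : Function.support K ⊆ Metric.ball 0 r := by
      intro z hz
      have h1 : x - z ∈ Function.support (κ k) := hz
      rw [hκ, ContDiffBump.support_normed_eq, mem_ball_zero_iff] at h1
      rw [mem_ball_zero_iff]
      have := norm_sub_norm_le z x
      rw [← norm_neg (z - x), neg_sub] at this
      linarith
    have hd : ∀ z, fderiv ℝ K z e = - fderiv ℝ (κ k) (x - z) e := by
      intro z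
      have h1 : HasFDerivAt (κ k) (fderiv ℝ (κ k) (x - z)) (x - z) :=
        ((κs k).differentiable (by simp)).differentiableAt.hasFDerivAt
      have := h1.comp z ((hasFDerivAt_id z).const_sub x)
      change fderiv ℝ (κ k ∘ fun y => x - y) z e = _
      rw [this.fderiv]
      simp
    have Kd : ContDiff ℝ ∞ fun z => fderiv ℝ K z e :=
      (Ks.fderiv_right (m := ∞) (by simp)).clm_apply contDiff_const
    have Kdc : HasCompactSupport fun z => fderiv ℝ K z e := Kc.fderiv_apply ℝ e
    obtain ⟨h1, h2⟩ := contDiff_convolution_compact hQ hQc hζ Ks Kc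
    have h3 := hid _ h1 h2 (tsupport_convolution_subset hQ hZ Ksupp)
    have h4 : ∀ i, ∫ z, K z * corr μ (F i) (H i) z ∂μ = _ := fun i =>
      integral_mul_corr_eq (hF i) hζ (hH i) (hw i) Ks Kc
    simp only [← h4] at h3
    simp only [fderiv_convolution_apply Ks Kc (hζ.locallyIntegrable (by simp))] at h3
    rw [integral_mul_convolution (Kd.continuous.integrable_of_hasCompactSupport Kdc) ha hζ,
      ← integral_finsetSum] at h3
    · simp only [hd, neg_mul, integral_neg, ← Finset.mul_sum] at h3
      simp only [lsmul_apply, smul_eq_mul]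
      rw [← neg_eq_iff_eq_neg]
      exact h3.symm
    · intro i _
      exact (Ks.continuous.mul (continuous_corr (hF i) (hH i))).integrable_of_hasCompactSupport
        Kc.mul_right
  rw [Metric.tendsto_nhds]
  intro η hη
  obtain ⟨s, hs, hqs⟩ := Metric.continuous_iff.1 qc 0 (η / 2) (by positivity)
  -- Half of the margin is for the segment from `-(δ • e)` to `0`, half for the radius of the bump.
  have he : 0 < min r s / 2 := by positivity
  have hlt : ∀ᶠ δ : ℝ in 𝓝[>] 0, δ * ‖e‖ < min r s / 2 := by
    have : Tendsto (fun δ : ℝ => δ * ‖e‖) (𝓝[>] 0) (𝓝 0) := by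
      have := (tendsto_id (α := ℝ) (x := 𝓝 0)).mul_const ‖e‖
      simp only [zero_mul] at this
      exact this.mono_left nhdsWithin_le_nhds
    exact this.eventually_lt_const he
  filter_upwards [hlt, self_mem_nhdsWithin] with δ hδ (hδ0 : 0 < δ)
  -- Mean value inequality on the segment, where the mollified `q` stays within `η / 2` of `q 0`.
  -- The estimate is uniform in `k`, so it survives the limit that removes the mollifier.
  have main : ∀ᶠ k in atTop, |(κ k ⋆[lsmul ℝ ℝ, μ] R) 0 - (κ k ⋆[lsmul ℝ ℝ, μ] R) (-(δ • e))
      + δ * q 0| ≤ η / 2 * δ := by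
    filter_upwards [(tendsto_bumpSeq_rOut (X := X)).eventually_lt_const he] with k hk
    have hn : ∀ t ∈ Icc (-δ) 0, ‖t • e‖ < min r s / 2 := by
      intro t ht
      rw [norm_smul, Real.norm_eq_abs, abs_of_nonpos ht.2]
      refine lt_of_le_of_lt ?_ hδ
      exact mul_le_mul_of_nonneg_right (by linarith [ht.1]) (norm_nonneg _)
    have hder2 : ∀ t ∈ Icc (-δ) 0, HasDerivWithinAt
        (fun t : ℝ => (κ k ⋆[lsmul ℝ ℝ, μ] R) (t • e) + t * q 0)
        (- (κ k ⋆[lsmul ℝ ℝ, μ] q) (t • e) + q 0) (Icc (-δ) 0) t := by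
      intro t ht
      have h1 : HasFDerivAt (κ k ⋆[lsmul ℝ ℝ, μ] R)
          (fderiv ℝ (κ k ⋆[lsmul ℝ ℝ, μ] R) (t • e)) (t • e) :=
        (((κc k).contDiff_convolution_left (n := ⊤) (lsmul ℝ ℝ) (κs k)
          Rc.locallyIntegrable).differentiable (by simp)).differentiableAt.hasFDerivAt
      have h2 : HasDerivAt (fun t : ℝ => t • e) e t := by
        simpa using (hasDerivAt_id t).smul_const e
      have h3 := h1.comp_hasDerivAt t h2
      rw [hder k (t • e) (by
        have := hn t ht
        have := min_le_left r s
        linarith)] at h3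
      have h4 : HasDerivAt (fun t : ℝ => t * q 0) (q 0) t := by
        simpa using (hasDerivAt_id t).mul_const (q 0)
      exact (h3.add h4).hasDerivWithinAt
    have hbd : ∀ t ∈ Ico (-δ) 0, ‖- (κ k ⋆[lsmul ℝ ℝ, μ] q) (t • e) + q 0‖ ≤ η / 2 := by
      intro t ht
      have h1 : dist ((κ k ⋆[lsmul ℝ ℝ, μ] q) (t • e)) (q 0) ≤ η / 2 := by
        refine dist_convolution_le (by positivity)
          ((bumpSeq X k).support_normed_eq.subset) (bumpSeq X k).nonneg_normed
          (bumpSeq X k).integral_normed qc.aestronglyMeasurable fun x hx => ?_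
        refine (hqs x ?_).le
        have h2 := hn t (Ico_subset_Icc_self ht)
        have h3 : dist x 0 ≤ dist x (t • e) + dist (t • e) 0 := dist_triangle _ _ _
        rw [dist_zero_right (t • e)] at h3
        have h4 : dist x (t • e) < (bumpSeq X k).rOut := hx
        have := min_le_right r s
        linarith
      rw [neg_add_eq_sub, ← dist_eq_norm, dist_comm]
      exact h1
    have := norm_image_sub_le_of_norm_deriv_le_segment' hder2 hbd 0
      (right_mem_Icc.2 (by linarith))
    simp only [zero_smul, zero_mul, add_zero, neg_smul, sub_neg_eq_add, zero_add,
      Real.norm_eq_abs] at this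
    convert this using 2
    ring
  have lim := fun x => ContDiffBump.convolution_tendsto_right_of_continuous (μ := μ)
    tendsto_bumpSeq_rOut Rc x
  have fin := le_of_tendsto (((lim 0).sub (lim (-(δ • e)))).add_const (δ * q 0)).abs main
  rw [Real.dist_eq, sub_neg_eq_add]
  have e2 : δ⁻¹ * (R 0 - R (-(δ • e))) + q 0 = δ⁻¹ * (R 0 - R (-(δ • e)) + δ * q 0) := by
    field_simp
  rw [e2, abs_mul, abs_of_pos (inv_pos.2 hδ0)]
  calc δ⁻¹ * |R 0 - R (-(δ • e)) + δ * q 0| ≤ δ⁻¹ * (η / 2 * δ) := by gcongr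
    _ = η / 2 := by field_simp
    _ < η := by linarith

end WeakDerivativeCalculus

end AggregationDiffusion

end

noncomputable section

namespace AggregationDiffusion

open Filter Topology

/-! ### Polar coordinates and the divergence of radial power fields. -/

section Polar

variable {F : Type*} [NormedAddCommGroup F] [NormedSpace ℝ F] [FiniteDimensional ℝ F]
  [MeasurableSpace F] [BorelSpace F] [Nontrivial F] (μ : Measure F) [μ.IsAddHaarMeasure]

/-- Integration in polar coordinates. -/
lemma integral_polar {f : F → ℝ} (hf : Integrable f μ) :
    (∀ᵐ w : Metric.sphere (0 : F) 1 ∂μ.toSphere, IntegrableOn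
      (fun r : ℝ => r ^ (Module.finrank ℝ F - 1) * f (r • (w : F))) (Ioi 0)) ∧
    ∫ x, f x ∂μ = ∫ w, (∫ r in Ioi (0 : ℝ),
      r ^ (Module.finrank ℝ F - 1) * f (r • (w : F))) ∂μ.toSphere := by
  have mp := μ.measurePreserving_homeomorphUnitSphereProd
  have me := (homeomorphUnitSphereProd F).measurableEmbedding
  let g : Metric.sphere (0 : F) 1 × Ioi (0 : ℝ) → ℝ := fun p => f (p.2.1 • (p.1 : F))
  have hg : (g ∘ homeomorphUnitSphereProd F) = fun x : ({0}ᶜ : Set F) => f x := by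
    ext x
    have hx : ‖(x : F)‖ ≠ 0 := norm_ne_zero_iff.2 x.2
    simp [g, smul_smul, hx]
  have hgi : Integrable g (μ.toSphere.prod (.volumeIoiPow (Module.finrank ℝ F - 1))) := by
    rw [← mp.integrable_comp_emb me, hg]
    have : IntegrableOn f {0}ᶜ μ := hf.integrableOn
    rwa [integrableOn_iff_comap_subtypeVal (measurableSet_singleton _).compl] at this
  have hpow : ∀ h : Ioi (0 : ℝ) → ℝ,
      ∫ r, h r ∂(.volumeIoiPow (Module.finrank ℝ F - 1))
        = ∫ r : Ioi (0 : ℝ), r.1 ^ (Module.finrank ℝ F - 1) * h r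
            ∂(Measure.comap Subtype.val volume) := by
    intro h
    simp only [Measure.volumeIoiPow, ENNReal.ofReal]
    rw [integral_withDensity_eq_integral_smul]
    · refine integral_congr_ae (Eventually.of_forall fun r => ?_)
      simp only []
      rw [NNReal.smul_def, Real.coe_toNNReal _ (pow_nonneg r.2.out.le _), smul_eq_mul]
    · exact (measurable_subtype_coe.pow_const _).real_toNNReal
  constructor
  · filter_upwards [hgi.prod_right_ae] with w hw
    rw [integrableOn_iff_comap_subtypeVal measurableSet_Ioi]
    rw [Measure.volumeIoiPow, integrable_withDensity_iff_integrable_smul'] at hw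
    · refine hw.congr (Eventually.of_forall fun r => ?_)
      have : 0 ≤ r.1 ^ (Module.finrank ℝ F - 1) := pow_nonneg r.2.out.le _
      simp [g, ENNReal.toReal_ofReal this]
    · fun_prop
    · simp
  · calc ∫ x, f x ∂μ = ∫ x : ({(0)}ᶜ : Set F), f x ∂(μ.comap (↑)) := by
          rw [integral_subtype_comap (measurableSet_singleton _).compl f, restrict_compl_singleton]
      _ = ∫ p, g p ∂(μ.toSphere.prod (.volumeIoiPow (Module.finrank ℝ F - 1))) := by
          rw [← mp.integral_comp me g]
          exact congrArg (fun h => ∫ x, h x ∂(μ.comap Subtype.val)) hg.symm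
      _ = _ := by
          rw [integral_prod _ hgi]
          congr 1
          ext w
          rw [hpow]
          exact integral_subtype_comap measurableSet_Ioi
            fun r => r ^ (Module.finrank ℝ F - 1) * f (r • (w : F))

/-- The fields `|x| ^ (a - d) x` and their divergence, tested against a smooth function. -/
lemma integral_norm_rpow_mul_fderiv_add {a : ℝ} (ha : 0 ≤ a) {χ : F → ℝ} (hχ : ContDiff ℝ ∞ χ)
    (hc : HasCompactSupport χ) :
    Integrable (fun x => ‖x‖ ^ (a - Module.finrank ℝ F) * fderiv ℝ χ x x) μ ∧
    Integrable (fun x => a * (‖x‖ ^ (a - Module.finrank ℝ F) * χ x)) μ ∧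
    ∫ x, ‖x‖ ^ (a - Module.finrank ℝ F) * fderiv ℝ χ x x ∂μ
      = - ∫ x, a * (‖x‖ ^ (a - Module.finrank ℝ F) * χ x) ∂μ
        - (0 : ℝ) ^ a * (μ.toSphere.real univ * χ 0) := by
  set d := Module.finrank ℝ F with hd
  have d1 : 1 ≤ d := Module.finrank_pos
  have hm : ∀ s : ℝ, Measurable fun x : F => ‖x‖ ^ s := fun s =>
    measurable_norm.pow_const s
  -- The derivative is taken in the direction `x`, which gains a factor `‖x‖`. The singularity is
  -- then of order `d - a - 1 < d`, including the case `a = 0`.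
  have i1 : Integrable (fun x => ‖x‖ ^ (a - d) * fderiv ℝ χ x x) μ := by
    obtain ⟨C, hC⟩ := (hc.fderiv ℝ).exists_bound_of_continuous
      (hχ.continuous_fderiv (by simp))
    have hcd : Continuous fun x => fderiv ℝ χ x x :=
      (hχ.continuous_fderiv (by simp)).clm_apply continuous_id
    have hl : LocallyIntegrable (fun x => ‖x‖ ^ (a - d) * fderiv ℝ χ x x) μ := by
      refine locallyIntegrable_of_norm_le_rpow (C := C) (α := d - a - 1) d1 (by rw [← hd]; linarith)
        ?_ ((hm _).aestronglyMeasurable.mul hcd.aestronglyMeasurable)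
      have : ∀ᵐ x ∂μ, x ≠ 0 := by simp [ae_iff]
      filter_upwards [this] with x hx
      have hx0 : 0 < ‖x‖ := norm_pos_iff.2 hx
      have e : ‖x‖ ^ (-((d : ℝ) - a - 1)) = ‖x‖ ^ (a - d) * ‖x‖ := by
        rw [← Real.rpow_add_one hx0.ne']
        congr 1
        ring
      rw [norm_mul, Real.norm_of_nonneg (by positivity), e]
      have := (ContinuousLinearMap.le_opNorm (fderiv ℝ χ x) x).trans
        (mul_le_mul_of_nonneg_right (hC x) (norm_nonneg x))
      calc ‖x‖ ^ (a - d) * ‖fderiv ℝ χ x x‖ ≤ ‖x‖ ^ (a - d) * (C * ‖x‖) := by gcongr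
        _ = _ := by ring
    refine (integrableOn_iff_integrable_of_support_subset ?_).1
      (hl.integrableOn_isCompact (hc.fderiv ℝ))
    intro x hx
    refine subset_tsupport _ fun h => hx ?_
    simp [h]
  have i2 : Integrable (fun x => a * (‖x‖ ^ (a - d) * χ x)) μ := by
    -- For `a = 0` the power is not integrable at the origin, but the factor `a` removes it.
    rcases ha.eq_or_lt with rfl | ha
    · simp
    · refine Integrable.const_mul ?_ a
      have hl : LocallyIntegrable (fun x : F => ‖x‖ ^ (a - d)) μ := by
        refine locallyIntegrable_of_norm_le_rpow (C := 1) (α := d - a) d1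
          (by rw [← hd]; linarith) (Eventually.of_forall fun x => ?_) (hm _).aestronglyMeasurable
        rw [Real.norm_of_nonneg (by positivity), one_mul, neg_sub]
      exact hl.integrable_smul_right_of_hasCompactSupport hχ.continuous hc
  refine ⟨i1, i2, ?_⟩
  rw [eq_sub_iff_add_eq', eq_neg_iff_add_eq_zero, add_assoc, ← integral_add i1 i2]
  obtain ⟨h1, h2⟩ := integral_polar μ (i1.add i2)
  simp only [Pi.add_apply] at h1 h2
  rw [h2, add_comm, ← eq_neg_iff_add_eq_zero]
  -- On each ray the integrand is the derivative of `r ^ a * χ (r • w)`. Only the endpoint `r = 0`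
  -- contributes, and since `0 ^ 0 = 1` it gives a Dirac mass precisely when `a = 0`.
  have key : ∀ᵐ w : Metric.sphere (0 : F) 1 ∂μ.toSphere, ∫ r in Ioi (0 : ℝ), r ^ (d - 1) *
      (‖r • (w : F)‖ ^ (a - d) * fderiv ℝ χ (r • (w : F)) (r • (w : F))
        + a * (‖r • (w : F)‖ ^ (a - d) * χ (r • (w : F)))) = - ((0 : ℝ) ^ a * χ 0) := by
    filter_upwards [h1] with w hw
    have hwn : ‖(w : F)‖ = 1 := by simp
    have hderiv : ∀ r ∈ Ioi (0 : ℝ), HasDerivAt (fun r : ℝ => r ^ a * χ (r • (w : F)))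
        (r ^ (d - 1) * (‖r • (w : F)‖ ^ (a - d) * fderiv ℝ χ (r • (w : F)) (r • (w : F))
        + a * (‖r • (w : F)‖ ^ (a - d) * χ (r • (w : F))))) r := by
      intro r (hr : 0 < r)
      have e1 : HasDerivAt (fun r : ℝ => r • (w : F)) (w : F) r := by
        simpa using (hasDerivAt_id r).smul_const (w : F)
      have e2 : HasFDerivAt χ (fderiv ℝ χ (r • (w : F))) (r • (w : F)) :=
        (hχ.differentiable (by simp)).differentiableAt.hasFDerivAt
      have e3 := (Real.hasDerivAt_rpow_const (p := a) (Or.inl hr.ne')).mul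
        (e2.comp_hasDerivAt r e1)
      refine e3.congr_deriv ?_
      have n1 : ‖r • (w : F)‖ = r := by rw [norm_smul, hwn, mul_one, Real.norm_of_nonneg hr.le]
      have n2 : r ^ (d - 1) * r ^ (a - d) = r ^ (a - 1) := by
        rw [← Real.rpow_natCast, ← Real.rpow_add hr]
        congr 1
        push_cast [d1]
        ring
      have n3 : r ^ (a - 1) * r = r ^ a := by
        rw [← Real.rpow_add_one hr.ne']
        congr 1
        ring
      rw [n1, map_smul, smul_eq_mul, ← n3, ← n2]
      simp only [Function.comp_apply]
      ring
    have hcont : ContinuousWithinAt (fun r : ℝ => r ^ a * χ (r • (w : F))) (Ici 0) 0 := by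
      refine ContinuousAt.continuousWithinAt (ContinuousAt.mul ?_ ?_)
      · exact Real.continuousAt_rpow_const 0 a (Or.inr ha)
      · exact (hχ.continuous.comp (by fun_prop :
          Continuous fun r : ℝ => r • (w : F))).continuousAt
    have hlim : Tendsto (fun r : ℝ => r ^ a * χ (r • (w : F))) atTop (𝓝 0) := by
      obtain ⟨R, hR0, hR⟩ := hc.isBounded.exists_pos_norm_lt
      refine tendsto_const_nhds.congr' ?_
      filter_upwards [eventually_ge_atTop R] with r hr
      have : χ (r • (w : F)) = 0 := by
        by_contra h
        have := hR _ (subset_tsupport _ h)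
        rw [norm_smul, hwn, mul_one, Real.norm_of_nonneg (hR0.le.trans hr)] at this
        linarith
      rw [this, mul_zero]
    have := integral_Ioi_of_hasDerivAt_of_tendsto hcont hderiv hw hlim
    rw [this]
    simp
  rw [integral_congr_ae key]
  simp [Measure.real]
  ring

end Polar

end AggregationDiffusion

end

noncomputable section

namespace AggregationDiffusion

open Filter Topology

/-! ### The interaction kernel: growth of the drift, size of the attraction, and the divergence. -/

section Kernel

variable {n : ℕ} {A B lam : ℝ}

lemma nontrivial_E (hn : 2 ≤ n) : Nontrivial (E n) :=
  Module.nontrivial_of_finrank_pos (R := ℝ) (by simp; omega)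

/-- The explicit form of the gradient of the interaction potential. -/
def kernel (A lam : ℝ) (z : E n) : E n := (‖z‖ ^ (A - 2) - lam * ‖z‖ ^ (-(n : ℝ))) • z

lemma hasDerivAt_powerLaw (a : ℝ) {r : ℝ} (hr : 0 < r) :
    HasDerivAt (powerLaw a) (r ^ (a - 1)) r := by
  by_cases ha : a = 0
  · have : powerLaw a = Real.log := by ext x; simp [powerLaw, ha]
    rw [this, ha, zero_sub, Real.rpow_neg_one]
    exact Real.hasDerivAt_log hr.ne'
  · have : powerLaw a = fun x => x ^ a / a := by ext x; simp [powerLaw, ha]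
    rw [this]
    refine ((Real.hasDerivAt_rpow_const (p := a) (Or.inl hr.ne')).div_const a).congr_deriv ?_
    field_simp

lemma hasFDerivAt_powerLaw_norm (a : ℝ) {z : E n} (hz : z ≠ 0) :
    HasFDerivAt (fun x : E n => powerLaw a ‖x‖) (‖z‖ ^ (a - 2) • innerSL ℝ z) z := by
  have hz0 : 0 < ‖z‖ := norm_pos_iff.2 hz
  have h1 : HasFDerivAt (fun x : E n => ‖x‖) (‖z‖⁻¹ • innerSL ℝ z) z := by
    have h := (hasStrictFDerivAt_norm_sq z).hasFDerivAt.sqrt (by positivity)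
    simp only [Real.sqrt_sq (norm_nonneg _)] at h
    refine h.congr_fderiv ?_
    ext v
    simp
    field_simp
  have h2 := (hasDerivAt_powerLaw a hz0).comp_hasFDerivAt z h1
  refine h2.congr_fderiv ?_
  rw [smul_smul]
  congr 1
  rw [← Real.rpow_neg_one, ← Real.rpow_add hz0]
  congr 1
  ring

lemma gradient_potential (hB : B = 2 - (n : ℝ)) {z : E n} (hz : z ≠ 0) :
    gradient (potential A B lam) z = kernel A lam z := by
  have h := (hasFDerivAt_powerLaw_norm A hz).sub
    ((hasFDerivAt_powerLaw_norm B hz).const_mul lam)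
  have hg : HasGradientAt (potential A B lam) (kernel A lam z) z := by
    rw [hasGradientAt_iff_hasFDerivAt]
    refine h.congr_fderiv ?_
    ext v
    have : B - 2 = -(n : ℝ) := by rw [hB]; ring
    simp [kernel, this]
    ring
  exact hg.gradient

lemma measurable_kernel : Measurable (kernel A lam : E n → E n) := by
  have hm : ∀ s : ℝ, Measurable fun x : E n => ‖x‖ ^ s := fun s => measurable_norm.pow_const s
  exact ((hm _).sub ((hm _).const_mul lam)).smul measurable_id

/-- The value that `gradient` takes at the singularity is irrelevant, since a point is a null set.
-/
lemma drift_eq (hn : 2 ≤ n) (hB : B = 2 - (n : ℝ)) (u : E n → ℝ) (x : E n) :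
    drift A B lam u x = ∫ y, u y • kernel A lam (x - y) := by
  have := nontrivial_E hn
  refine integral_congr_ae ?_
  have : ∀ᵐ y : E n, y ≠ x := by simp [ae_iff]
  filter_upwards [this] with y hy
  rw [gradient_potential hB (sub_ne_zero.2 hy.symm)]

/-- Inside the unit ball the Newtonian singularity dominates because `A > 2 - n`; outside it only
the attractive growth and a constant remain. -/
lemma norm_kernel_le {z : E n} (hn : 2 ≤ n) (hA : 2 - (n : ℝ) < A) (hlam : 0 < lam) :
    ‖kernel A lam z‖ ≤ (Metric.ball (0 : E n) 1).indicator
      (fun z => (1 + lam) * ‖z‖ ^ (1 - (n : ℝ))) z + (‖z‖ ^ max (A - 1) 0 + lam) := by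
  by_cases hz : z = 0
  · subst hz
    have h1 : (0 : ℝ) ≤ (0 : ℝ) ^ max (A - 1) 0 := Real.rpow_nonneg le_rfl _
    have h2 : (0 : ℝ) ≤ (1 + lam) * 0 ^ (1 - (n : ℝ)) :=
      mul_nonneg (by linarith) (Real.rpow_nonneg le_rfl _)
    simp [kernel]
    linarith
  have hz0 : 0 < ‖z‖ := norm_pos_iff.2 hz
  have hn' : (2 : ℝ) ≤ n := by exact_mod_cast hn
  have e1 : ‖z‖ ^ (A - 2) * ‖z‖ = ‖z‖ ^ (A - 1) := by
    rw [← Real.rpow_add_one hz0.ne']; congr 1; ring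
  have e2 : ‖z‖ ^ (-(n : ℝ)) * ‖z‖ = ‖z‖ ^ (1 - (n : ℝ)) := by
    rw [← Real.rpow_add_one hz0.ne']; congr 1; ring
  have p1 : 0 < ‖z‖ ^ (A - 1) := by positivity
  have p2 : 0 < ‖z‖ ^ (1 - (n : ℝ)) := by positivity
  have hk : ‖kernel A lam z‖ ≤ ‖z‖ ^ (A - 1) + lam * ‖z‖ ^ (1 - (n : ℝ)) := by
    rw [kernel, norm_smul, ← e1, ← e2]
    have : ‖‖z‖ ^ (A - 2) - lam * ‖z‖ ^ (-(n : ℝ))‖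
        ≤ ‖z‖ ^ (A - 2) + lam * ‖z‖ ^ (-(n : ℝ)) := by
      refine (norm_sub_le _ _).trans_eq ?_
      rw [Real.norm_of_nonneg (by positivity), Real.norm_of_nonneg (by positivity)]
    refine (mul_le_mul_of_nonneg_right this hz0.le).trans_eq (by ring)
  refine hk.trans ?_
  by_cases hb : ‖z‖ < 1
  · rw [indicator_of_mem (by simpa using hb)]
    have h1 : ‖z‖ ^ (A - 1) ≤ ‖z‖ ^ (1 - (n : ℝ)) :=
      Real.rpow_le_rpow_of_exponent_ge hz0 hb.le (by linarith)
    have h2 : 0 ≤ ‖z‖ ^ max (A - 1) 0 := by positivity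
    linarith
  · rw [indicator_of_notMem (by simpa using hb)]
    have hb' : 1 ≤ ‖z‖ := not_lt.1 hb
    have h1 : ‖z‖ ^ (A - 1) ≤ ‖z‖ ^ max (A - 1) 0 :=
      Real.rpow_le_rpow_of_exponent_le hb' (le_max_left _ _)
    have h2 : ‖z‖ ^ (1 - (n : ℝ)) ≤ 1 := Real.rpow_le_one_of_one_le_of_nonpos hb' (by linarith)
    nlinarith

/-- A converse growth estimate: outside the unit ball the repulsive part of the kernel is at most
`lam`. A finite drift integral at one point therefore controls the moment of order `max (A - 1) 0`.
-/
lemma norm_rpow_le_norm_kernel {z : E n} (hn : 2 ≤ n) (hlam : 0 < lam) :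
    ‖z‖ ^ max (A - 1) 0 ≤ 1 + lam + ‖kernel A lam z‖ := by
  have hn' : (2 : ℝ) ≤ n := by exact_mod_cast hn
  by_cases hb : ‖z‖ ≤ 1
  · have := Real.rpow_le_one (norm_nonneg z) hb (le_max_right (A - 1) 0)
    have := norm_nonneg (kernel A lam z)
    linarith
  have hb' : 1 ≤ ‖z‖ := (not_le.1 hb).le
  have hz0 : 0 < ‖z‖ := by linarith
  rcases le_total (A - 1) 0 with h | h
  · rw [max_eq_right h, Real.rpow_zero]
    have := norm_nonneg (kernel A lam z)
    linarith
  rw [max_eq_left h]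
  have e1 : ‖z‖ ^ (A - 2) * ‖z‖ = ‖z‖ ^ (A - 1) := by
    rw [← Real.rpow_add_one hz0.ne']; congr 1; ring
  have e2 : ‖z‖ ^ (-(n : ℝ)) * ‖z‖ = ‖z‖ ^ (1 - (n : ℝ)) := by
    rw [← Real.rpow_add_one hz0.ne']; congr 1; ring
  have h2 : ‖z‖ ^ (1 - (n : ℝ)) ≤ 1 := Real.rpow_le_one_of_one_le_of_nonpos hb' (by linarith)
  have h3 : ‖z‖ ^ (A - 1) - lam * ‖z‖ ^ (1 - (n : ℝ)) ≤ ‖kernel A lam z‖ := by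
    rw [kernel, norm_smul, ← e1, ← e2]
    have := mul_le_mul_of_nonneg_right
      (le_abs_self (‖z‖ ^ (A - 2) - lam * ‖z‖ ^ (-(n : ℝ)))) hz0.le
    rw [Real.norm_eq_abs]
    linarith
  nlinarith

lemma integrableOn_ball_norm_rpow (hn : 2 ≤ n) {s : ℝ} (hs : -(n : ℝ) < s) (R : ℝ) :
    IntegrableOn (fun z : E n => ‖z‖ ^ s) (Metric.ball 0 R) := by
  refine integrableOn_ball_of_norm_le_rpow (C := 1) (α := -s) (by simp; omega)
    (by simp; linarith) (Eventually.of_forall fun x => ?_)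
    (measurable_norm.pow_const s).aestronglyMeasurable
  rw [Real.norm_of_nonneg (by positivity), one_mul, neg_neg]

/-- A density on `ℝⁿ` with values in `[0,S]`, mass at most `M`, and drift of size at most `L` at
some point of the unit ball. -/
structure IsDensity (A lam S M : ℝ) (L : ℝ≥0) (u : E n → ℝ) : Prop where
  measurable : Measurable u
  nonneg : ∀ y, 0 ≤ u y
  le : ∀ y, u y ≤ S
  integrable : Integrable u
  mass_le : ∫ y, u y ≤ M
  exists_drift_le : ∃ x : E n, ‖x‖ < 1 ∧ ∫⁻ y, ‖u y • kernel A lam (x - y)‖ₑ ≤ L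

variable {S M : ℝ} {L : ℝ≥0} {u : E n → ℝ}

lemma IsDensity.measurable_integrand (hu : IsDensity A lam S M L u) (x : E n) :
    Measurable fun y => u y • kernel A lam (x - y) :=
  hu.measurable.smul (measurable_kernel.comp (measurable_const.sub measurable_id))

lemma IsDensity.nonneg_bound (hu : IsDensity A lam S M L u) : 0 ≤ S :=
  (hu.nonneg 0).trans (hu.le 0)

lemma IsDensity.nonneg_mass (hu : IsDensity A lam S M L u) : 0 ≤ M :=
  (integral_nonneg hu.nonneg).trans hu.mass_le

/-- The singular part is controlled by the bound `S`. The far part is a moment of order at most one,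
which can be compared with the moment about the point `x₀` where the drift is finite; moving the
centre costs a factor linear in `‖x‖`. -/
lemma IsDensity.integrable_smul_kernel (hn : 2 ≤ n) (hA : 2 - (n : ℝ) < A) (hA2 : A ≤ 2)
    (hlam : 0 < lam) (hu : IsDensity A lam S M L u) (x : E n) :
    Integrable (fun y => u y • kernel A lam (x - y)) ∧
      ∫ y, ‖u y • kernel A lam (x - y)‖ ≤
        (S * ((1 + lam) * ∫ z in Metric.ball (0 : E n) 1, ‖z‖ ^ (1 - (n : ℝ)))
          + (3 + 2 * lam) * M + L) * (1 + ‖x‖) := by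
  obtain ⟨x₀, hx₀, hL⟩ := hu.exists_drift_le
  set s := max (A - 1) 0 with hs
  have hs0 : 0 ≤ s := le_max_right _ _
  have hs1 : s ≤ 1 := max_le (by linarith) zero_le_one
  set ind : E n → ℝ := (Metric.ball (0 : E n) 1).indicator
    (fun z => (1 + lam) * ‖z‖ ^ (1 - (n : ℝ))) with hind
  have indi : Integrable ind :=
    (integrable_indicator_iff measurableSet_ball).2
      ((integrableOn_ball_norm_rpow hn (by linarith) 1).const_mul _)
  have indn : ∀ z, 0 ≤ ind z := fun z =>
    indicator_nonneg (fun z _ => mul_nonneg (by linarith) (by positivity)) z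
  have hm := hu.measurable_integrand
  have hLi : Integrable (fun y => ‖u y • kernel A lam (x₀ - y)‖) :=
    ⟨(hm x₀).norm.aestronglyMeasurable, by
      rw [hasFiniteIntegral_norm_iff]; exact hL.trans_lt ENNReal.coe_lt_top⟩
  have hLe : ∫ y, ‖u y • kernel A lam (x₀ - y)‖ ≤ L := by
    rw [integral_norm_eq_lintegral_enorm (hm x₀).aestronglyMeasurable]
    exact ENNReal.toReal_le_of_le_ofReal L.2 (by simpa using hL)
  set D : E n → ℝ := fun y => S * ind (x - y) + u y * (3 + ‖x‖ + 2 * lam)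
    + ‖u y • kernel A lam (x₀ - y)‖ with hD
  have Di : Integrable D :=
    (((indi.comp_sub_left x).const_mul S).add (hu.integrable.mul_const _)).add hLi
  have hpt : ∀ y, ‖u y • kernel A lam (x - y)‖ ≤ D y := by
    intro y
    have h0 := hu.nonneg y
    have h1 := norm_kernel_le (A := A) (z := x - y) hn hA hlam
    have h2 := norm_rpow_le_norm_kernel (A := A) (z := x₀ - y) hn hlam
    -- Subadditivity of `t ↦ t ^ s`, valid as `A ≤ 2` gives `s ≤ 1`.
    have h3 : ‖x - y‖ ^ s ≤ ‖x - x₀‖ ^ s + ‖x₀ - y‖ ^ s :=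
      (Real.rpow_le_rpow (norm_nonneg _) (norm_sub_le_norm_sub_add_norm_sub x x₀ y) hs0).trans
        (Real.rpow_add_le_add_rpow (norm_nonneg _) (norm_nonneg _) hs0 hs1)
    have h4 : ‖x - x₀‖ ^ s ≤ 2 + ‖x‖ := by
      have h5 : ‖x - x₀‖ ≤ 1 + ‖x‖ := (norm_sub_le _ _).trans (by linarith)
      rcases le_total ‖x - x₀‖ 1 with h | h
      · have := Real.rpow_le_one (norm_nonneg _) h hs0
        linarith [norm_nonneg x]
      · have := Real.rpow_le_rpow_of_exponent_le h hs1
        rw [Real.rpow_one] at this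
        linarith
    simp only [hD]
    rw [norm_smul, norm_smul, Real.norm_of_nonneg h0]
    calc u y * ‖kernel A lam (x - y)‖ ≤ u y * (ind (x - y)
          + (3 + ‖x‖ + 2 * lam + ‖kernel A lam (x₀ - y)‖)) := by
          refine mul_le_mul_of_nonneg_left ?_ h0
          linarith
      _ ≤ _ := by
          have := mul_le_mul_of_nonneg_right (hu.le y) (indn (x - y))
          linarith
  have hi : Integrable (fun y => u y • kernel A lam (x - y)) :=
    Di.mono' (hm x).aestronglyMeasurable (Eventually.of_forall hpt)
  refine ⟨hi, (integral_mono hi.norm Di hpt).trans ?_⟩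
  have e1 : ∫ y, D y = S * (∫ z, ind z) + (∫ y, u y) * (3 + ‖x‖ + 2 * lam)
      + ∫ y, ‖u y • kernel A lam (x₀ - y)‖ := by
    have i1 : Integrable fun y => S * ind (x - y) := (indi.comp_sub_left x).const_mul S
    have i2 : Integrable fun y => u y * (3 + ‖x‖ + 2 * lam) := hu.integrable.mul_const _
    have i3 : Integrable fun y => S * ind (x - y) + u y * (3 + ‖x‖ + 2 * lam) := i1.add i2
    simp only [hD]
    rw [integral_add i3 hLi, integral_add i1 i2,
      integral_const_mul, integral_mul_const, integral_sub_left_eq_self ind volume x]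
  have e2 : ∫ z, ind z = (1 + lam) * ∫ z in Metric.ball (0 : E n) 1, ‖z‖ ^ (1 - (n : ℝ)) := by
    rw [hind, integral_indicator measurableSet_ball, integral_const_mul]
  have c0 : 0 ≤ (1 + lam) * ∫ z in Metric.ball (0 : E n) 1, ‖z‖ ^ (1 - (n : ℝ)) := by
    rw [← e2]; exact integral_nonneg indn
  rw [e1, e2]
  generalize (1 + lam) * ∫ z in Metric.ball (0 : E n) 1, ‖z‖ ^ (1 - (n : ℝ)) = c at c0 ⊢
  generalize ∫ y, ‖u y • kernel A lam (x₀ - y)‖ = l at hLe ⊢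
  have hx := norm_nonneg x
  have hS := hu.nonneg_bound
  have hM := hu.nonneg_mass
  have a1 : (∫ y, u y) * (3 + ‖x‖ + 2 * lam) ≤ M * (3 + ‖x‖ + 2 * lam) :=
    mul_le_mul_of_nonneg_right hu.mass_le (by linarith)
  have a2 : 0 ≤ S * c * ‖x‖ := by positivity
  have a3 : 0 ≤ (L : ℝ) * ‖x‖ := by positivity
  have a4 : 0 ≤ (2 + 2 * lam) * M * ‖x‖ := by positivity
  linarith

lemma norm_drift_le_integral (hn : 2 ≤ n) (hB : B = 2 - (n : ℝ)) (u : E n → ℝ) (x : E n) :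
    ‖drift A B lam u x‖ ≤ ∫ y, ‖u y • kernel A lam (x - y)‖ := by
  rw [drift_eq hn hB]
  exact norm_integral_le_integral_norm _

/-- The attractive part of the divergence of the drift. -/
def attraction (A : ℝ) (u : E n → ℝ) (x : E n) : ℝ := ∫ y, u y * ‖x - y‖ ^ (A - 2)

/-- Within distance `R` the density is at most `S` and the power is locally integrable; beyond `R`
the power is at most `R ^ (A - 2)`, as `A ≤ 2`, and the mass suffices. -/
lemma attraction_le_aux (hn : 2 ≤ n) (hA : 2 - (n : ℝ) < A) (hA2 : A ≤ 2)
    (hu : IsDensity A lam S M L u) {R : ℝ} (hR : 0 < R) (x : E n) :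
    Integrable (fun y => u y * ‖x - y‖ ^ (A - 2)) ∧
      attraction A u x ≤ S * (∫ z in Metric.ball (0 : E n) R, ‖z‖ ^ (A - 2))
        + R ^ (A - 2) * M := by
  set ind : E n → ℝ := (Metric.ball (0 : E n) R).indicator (fun z => ‖z‖ ^ (A - 2)) with hind
  have indi : Integrable ind := (integrable_indicator_iff measurableSet_ball).2
    (integrableOn_ball_norm_rpow hn (by linarith) R)
  have indn : ∀ z, 0 ≤ ind z := fun z => indicator_nonneg (fun z _ => by positivity) z
  set D : E n → ℝ := fun y => S * ind (x - y) + R ^ (A - 2) * u y with hD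
  have Di : Integrable D :=
    ((indi.comp_sub_left x).const_mul S).add (hu.integrable.const_mul _)
  have hpt : ∀ y, u y * ‖x - y‖ ^ (A - 2) ≤ D y := by
    intro y
    have h0 := hu.nonneg y
    have hRp : 0 ≤ R ^ (A - 2) := by positivity
    have hp : 0 ≤ ‖x - y‖ ^ (A - 2) := by positivity
    by_cases hb : ‖x - y‖ < R
    · have : ind (x - y) = ‖x - y‖ ^ (A - 2) := indicator_of_mem (by simpa using hb) _
      simp only [hD, this]
      have := mul_le_mul_of_nonneg_right (hu.le y) hp
      have := mul_nonneg hRp h0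
      linarith
    · have : ind (x - y) = 0 := indicator_of_notMem (by simpa using hb) _
      simp only [hD, this, mul_zero, zero_add]
      rw [mul_comm]
      exact mul_le_mul_of_nonneg_right
        (Real.rpow_le_rpow_of_nonpos hR (not_lt.1 hb) (by linarith)) h0
  have hm : Measurable fun y => u y * ‖x - y‖ ^ (A - 2) :=
    hu.measurable.mul ((measurable_const.sub measurable_id).norm.pow_const _)
  have hi : Integrable (fun y => u y * ‖x - y‖ ^ (A - 2)) := by
    refine Di.mono' hm.aestronglyMeasurable (Eventually.of_forall fun y => ?_)
    rw [Real.norm_of_nonneg (mul_nonneg (hu.nonneg y) (by positivity))]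
    exact hpt y
  refine ⟨hi, (integral_mono hi Di hpt).trans ?_⟩
  simp only [hD]
  rw [integral_add ((indi.comp_sub_left x).const_mul S) (hu.integrable.const_mul _),
    integral_const_mul, integral_const_mul, integral_sub_left_eq_self ind volume x, hind,
    integral_indicator measurableSet_ball]
  gcongr
  exact hu.mass_le

lemma attraction_nonneg (hu : IsDensity A lam S M L u) (x : E n) : 0 ≤ attraction A u x :=
  integral_nonneg fun y => mul_nonneg (hu.nonneg y) (by positivity)

/-- The attraction is an arbitrarily small multiple of the supremum of the density, up to a
constant that depends on the mass only. -/
lemma exists_attraction_le (hn : 2 ≤ n) (hA : 2 - (n : ℝ) < A) (hA2 : A ≤ 2) (M : ℝ)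
    {η : ℝ} (hη : 0 < η) :
    ∃ D : ℝ, ∀ (lam S : ℝ) (L : ℝ≥0) (u : E n → ℝ), IsDensity A lam S M L u →
      ∀ x, attraction A u x ≤ η * S + D := by
  have := nontrivial_E hn
  -- The coefficient of `S` is the integral of an integrable function over shrinking balls, so some
  -- radius makes it less than `η`.
  have hlim : Tendsto (fun k : ℕ => ∫ z in Metric.ball (0 : E n) (1 / (k + 1)), ‖z‖ ^ (A - 2))
      atTop (𝓝 0) := by
    have h := tendsto_setIntegral_of_antitone (μ := (volume : Measure (E n)))
      (f := fun z : E n => ‖z‖ ^ (A - 2)) (s := fun k : ℕ => Metric.ball (0 : E n) (1 / (k + 1)))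
      (fun k => measurableSet_ball)
      (fun i j hij => Metric.ball_subset_ball (by gcongr))
      ⟨0, integrableOn_ball_norm_rpow hn (by linarith) _⟩
    convert h using 2
    have : ⋂ k : ℕ, Metric.ball (0 : E n) (1 / (k + 1)) = {0} := by
      ext z
      simp only [mem_iInter, mem_ball_zero_iff, mem_singleton_iff]
      constructor
      · intro hz
        by_contra h0
        obtain ⟨k, hk⟩ := exists_nat_one_div_lt (norm_pos_iff.2 h0)
        exact lt_asymm hk (hz k)
      · rintro rfl k
        simp
        positivity
    rw [this]
    simp
  obtain ⟨k, hk⟩ := (hlim.eventually_lt_const hη).exists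
  have hR : (0 : ℝ) < 1 / ((k : ℝ) + 1) := by positivity
  refine ⟨(1 / ((k : ℝ) + 1)) ^ (A - 2) * M, fun lam S L u hu x => ?_⟩
  refine (attraction_le_aux hn hA hA2 hu hR x).2.trans ?_
  have := mul_le_mul_of_nonneg_left hk.le hu.nonneg_bound
  linarith

/-- The surface area of the unit sphere of `ℝⁿ`. -/
def sphereArea (n : ℕ) : ℝ := (volume : Measure (E n)).toSphere.real univ

lemma sphereArea_pos (hn : 2 ≤ n) : 0 < sphereArea n := by
  rw [sphereArea, Measure.toSphere_real_apply_univ]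
  have : 0 < (volume : Measure (E n)).real (Metric.ball 0 1) :=
    ENNReal.toReal_pos (Metric.measure_ball_pos _ _ one_pos).ne' measure_ball_lt_top.ne
  have h2 : (0 : ℝ) < Module.finrank ℝ (E n) := by simp; omega
  positivity

/-- The polar identity is used twice: `a = A + n - 2 > 0` for the attraction, with no Dirac mass,
and `a = 0` for the repulsion, which is nothing but a Dirac mass. -/
lemma integral_fderiv_kernel (hn : 2 ≤ n) (hA : 2 - (n : ℝ) < A) {χ : E n → ℝ}
    (hχ : ContDiff ℝ ∞ χ) (hc : HasCompactSupport χ) (y : E n) :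
    Integrable (fun x => ‖x - y‖ ^ (A - 2) * χ x) ∧
    ∫ x, fderiv ℝ χ x (kernel A lam (x - y))
      = - ((A + n - 2) * ∫ x, ‖x - y‖ ^ (A - 2) * χ x) + lam * sphereArea n * χ y := by
  have := nontrivial_E hn
  have fr : (Module.finrank ℝ (E n) : ℝ) = n := by simp
  set η : E n → ℝ := fun x => χ (x + y) with hη
  have ηs : ContDiff ℝ ∞ η := hχ.comp (contDiff_id.add contDiff_const)
  have ηc : HasCompactSupport η := hc.comp_homeomorph (Homeomorph.addRight y)
  have hd : ∀ x, fderiv ℝ η x = fderiv ℝ χ (x + y) := fun x => fderiv_comp_add_right y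
  obtain ⟨i1, j1, h1⟩ := integral_norm_rpow_mul_fderiv_add (volume : Measure (E n))
    (a := A + n - 2) (by linarith) ηs ηc
  obtain ⟨i2, -, h2⟩ := integral_norm_rpow_mul_fderiv_add (volume : Measure (E n))
    (a := 0) le_rfl ηs ηc
  rw [fr] at i1 j1 h1 i2 h2
  have e1 : A + n - 2 - n = A - 2 := by ring
  have hne : A + n - 2 ≠ 0 := by linarith
  rw [e1] at i1 j1 h1
  rw [zero_sub] at i2 h2
  simp only [zero_mul, integral_zero, neg_zero, Real.rpow_zero, one_mul] at h2
  rw [Real.zero_rpow hne, zero_mul, sub_zero, integral_const_mul] at h1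
  constructor
  · have := ((integrable_const_mul_iff (isUnit_iff_ne_zero.2 hne) _).1 j1).comp_sub_right y
    simpa [hη] using this
  · have t1 : ∫ x, fderiv ℝ χ x (kernel A lam (x - y))
        = ∫ x, fderiv ℝ η x (kernel A lam x) := by
      rw [← integral_add_right_eq_self _ y]
      simp [hd]
    have t2 : ∫ x, ‖x - y‖ ^ (A - 2) * χ x = ∫ x, ‖x‖ ^ (A - 2) * η x := by
      rw [← integral_add_right_eq_self _ y]
      simp [hη]
    have t3 : ∀ x, fderiv ℝ η x (kernel A lam x) = ‖x‖ ^ (A - 2) * fderiv ℝ η x x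
        - lam * (‖x‖ ^ (-(n : ℝ)) * fderiv ℝ η x x) := fun x => by
      simp [kernel]
      ring
    rw [t1, t2]
    simp only [t3]
    rw [integral_sub i1 (i2.const_mul lam), integral_const_mul, h1, h2]
    simp [hη, sphereArea]
    ring

/-- The divergence of the drift, in the sense of distributions. -/
lemma integral_fderiv_drift (hn : 2 ≤ n) (hA : 2 - (n : ℝ) < A) (hA2 : A ≤ 2) (hlam : 0 < lam)
    (hB : B = 2 - (n : ℝ)) (hu : IsDensity A lam S M L u) {χ : E n → ℝ} (hχ : ContDiff ℝ ∞ χ)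
    (hc : HasCompactSupport χ) :
    ∫ x, fderiv ℝ χ x (drift A B lam u x)
      = - ∫ x, ((A + n - 2) * attraction A u x - lam * sphereArea n * u x) * χ x := by
  have cd : Continuous (fderiv ℝ χ) := hχ.continuous_fderiv (by simp)
  have hk := hu.integrable_smul_kernel hn hA hA2 hlam
  set C := S * ((1 + lam) * ∫ z in Metric.ball (0 : E n) 1, ‖z‖ ^ (1 - (n : ℝ)))
          + (3 + 2 * lam) * M + L with hC
  -- `p1` and `p2` justify Fubini, which reduces the claim to the divergence of a single translated
  -- kernel.
  have p1 : Integrable (fun p : E n × E n => u p.2 * fderiv ℝ χ p.1 (kernel A lam (p.1 - p.2)))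
      (volume.prod volume) := by
    have hm : Measurable fun p : E n × E n =>
        u p.2 * fderiv ℝ χ p.1 (kernel A lam (p.1 - p.2)) := by
      have h1 : Measurable fun p : E n × E n => kernel A lam (p.1 - p.2) :=
        measurable_kernel.comp (measurable_fst.sub measurable_snd)
      have h2 : Measurable fun p : E n × E n => fderiv ℝ χ p.1 := cd.measurable.comp measurable_fst
      have h3 : Continuous fun q : (E n →L[ℝ] ℝ) × E n => q.1 q.2 := by fun_prop
      exact (hu.measurable.comp measurable_snd).mul (h3.measurable.comp (h2.prodMk h1))
    have hb : ∀ x y, ‖u y * fderiv ℝ χ x (kernel A lam (x - y))‖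
        ≤ ‖fderiv ℝ χ x‖ * ‖u y • kernel A lam (x - y)‖ := fun x y => by
      rw [norm_mul, norm_smul]
      have := (fderiv ℝ χ x).le_opNorm (kernel A lam (x - y))
      nlinarith [norm_nonneg (u y)]
    rw [integrable_prod_iff hm.aestronglyMeasurable]
    have hi : ∀ x, Integrable fun y => u y * fderiv ℝ χ x (kernel A lam (x - y)) := fun x =>
      ((hk x).1.norm.const_mul ‖fderiv ℝ χ x‖).mono'
        (hm.comp measurable_prodMk_left).aestronglyMeasurable (Eventually.of_forall (hb x))
    refine ⟨Eventually.of_forall hi, ?_⟩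
    have hci : Integrable fun x => ‖fderiv ℝ χ x‖ * (C * (1 + ‖x‖)) :=
      Continuous.integrable_of_hasCompactSupport (by fun_prop) (hc.fderiv ℝ).norm.mul_right
    refine hci.mono' hm.norm.aestronglyMeasurable.integral_prod_right'
      (Eventually.of_forall fun x => ?_)
    rw [Real.norm_of_nonneg (integral_nonneg fun y => norm_nonneg _)]
    refine (integral_mono (hi x).norm ((hk x).1.norm.const_mul _) (hb x)).trans ?_
    rw [integral_const_mul]
    exact mul_le_mul_of_nonneg_left (hk x).2 (norm_nonneg _)
  have p2 : Integrable (fun p : E n × E n => u p.2 * (‖p.1 - p.2‖ ^ (A - 2) * χ p.1))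
      (volume.prod volume) := by
    have hm : Measurable fun p : E n × E n => u p.2 * (‖p.1 - p.2‖ ^ (A - 2) * χ p.1) :=
      (hu.measurable.comp measurable_snd).mul
        (((measurable_fst.sub measurable_snd).norm.pow_const _).mul
          (hχ.continuous.measurable.comp measurable_fst))
    rw [integrable_prod_iff hm.aestronglyMeasurable]
    have ha := attraction_le_aux hn hA hA2 hu one_pos
    have e : ∀ x y, u y * (‖x - y‖ ^ (A - 2) * χ x) = χ x * (u y * ‖x - y‖ ^ (A - 2)) :=
      fun x y => by ring
    have hi : ∀ x, Integrable fun y => u y * (‖x - y‖ ^ (A - 2) * χ x) := fun x => by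
      simp only [e]
      exact (ha x).1.const_mul _
    refine ⟨Eventually.of_forall hi, ?_⟩
    have hci := (hχ.continuous.norm.integrable_of_hasCompactSupport (μ := volume) hc.norm).mul_const
      (S * (∫ z in Metric.ball (0 : E n) 1, ‖z‖ ^ (A - 2)) + 1 ^ (A - 2) * M)
    refine hci.mono' hm.norm.aestronglyMeasurable.integral_prod_right'
      (Eventually.of_forall fun x => ?_)
    rw [Real.norm_of_nonneg (integral_nonneg fun y => norm_nonneg _)]
    simp only [e]
    simp only [norm_mul]
    rw [integral_const_mul]
    refine mul_le_mul_of_nonneg_left ?_ (norm_nonneg _)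
    refine le_trans (le_of_eq ?_) (ha x).2
    refine integral_congr_ae (Eventually.of_forall fun y => ?_)
    simp only [← norm_mul]
    exact Real.norm_of_nonneg (mul_nonneg (hu.nonneg y) (by positivity))
  have ui : Integrable fun x => u x * χ x := by
    obtain ⟨c, hc'⟩ := hc.exists_bound_of_continuous hχ.continuous
    exact hu.integrable.mul_bdd hχ.continuous.aestronglyMeasurable (Eventually.of_forall hc')
  have l1 : ∀ x, fderiv ℝ χ x (drift A B lam u x)
      = ∫ y, u y * fderiv ℝ χ x (kernel A lam (x - y)) := fun x => by
    rw [drift_eq hn hB, ← ContinuousLinearMap.integral_comp_comm _ (hk x).1]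
    simp
  have l2 : ∀ x, attraction A u x * χ x = ∫ y, u y * (‖x - y‖ ^ (A - 2) * χ x) := fun x => by
    rw [attraction, ← integral_mul_const]
    simp only [mul_assoc]
  have p3 : Integrable fun x => attraction A u x * χ x := by
    simp only [l2]
    exact p2.integral_prod_left
  have p4 : Integrable fun y => ∫ x, u y * (‖x - y‖ ^ (A - 2) * χ x) := p2.integral_prod_right
  calc ∫ x, fderiv ℝ χ x (drift A B lam u x)
      = ∫ y, ∫ x, u y * fderiv ℝ χ x (kernel A lam (x - y)) := by
        simp only [l1]
        exact integral_integral_swap p1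
    _ = ∫ y, (- ((A + n - 2) * ∫ x, u y * (‖x - y‖ ^ (A - 2) * χ x))
          + lam * sphereArea n * (u y * χ y)) := by
        congr 1
        ext y
        rw [integral_const_mul, integral_const_mul, (integral_fderiv_kernel hn hA hχ hc y).2]
        ring
    _ = - ((A + n - 2) * ∫ x, attraction A u x * χ x)
          + lam * sphereArea n * ∫ x, u x * χ x := by
        have i1 : Integrable fun y => - ((A + n - 2) * ∫ x, u y * (‖x - y‖ ^ (A - 2) * χ x)) :=
          (p4.const_mul _).neg
        rw [integral_add i1 (ui.const_mul _), integral_neg, integral_const_mul,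
          integral_const_mul, ← integral_integral_swap p2]
        simp only [l2]
    _ = _ := by
        have e : ∀ x, ((A + n - 2) * attraction A u x - lam * sphereArea n * u x) * χ x
            = (A + n - 2) * (attraction A u x * χ x) - lam * sphereArea n * (u x * χ x) :=
          fun x => by ring
        simp only [e]
        rw [integral_sub (p3.const_mul _) (ui.const_mul _), integral_const_mul,
          integral_const_mul]
        ring

end Kernel

end AggregationDiffusion

end

noncomputable section

namespace AggregationDiffusion

open Filter Topology

/-! ### Scalar truncations above the level `k`. -/

section Truncation

/-- Scalar functions used to test the equation on the set where the density exceeds `k`: `h` is a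
smooth increasing cutoff in the variable `s = ρ ^ m`, the derivatives of `h` and `P` satisfy
`P' = s ^ (1 / m) h'`, and `Φ` is a primitive of `x ↦ h (x ^ m)`. -/
structure Truncation (m k : ℝ) where
  (h h' P P' Φ : ℝ → ℝ)
  C : ℝ
  hasDerivAt_h : ∀ s, HasDerivAt h (h' s) s
  hasDerivAt_P : ∀ s, HasDerivAt P (P' s) s
  continuous_h' : Continuous h'
  continuous_P' : Continuous P'
  h_nonneg : ∀ s, 0 ≤ h s
  h_le : ∀ s, h s ≤ C
  P_nonneg : ∀ s, 0 ≤ P s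
  P_le : ∀ s, P s ≤ C
  h'_nonneg : ∀ s, 0 ≤ h' s
  h'_le : ∀ s, h' s ≤ C
  abs_P'_le : ∀ s, |P' s| ≤ C
  h_eq_zero : ∀ s, s ≤ k ^ m → h s = 0
  P_eq_zero : ∀ s, s ≤ k ^ m → P s = 0
  P'_rpow : ∀ x, 0 ≤ x → P' (x ^ m) = x * h' (x ^ m)
  continuous_Φ : Continuous Φ
  Φ_eq_zero : ∀ x, 0 ≤ x → x ≤ k → Φ x = 0
  Φ_nonneg : ∀ x, 0 ≤ x → 0 ≤ Φ x
  Φ_le : ∀ x, 0 ≤ x → Φ x ≤ C * x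
  Φ_pos : ∀ x, k < x → 0 < Φ x
  Φ_sub_le : ∀ x y, 0 ≤ x → 0 ≤ y → Φ x - Φ y ≤ h (x ^ m) * (x - y)

lemma exists_bounded_primitive {p : ℝ → ℝ} {b : ℝ} (hp : Continuous p) (h0 : ∀ s, 0 ≤ p s)
    (hs : ∀ s, s ∉ Ioo b (b + 1) → p s = 0) (hpos : ∀ s ∈ Ioo b (b + 1), 0 < p s) :
    ∃ (q : ℝ → ℝ) (C : ℝ), (∀ s, HasDerivAt q (p s) s) ∧ Monotone q ∧ (∀ s, 0 ≤ q s) ∧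
      (∀ s, q s ≤ C) ∧ (∀ s, s ≤ b → q s = 0) ∧ ∀ s, b < s → 0 < q s := by
  set q : ℝ → ℝ := fun s => ∫ x in b..s, p x with hq
  have hi : ∀ x y, IntervalIntegrable p volume x y := fun x y => hp.intervalIntegrable x y
  have hd : ∀ s, HasDerivAt q (p s) s := fun s =>
    intervalIntegral.integral_hasDerivAt_right (hi b s)
      hp.stronglyMeasurable.stronglyMeasurableAtFilter hp.continuousAt
  have hm : Monotone q := monotone_of_deriv_nonneg (fun s => (hd s).differentiableAt)
    fun s => by rw [(hd s).deriv]; exact h0 s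
  have hb : ∀ s, s ≤ b → q s = 0 := by
    intro s hsb
    simp only [hq]
    rw [intervalIntegral.integral_symm, neg_eq_zero]
    refine (intervalIntegral.integral_congr (g := fun _ => 0) fun x hx => ?_).trans (by simp)
    rw [uIcc_of_le hsb] at hx
    exact hs x fun h => absurd h.1 (not_lt.2 hx.2)
  have hc : ∀ s, b + 1 ≤ s → q s = q (b + 1) := by
    intro s hsb
    simp only [hq]
    rw [← intervalIntegral.integral_add_adjacent_intervals (hi b (b + 1)) (hi (b + 1) s),
      add_eq_left]
    refine (intervalIntegral.integral_congr (g := fun _ => 0) fun x hx => ?_).trans (by simp)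
    rw [uIcc_of_le hsb] at hx
    exact hs x fun h => absurd h.2 (not_lt.2 hx.1)
  refine ⟨q, q (b + 1), hd, hm, fun s => ?_, fun s => ?_, hb, fun s hsb => ?_⟩
  · rcases le_total s b with h | h
    · exact (hb s h).ge
    · rw [← hb b le_rfl]; exact hm h
  · rcases le_total s (b + 1) with h | h
    · exact hm h
    · exact (hc s h).le
  · have h1 : 0 < q (min s (b + 1)) := by
      have hlt : b < min s (b + 1) := lt_min hsb (by linarith)
      refine intervalIntegral.intervalIntegral_pos_of_pos_on (hi _ _) (fun x hx => ?_) hlt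
      exact hpos x ⟨hx.1, hx.2.trans_le (min_le_right _ _)⟩
    exact h1.trans_le (hm (min_le_left _ _))

lemma nonempty_truncation {m k : ℝ} (hm : 0 < m) (hk : 0 < k) : Nonempty (Truncation m k) := by
  set b := k ^ m with hb
  have b0 : 0 < b := by positivity
  -- The derivative of `h` is a tent on `(b, b + 1)`. Its primitive is bounded, constant beyond `b +
  -- 1`, and positive exactly above `b = k ^ m`.
  set p : ℝ → ℝ := fun s => max 0 (min (s - b) (b + 1 - s)) with hp
  have pc : Continuous p := by fun_prop
  have p0 : ∀ s, 0 ≤ p s := fun s => le_max_left _ _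
  have ps : ∀ s, s ∉ Ioo b (b + 1) → p s = 0 := by
    intro s hs
    refine max_eq_left ?_
    by_contra! h
    have := lt_min_iff.1 h
    exact hs ⟨by linarith, by linarith⟩
  have pp : ∀ s ∈ Ioo b (b + 1), 0 < p s := fun s hs =>
    lt_max_of_lt_right (lt_min (by linarith [hs.1]) (by linarith [hs.2]))
  set r : ℝ → ℝ := fun s => |s| ^ m⁻¹ * p s with hr
  have rc : Continuous r :=
    ((continuous_abs.rpow_const fun _ => Or.inr (by positivity))).mul pc
  have r0 : ∀ s, 0 ≤ r s := fun s => mul_nonneg (by positivity) (p0 s)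
  have rs : ∀ s, s ∉ Ioo b (b + 1) → r s = 0 := fun s hs => by simp [hr, ps s hs]
  have rp : ∀ s ∈ Ioo b (b + 1), 0 < r s := fun s hs => by
    have : 0 < |s| := abs_pos.2 (b0.trans hs.1).ne'
    have := pp s hs
    positivity
  obtain ⟨h, C₁, hd, hmon, hn, hle, hz, hpos⟩ := exists_bounded_primitive pc p0 ps pp
  obtain ⟨P, C₂, Pd, -, Pn, Ple, Pz, -⟩ := exists_bounded_primitive rc r0 rs rp
  have bd : ∀ f : ℝ → ℝ, Continuous f → (∀ s, s ∉ Ioo b (b + 1) → f s = 0) →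
      ∃ C, ∀ s, ‖f s‖ ≤ C := fun f hf hs =>
    (HasCompactSupport.intro (isCompact_Icc (a := b) (b := b + 1)) fun s hs' =>
      hs s fun h => hs' (Ioo_subset_Icc_self h)).exists_bound_of_continuous hf
  obtain ⟨C₃, h3⟩ := bd p pc ps
  obtain ⟨C₄, h4⟩ := bd r rc rs
  have hc : Continuous h := continuous_iff_continuousAt.2 fun s => (hd s).continuousAt
  have hmc : Continuous fun x : ℝ => h (x ^ m) :=
    hc.comp (continuous_id.rpow_const fun _ => Or.inr hm.le)
  set Φ : ℝ → ℝ := fun x => ∫ s in (0 : ℝ)..x, h (s ^ m) with hΦ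
  have hi : ∀ x y, IntervalIntegrable (fun x : ℝ => h (x ^ m)) volume x y :=
    fun x y => hmc.intervalIntegrable x y
  have sub : ∀ x y, Φ x - Φ y = ∫ s in y..x, h (s ^ m) := fun x y =>
    intervalIntegral.integral_interval_sub_left (hi 0 x) (hi 0 y)
  have zero : ∀ x, 0 ≤ x → x ≤ k → Φ x = 0 := by
    intro x hx hxk
    refine (intervalIntegral.integral_congr (g := fun _ => 0) fun s hs => ?_).trans (by simp)
    rw [uIcc_of_le hx] at hs
    exact hz _ (Real.rpow_le_rpow hs.1 (hs.2.trans hxk) hm.le)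
  -- The tangent line inequality: `Φ` is convex on the half-line because `x ↦ h (x ^ m)` is
  -- increasing there.
  have conv : ∀ x y, 0 ≤ x → 0 ≤ y → Φ x - Φ y ≤ h (x ^ m) * (x - y) := by
    intro x y hx hy
    rw [sub]
    rcases le_total y x with hyx | hxy
    · refine (intervalIntegral.integral_mono_on hyx (hi y x) (by simp)
        (g := fun _ => h (x ^ m)) fun s hs => ?_).trans_eq ?_
      · exact hmon (Real.rpow_le_rpow (hy.trans hs.1) hs.2 hm.le)
      · simp [mul_comm]
    · rw [intervalIntegral.integral_symm]
      have := intervalIntegral.integral_mono_on hxy (f := fun _ => h (x ^ m)) (by simp) (hi x y)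
        fun s hs => hmon (Real.rpow_le_rpow hx hs.1 hm.le)
      simp only [intervalIntegral.integral_const, smul_eq_mul] at this
      linarith
  set C := max (max C₁ C₂) (max C₃ C₄) with hC
  have Φ0 : Φ 0 = 0 := by simp [hΦ]
  exact ⟨{
    h := h, h' := p, P := P, P' := r, Φ := Φ, C := C
    hasDerivAt_h := hd
    hasDerivAt_P := Pd
    continuous_h' := pc
    continuous_P' := rc
    h_nonneg := hn
    h_le := fun s => (hle s).trans ((le_max_left _ _).trans (le_max_left _ _))
    P_nonneg := Pn
    P_le := fun s => (Ple s).trans ((le_max_right _ _).trans (le_max_left _ _))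
    h'_nonneg := p0
    h'_le := fun s => (le_abs_self _).trans
      ((h3 s).trans ((le_max_left _ _).trans (le_max_right _ _)))
    abs_P'_le := fun s => (h4 s).trans ((le_max_right _ _).trans (le_max_right _ _))
    h_eq_zero := hz
    P_eq_zero := Pz
    P'_rpow := fun x hx => by
      simp only [hr]
      rw [abs_of_nonneg (by positivity), Real.rpow_rpow_inv hx hm.ne']
    continuous_Φ := intervalIntegral.continuous_primitive hi 0
    Φ_eq_zero := zero
    Φ_nonneg := fun x hx => intervalIntegral.integral_nonneg hx fun s _ => hn _
    Φ_le := fun x hx => by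
      have := conv x 0 hx le_rfl
      rw [Φ0, sub_zero, sub_zero] at this
      exact this.trans (mul_le_mul_of_nonneg_right
        ((hle _).trans ((le_max_left _ _).trans (le_max_left _ _))) hx)
    Φ_pos := fun x hx => by
      have h1 := sub x k
      rw [zero k hk.le le_rfl, sub_zero] at h1
      rw [h1]
      refine intervalIntegral.intervalIntegral_pos_of_pos_on (hi _ _) (fun s hs => ?_) hx
      exact hpos _ (Real.rpow_lt_rpow hk.le hs.1 hm)
    Φ_sub_le := conv }⟩

end Truncation

/-! ### Spatial cutoffs whose gradients decay like `1 / (1 + ‖x‖)`. -/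

section Cutoff

/-- Cutoff functions between the balls of radius `R` and `2 * R`. -/
lemma exists_cutoff (n : ℕ) : ∃ C : ℝ, 0 ≤ C ∧ ∀ R : ℝ, 1 ≤ R → ∃ φ : E n → ℝ, ContDiff ℝ ∞ φ ∧
    (∀ x, 0 ≤ φ x) ∧ (∀ x, φ x ≤ 1) ∧ (∀ x, ‖x‖ < R → φ x = 1 ∧ fderiv ℝ φ x = 0) ∧
    (∀ x, 2 * R < ‖x‖ → φ x = 0 ∧ fderiv ℝ φ x = 0) ∧
    ∀ x, ‖fderiv ℝ φ x‖ * (1 + ‖x‖) ≤ C := by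
  let η : ContDiffBump (0 : E n) := ⟨1, 2, one_pos, one_lt_two⟩
  obtain ⟨c, hc⟩ := (η.hasCompactSupport.fderiv ℝ).exists_bound_of_continuous
    (η.contDiff (n := ⊤).continuous_fderiv (by simp))
  have c0 : 0 ≤ c := (norm_nonneg _).trans (hc 0)
  refine ⟨3 * c, by positivity, fun R hR => ?_⟩
  have R0 : 0 < R := by linarith
  have hd : ∀ x, fderiv ℝ (fun x => η (R⁻¹ • x)) x = R⁻¹ • fderiv ℝ η (R⁻¹ • x) := fun x =>
    fderiv_comp_smul R⁻¹
  have hn : ∀ x : E n, ‖R⁻¹ • x‖ = ‖x‖ / R := fun x => by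
    rw [norm_smul, norm_inv, Real.norm_of_nonneg R0.le]; field_simp
  have loc : ∀ (s : Set (E n)) (a : ℝ), IsOpen s → (∀ x ∈ s, η (R⁻¹ • x) = a) → ∀ x ∈ s,
      fderiv ℝ (fun x => η (R⁻¹ • x)) x = 0 := by
    intro s a hs h x hx
    have : (fun x => η (R⁻¹ • x)) =ᶠ[𝓝 x] fun _ => a := by
      filter_upwards [hs.mem_nhds hx] with y hy using h y hy
    rw [this.fderiv_eq]
    simp
  have one : ∀ x : E n, ‖x‖ < R → η (R⁻¹ • x) = 1 := fun x hx => by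
    refine η.one_of_mem_closedBall ?_
    rw [mem_closedBall_zero_iff, hn, div_le_iff₀ R0]
    change ‖x‖ ≤ 1 * R
    linarith
  have zero : ∀ x : E n, 2 * R < ‖x‖ → η (R⁻¹ • x) = 0 := fun x hx => by
    refine η.zero_of_le_dist ?_
    rw [dist_zero_right, hn, le_div_iff₀ R0]
    exact hx.le
  have z2 := loc {x | 2 * R < ‖x‖} 0 (isOpen_lt continuous_const continuous_norm) zero
  refine ⟨fun x => η (R⁻¹ • x), η.contDiff.comp (contDiff_const_smul _), fun x => η.nonneg,
    fun x => η.le_one, fun x hx => ⟨one x hx,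
      loc {x | ‖x‖ < R} 1 (isOpen_lt continuous_norm continuous_const) one x hx⟩,
    fun x hx => ⟨zero x hx, z2 x hx⟩, fun x => ?_⟩
  by_cases hx : 2 * R < ‖x‖
  · rw [z2 x hx]
    simp
    positivity
  · have h1 : ‖fderiv ℝ (fun x => η (R⁻¹ • x)) x‖ ≤ R⁻¹ * c := by
      rw [hd, norm_smul, norm_inv, Real.norm_of_nonneg R0.le]
      exact mul_le_mul_of_nonneg_left (hc _) (by positivity)
    -- On the support of the gradient `1 + ‖x‖ ≤ 1 + 2 * R ≤ 3 * R`, since `R ≥ 1`.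
    calc _ ≤ R⁻¹ * c * (3 * R) := by
          gcongr
          linarith
      _ = 3 * c := by field_simp

end Cutoff

end AggregationDiffusion

end

noncomputable section

namespace AggregationDiffusion

open Filter Topology

/-! ### Space-time versions of the weak derivatives, the drift and its divergence. -/

section Slab

variable {n : ℕ}

instance : (volume : Measure (ℝ × E n)).IsAddHaarMeasure :=
  inferInstanceAs ((volume : Measure ℝ).prod (volume : Measure (E n))).IsAddHaarMeasure

/-- The coordinate directions of space, as directions of space-time. -/
def spaceDir (i : Fin n) : ℝ × E n := (0, EuclideanSpace.single i 1)

lemma sum_mul_apply_single (l : E n →L[ℝ] ℝ) (w : E n) :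
    ∑ i, w i * l (EuclideanSpace.single i 1) = l w := by
  conv_rhs => rw [← (EuclideanSpace.basisFun (Fin n) ℝ).sum_repr w]
  simp

lemma sum_mul_apply_spaceDir (l : ℝ × E n →L[ℝ] ℝ) (w : E n) :
    ∑ i, w i * l (spaceDir i) = l (0, w) :=
  sum_mul_apply_single (l.comp (ContinuousLinearMap.inr ℝ ℝ (E n))) w

lemma contDiff_slice {χ : ℝ × E n → ℝ} (hχ : ContDiff ℝ ∞ χ) (t : ℝ) :
    ContDiff ℝ ∞ fun x => χ (t, x) := hχ.comp (contDiff_const.prodMk contDiff_id)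

lemma hasCompactSupport_slice {χ : ℝ × E n → ℝ} (hc : HasCompactSupport χ) (t : ℝ) :
    HasCompactSupport fun x => χ (t, x) := by
  refine HasCompactSupport.of_support_subset_isCompact (hc.image continuous_snd) fun x hx => ?_
  exact ⟨(t, x), subset_tsupport _ hx, rfl⟩

lemma fderiv_slice {χ : ℝ × E n → ℝ} (hχ : ContDiff ℝ ∞ χ) (t : ℝ) (x w : E n) :
    fderiv ℝ (fun x => χ (t, x)) x w = fderiv ℝ χ (t, x) (0, w) := by
  have h1 : HasFDerivAt χ (fderiv ℝ χ (t, x)) (t, x) :=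
    (hχ.differentiable (by simp)).differentiableAt.hasFDerivAt
  have h2 := h1.comp x (hasFDerivAt_prodMk_right t x)
  change fderiv ℝ (χ ∘ fun x => (t, x)) x w = _
  rw [h2.fderiv]
  simp

lemma gradient_apply {φ : E n → ℝ} (x : E n) (i : Fin n) :
    gradient φ x i = fderiv ℝ φ x (EuclideanSpace.single i 1) := by
  have : inner ℝ (gradient φ x) (EuclideanSpace.single i (1 : ℝ))
      = fderiv ℝ φ x (EuclideanSpace.single i 1) := by
    rw [gradient, InnerProductSpace.toDual_symm_apply]
  rw [← this, EuclideanSpace.inner_single_right]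
  simp

lemma inner_gradient {φ : E n → ℝ} (x w : E n) : inner ℝ w (gradient φ x) = fderiv ℝ φ x w := by
  rw [real_inner_comm, gradient, InnerProductSpace.toDual_symm_apply]

lemma HasWeakGradient.integral_mul_fderiv {f : E n → ℝ} {g : E n → E n}
    (h : HasWeakGradient f g) {φ : E n → ℝ} (hφ : ContDiff ℝ ∞ φ) (hc : HasCompactSupport φ)
    (i : Fin n) :
    ∫ x, f x * fderiv ℝ φ x (EuclideanSpace.single i 1) = - ∫ x, φ x * g x i := by
  obtain ⟨hf, hg, hw⟩ := h
  have cd : Continuous (gradient φ) :=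
    (InnerProductSpace.toDual ℝ (E n)).symm.continuous.comp (hφ.continuous_fderiv (by simp))
  have hcg : HasCompactSupport (gradient φ) :=
    (hc.fderiv ℝ).comp_left (g := (InnerProductSpace.toDual ℝ (E n)).symm) (map_zero _)
  have h1 : Integrable fun x => f x • gradient φ x :=
    hf.integrable_smul_right_of_hasCompactSupport cd hcg
  have h2 : Integrable fun x => φ x • g x :=
    hg.integrable_smul_left_of_hasCompactSupport hφ.continuous hc
  have h3 := congrArg (fun w : E n => EuclideanSpace.proj (𝕜 := ℝ) i w) (hw φ hφ hc)
  simp only [map_neg] at h3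
  rw [← ContinuousLinearMap.integral_comp_comm _ h1,
    ← ContinuousLinearMap.integral_comp_comm _ h2] at h3
  simpa [gradient_apply] using h3

/-- Restricting to a time interval preserves weak spatial derivatives. -/
lemma hasWeakDeriv_indicator {f : ℝ × E n → ℝ} {g : ℝ × E n → E n} {J : Set ℝ}
    (hJ : MeasurableSet J) (h : ∀ᵐ t ∂(volume.restrict J),
      HasWeakGradient (fun x => f (t, x)) (fun x => g (t, x)))
    (hf : LocallyIntegrable f volume) (hg : LocallyIntegrable g volume) (i : Fin n) :
    HasWeakDeriv volume (spaceDir i) ((Prod.fst ⁻¹' J).indicator f)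
      ((Prod.fst ⁻¹' J).indicator fun z => g z i) := by
  intro χ hχ hc
  have mJ : MeasurableSet (Prod.fst ⁻¹' J : Set (ℝ × E n)) := measurable_fst hJ
  have hgi : LocallyIntegrable (fun z => g z i) volume := fun z => by
    obtain ⟨s, hs, hi⟩ := hg z
    exact ⟨s, hs, (EuclideanSpace.proj (𝕜 := ℝ) i).integrable_comp hi⟩
  have cχ : Continuous fun z => fderiv ℝ χ z (spaceDir i) :=
    (hχ.continuous_fderiv (by simp)).clm_apply continuous_const
  have hcd : HasCompactSupport fun z => fderiv ℝ χ z (spaceDir i) := hc.fderiv_apply ℝ _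
  have i1 : Integrable fun z => (Prod.fst ⁻¹' J).indicator f z * fderiv ℝ χ z (spaceDir i) := by
    have := (hf.integrable_smul_right_of_hasCompactSupport cχ hcd).indicator mJ
    refine this.congr (Eventually.of_forall fun z => ?_)
    simp [indicator]
  have i2 : Integrable fun z => χ z * (Prod.fst ⁻¹' J).indicator (fun z => g z i) z := by
    have := (hgi.integrable_smul_left_of_hasCompactSupport hχ.continuous hc).indicator mJ
    refine this.congr (Eventually.of_forall fun z => ?_)
    simp [indicator]
  rw [Measure.volume_eq_prod] at i1 i2 ⊢
  rw [integral_prod _ i1, integral_prod _ i2, ← integral_neg]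
  refine integral_congr_ae ?_
  filter_upwards [(ae_restrict_iff' hJ).1 h] with t ht
  by_cases htJ : t ∈ J
  · have := (ht htJ).integral_mul_fderiv (contDiff_slice hχ t) (hasCompactSupport_slice hc t) i
    simpa [indicator, htJ, fderiv_slice hχ, spaceDir] using this
  · simp [indicator, htJ]

variable {A B lam S M : ℝ} {L : ℝ≥0} {r : ℝ × E n → ℝ}

/-- The drift of a space-time density. -/
def velocity (A B lam : ℝ) (r : ℝ × E n → ℝ) (z : ℝ × E n) : E n :=
  drift A B lam (fun x => r (z.1, x)) z.2

/-- The divergence of the drift of a space-time density. -/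
def velocityDiv (A lam : ℝ) (r : ℝ × E n → ℝ) (z : ℝ × E n) : ℝ :=
  (A + n - 2) * attraction A (fun x => r (z.1, x)) z.2 - lam * sphereArea n * r z

lemma stronglyMeasurable_velocity (hn : 2 ≤ n) (hB : B = 2 - (n : ℝ)) (hr : Measurable r) :
    StronglyMeasurable (velocity A B lam r) := by
  have h : Measurable fun p : (ℝ × E n) × E n => r (p.1.1, p.2) • kernel A lam (p.1.2 - p.2) := by
    refine (hr.comp ?_).smul (measurable_kernel.comp ?_) <;> fun_prop
  have e : velocity A B lam r = fun z => ∫ y, r (z.1, y) • kernel A lam (z.2 - y) :=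
    funext fun z => drift_eq hn hB _ _
  rw [e]
  exact h.stronglyMeasurable.integral_prod_right' (ν := volume)

lemma measurable_velocityDiv (hr : Measurable r) : Measurable (velocityDiv A lam r) := by
  have h : Measurable fun p : (ℝ × E n) × E n => r (p.1.1, p.2) * ‖p.1.2 - p.2‖ ^ (A - 2) := by
    refine (hr.comp ?_).mul (Measurable.pow_const ?_ _) <;> fun_prop
  exact ((h.stronglyMeasurable.integral_prod_right' (ν := volume)).measurable.const_mul _).sub
    (hr.const_mul _)

lemma ae_prod_of_ae_fst {p : ℝ → Prop} (h : ∀ᵐ t, p t) : ∀ᵐ z : ℝ × E n, p z.1 :=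
  Measure.quasiMeasurePreserving_fst.ae h

lemma exists_velocity_le (hn : 2 ≤ n) (hA : 2 - (n : ℝ) < A) (hA2 : A ≤ 2) (hlam : 0 < lam)
    (hB : B = 2 - (n : ℝ)) (hd : ∀ᵐ t, IsDensity A lam S M L fun x => r (t, x)) :
    ∃ C, 0 ≤ C ∧ ∀ᵐ z, ‖velocity A B lam r z‖ ≤ C * (1 + ‖z.2‖) := by
  have key : ∀ᵐ z : ℝ × E n, ‖velocity A B lam r z‖ ≤
      (S * ((1 + lam) * ∫ z in Metric.ball (0 : E n) 1, ‖z‖ ^ (1 - (n : ℝ)))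
          + (3 + 2 * lam) * M + L) * (1 + ‖z.2‖) := by
    filter_upwards [ae_prod_of_ae_fst hd] with z hz
    exact (norm_drift_le_integral hn hB _ _).trans
      (hz.integrable_smul_kernel hn hA hA2 hlam z.2).2
  generalize S * ((1 + lam) * ∫ z in Metric.ball (0 : E n) 1, ‖z‖ ^ (1 - (n : ℝ)))
    + (3 + 2 * lam) * M + L = C at key
  refine ⟨max C 0, le_max_right _ _, key.mono fun z hz => hz.trans ?_⟩
  exact mul_le_mul_of_nonneg_right (le_max_left _ _) (by positivity)

lemma exists_abs_velocityDiv_le (hn : 2 ≤ n) (hA : 2 - (n : ℝ) < A) (hA2 : A ≤ 2)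
    (hlam : 0 < lam) (hd : ∀ᵐ t, IsDensity A lam S M L fun x => r (t, x)) :
    ∃ C, ∀ᵐ z, |velocityDiv A lam r z| ≤ C := by
  obtain ⟨D, hD⟩ := exists_attraction_le hn hA hA2 M one_pos
  have hs := sphereArea_pos hn
  refine ⟨(A + n - 2) * (1 * S + D) + lam * sphereArea n * S, ?_⟩
  filter_upwards [ae_prod_of_ae_fst hd] with z hz
  have h1 := hD lam S L _ hz z.2
  have h2 := attraction_nonneg hz z.2
  have h3 : 0 ≤ r z := hz.nonneg z.2
  have h4 : r z ≤ S := hz.le z.2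
  have h5 : 0 < A + n - 2 := by linarith
  refine (abs_sub _ _).trans (add_le_add ?_ ?_)
  · rw [abs_of_nonneg (by positivity)]
    gcongr
  · rw [abs_of_nonneg (by positivity)]
    gcongr

/-- Only spatial derivatives occur, so the identity at almost every fixed time integrates in `t`. -/
lemma integral_fderiv_velocity (hn : 2 ≤ n) (hA : 2 - (n : ℝ) < A) (hA2 : A ≤ 2) (hlam : 0 < lam)
    (hB : B = 2 - (n : ℝ)) (hr : Measurable r)
    (hd : ∀ᵐ t, IsDensity A lam S M L fun x => r (t, x))
    {χ : ℝ × E n → ℝ} (hχ : ContDiff ℝ ∞ χ) (hc : HasCompactSupport χ) :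
    ∫ z, fderiv ℝ χ z (0, velocity A B lam r z) = - ∫ z, velocityDiv A lam r z * χ z := by
  have cd : Continuous (fderiv ℝ χ) := hχ.continuous_fderiv (by simp)
  obtain ⟨C, -, hC⟩ := exists_velocity_le hn hA hA2 hlam hB hd
  obtain ⟨C', hC'⟩ := exists_abs_velocityDiv_le hn hA hA2 hlam hd
  have i1 : Integrable fun z => fderiv ℝ χ z (0, velocity A B lam r z) := by
    have hm : AEStronglyMeasurable (fun z => fderiv ℝ χ z (0, velocity A B lam r z)) volume := by
      have h3 : Continuous fun q : (ℝ × E n →L[ℝ] ℝ) × E n => q.1 (0, q.2) := by fun_prop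
      exact (h3.comp_stronglyMeasurable (cd.stronglyMeasurable.prodMk
        (stronglyMeasurable_velocity hn hB hr))).aestronglyMeasurable
    have hi : Integrable fun z : ℝ × E n => ‖fderiv ℝ χ z‖ * (C * (1 + ‖z.2‖)) :=
      Continuous.integrable_of_hasCompactSupport (by fun_prop) (hc.fderiv ℝ).norm.mul_right
    refine hi.mono' hm (hC.mono fun z hz => ?_)
    refine (ContinuousLinearMap.le_opNorm _ _).trans ?_
    rw [Prod.norm_mk, norm_zero, max_eq_right (norm_nonneg _)]
    exact mul_le_mul_of_nonneg_left hz (norm_nonneg _)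
  have i2 : Integrable fun z => velocityDiv A lam r z * χ z :=
    (hχ.continuous.integrable_of_hasCompactSupport hc).bdd_mul (c := C')
      (measurable_velocityDiv hr).aestronglyMeasurable hC'
  rw [Measure.volume_eq_prod] at i1 i2 ⊢
  rw [integral_prod _ i1, integral_prod _ i2, ← integral_neg]
  refine integral_congr_ae ?_
  filter_upwards [hd] with t ht
  have := integral_fderiv_drift hn hA hA2 hlam hB ht (contDiff_slice hχ t)
    (hasCompactSupport_slice hc t)
  simpa [fderiv_slice hχ, velocity, velocityDiv] using this

end Slab

end AggregationDiffusion

end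

noncomputable section

namespace AggregationDiffusion

open Filter Topology

/-! ### The localized comparison inequality above the level `k`. -/

section Comparison

variable {n : ℕ}

/-- The density for positive times, extended by the initial datum. -/
def extendInitial (r : ℝ × E n → ℝ) (a₀ : E n → ℝ) (z : ℝ × E n) : ℝ :=
  if z.1 ≤ 0 then a₀ z.2 else r z

/-- A weak solution on `(0,T) × ℝⁿ`, given by everywhere defined measurable functions. -/
structure IsSlabSolution (m A B lam S M K T : ℝ) (L : ℝ≥0) (r : ℝ × E n → ℝ) (a₀ : E n → ℝ)
    (G : ℝ × E n → E n) : Prop where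
  measurable : Measurable r
  nonneg : ∀ z, 0 ≤ r z
  le : ∀ z, r z ≤ S
  integrable : Integrable r
  density : ∀ᵐ t, IsDensity A lam S M L fun x => r (t, x)
  measurable₀ : Measurable a₀
  nonneg₀ : ∀ x, 0 ≤ a₀ x
  le₀ : ∀ x, a₀ x ≤ K
  memLp : MemLp G 2
  weakGradient : ∀ᵐ t ∂(volume.restrict (Ioo 0 T)),
    HasWeakGradient (fun x => r (t, x) ^ m) fun x => G (t, x)
  equation : ∀ ψ : ℝ × E n → ℝ, ContDiff ℝ ∞ ψ → HasCompactSupport ψ →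
    tsupport ψ ⊆ {z | z.1 < T} →
    ∫ z, (extendInitial r a₀ z * fderiv ℝ ψ z (1, 0)
      - fderiv ℝ ψ z (0, G z + r z • velocity A B lam r z)) = 0

lemma memLp_of_bounded_support {α : Type*} [MeasurableSpace α] {ν : Measure α} {p : ℝ≥0∞}
    {f : α → ℝ} {Q : Set α} {C : ℝ} (hf : AEStronglyMeasurable f ν) (hQ : MeasurableSet Q)
    (hν : ν Q < ⊤) (hC : ∀ᵐ x ∂ν, |f x| ≤ C) (h0 : ∀ x, x ∉ Q → f x = 0) : MemLp f p ν := by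
  have : IsFiniteMeasure (ν.restrict Q) := ⟨by simpa using hν⟩
  have h1 : MemLp f p (ν.restrict Q) := MemLp.of_bound hf.restrict C (ae_restrict_of_ae hC)
  rw [← memLp_indicator_iff_restrict hQ] at h1
  convert h1 using 1
  ext x
  by_cases hx : x ∈ Q
  · simp [hx]
  · simp [hx, h0 x hx]

variable {m A B lam S M K T k T' : ℝ} {L : ℝ≥0} {r : ℝ × E n → ℝ} {a₀ : E n → ℝ}
  {G : ℝ × E n → E n}

lemma IsSlabSolution.measurable_extend (hs : IsSlabSolution m A B lam S M K T L r a₀ G) :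
    Measurable (extendInitial r a₀) :=
  Measurable.ite (measurableSet_le measurable_fst measurable_const)
    (hs.measurable₀.comp measurable_snd) hs.measurable

lemma IsSlabSolution.extend_nonneg (hs : IsSlabSolution m A B lam S M K T L r a₀ G)
    (z : ℝ × E n) : 0 ≤ extendInitial r a₀ z := by
  unfold extendInitial
  split_ifs
  exacts [hs.nonneg₀ _, hs.nonneg _]

lemma IsSlabSolution.extend_le (hs : IsSlabSolution m A B lam S M K T L r a₀ G)
    (z : ℝ × E n) : extendInitial r a₀ z ≤ max S K := by
  unfold extendInitial
  split_ifs
  exacts [(hs.le₀ _).trans (le_max_right _ _), (hs.le _).trans (le_max_left _ _)]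

/-- The compact set that contains the supports of the test functions. -/
def testSet (n : ℕ) (T' R : ℝ) : Set (ℝ × E n) := Icc 0 T' ×ˢ Metric.closedBall 0 R

lemma isCompact_testSet (T' R : ℝ) : IsCompact (testSet n T' R) :=
  isCompact_Icc.prod (isCompact_closedBall _ _)

/-- The convexity inequality for the time derivative, in discrete form. -/
lemma IsSlabSolution.mul_integral_le (hs : IsSlabSolution m A B lam S M K T L r a₀ G)
    (tr : Truncation m k) (hK : K ≤ k) {T'' δ R : ℝ} (hδ : 0 < δ)
    (hT'' : T'' + δ ≤ T') {φ : E n → ℝ} (hφ : Measurable φ) (φ0 : ∀ x, 0 ≤ φ x)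
    (φ1 : ∀ x, φ x ≤ 1) (φR : ∀ x, R < ‖x‖ → φ x = 0) {ζ : ℝ × E n → ℝ}
    (hζ : ∀ z, ζ z = if z.1 ∈ Ioo 0 T' then (T' - z.1) * φ z.2 * tr.h (r z ^ m) else 0) :
    δ * ∫ z : ℝ × E n, (if z.1 ∈ Ioo 0 T'' then φ z.2 * tr.Φ (r z) else 0)
      ≤ ∫ w, (extendInitial r a₀ w - extendInitial r a₀ (w + -(δ • (1, 0)))) * ζ w := by
  set e : ℝ × E n := (1, 0) with he
  -- The weight has slope `-1` on `(0, T')`. Summation by parts in time thus yields the integral of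
  -- `φ Φ(r)` itself, with no boundary term at `T'`.
  set θ : ℝ → ℝ := fun t => if t ∈ Ioo 0 T' then T' - t else 0 with hθ
  have θm : Measurable θ := Measurable.ite measurableSet_Ioo (by fun_prop) measurable_const
  have θ0 : ∀ t, 0 ≤ θ t := fun t => by
    simp only [hθ]
    split_ifs with h
    · linarith [h.2]
    · rfl
  have θb : ∀ t, θ t ≤ |T'| := fun t => by
    simp only [hθ]
    split_ifs with h
    · linarith [h.1, le_abs_self T']
    · positivity
  set u := extendInitial r a₀ with hu
  have um : Measurable u := hs.measurable_extend
  have u0 : ∀ z, 0 ≤ u z := hs.extend_nonneg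
  have ub : ∀ z, u z ≤ max S K := hs.extend_le
  have sm : Measurable fun w : ℝ × E n => w + -(δ • e) := by fun_prop
  have C0 : 0 ≤ tr.C := (tr.h_nonneg 0).trans (tr.h_le 0)
  have Φb : ∀ z, tr.Φ (u z) ≤ tr.C * max S K := fun z =>
    (tr.Φ_le _ (u0 z)).trans (mul_le_mul_of_nonneg_left (ub z) C0)
  have Φ0 : ∀ z, 0 ≤ tr.Φ (u z) := fun z => tr.Φ_nonneg _ (u0 z)
  have prodb : ∀ t x z, |θ t * φ x * tr.Φ (u z)| ≤ |T'| * 1 * (tr.C * max S K) := by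
    intro t x z
    rw [abs_of_nonneg (mul_nonneg (mul_nonneg (θ0 _) (φ0 _)) (Φ0 _))]
    exact mul_le_mul (mul_le_mul (θb t) (φ1 x) (φ0 x) (abs_nonneg _)) (Φb z) (Φ0 z)
      (by positivity)
  have fin : ∀ a b R : ℝ, MeasurableSet (Icc a b ×ˢ Metric.closedBall (0 : E n) R) ∧
      volume (Icc a b ×ˢ Metric.closedBall (0 : E n) R) < ⊤ := fun a b R =>
    ⟨measurableSet_Icc.prod measurableSet_closedBall,
      (isCompact_Icc.prod (isCompact_closedBall _ _)).measure_lt_top⟩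
  have supp : ∀ c (z : ℝ × E n), z ∉ Icc (-c) (T' - c) ×ˢ Metric.closedBall (0 : E n) R →
      θ (z.1 + c) * φ z.2 = 0 := by
    intro c z hz
    rw [mem_prod, not_and_or] at hz
    rcases hz with hz | hz
    · have : z.1 + c ∉ Ioo 0 T' := fun h => hz ⟨by linarith [h.1], by linarith [h.2]⟩
      simp only [hθ, if_neg this, zero_mul]
    · rw [φR z.2 (by simpa using hz), mul_zero]
  have iJ : Integrable fun w : ℝ × E n => θ w.1 * φ w.2 * tr.Φ (u w) := by
    rw [← memLp_one_iff_integrable]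
    refine memLp_of_bounded_support (Q := Icc (-0) (T' - 0) ×ˢ Metric.closedBall (0 : E n) R)
      (((θm.comp measurable_fst).mul (hφ.comp measurable_snd)).mul
        (tr.continuous_Φ.measurable.comp um)).aestronglyMeasurable (fin _ _ _).1 (fin _ _ _).2
      (Eventually.of_forall fun w => prodb _ _ _) fun w hw => ?_
    have := supp 0 w hw
    rw [add_zero] at this
    rw [this, zero_mul]
  have iJ3 : Integrable fun w : ℝ × E n => θ (w.1 + δ) * φ w.2 * tr.Φ (u w) := by
    rw [← memLp_one_iff_integrable]
    refine memLp_of_bounded_support (Q := Icc (-δ) (T' - δ) ×ˢ Metric.closedBall (0 : E n) R)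
      (((θm.comp (measurable_fst.add_const δ)).mul (hφ.comp measurable_snd)).mul
        (tr.continuous_Φ.measurable.comp um)).aestronglyMeasurable (fin _ _ _).1 (fin _ _ _).2
      (Eventually.of_forall fun w => prodb _ _ _) fun w hw => ?_
    rw [supp δ w hw, zero_mul]
  have eJ : (fun w : ℝ × E n => θ (w.1 + δ) * φ w.2 * tr.Φ (u w)) = fun w : ℝ × E n =>
      (fun w : ℝ × E n => θ w.1 * φ w.2 * tr.Φ (u (w + -(δ • e)))) (w + δ • e) := by
    ext w
    simp only [add_neg_cancel_right]
    simp [he]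
  have iJ2 : Integrable fun w : ℝ × E n => θ w.1 * φ w.2 * tr.Φ (u (w + -(δ • e))) := by
    rw [eJ] at iJ3
    simpa using iJ3.comp_add_right (-(δ • e))
  have eJ2 : ∫ w : ℝ × E n, θ w.1 * φ w.2 * tr.Φ (u (w + -(δ • e)))
      = ∫ w : ℝ × E n, θ (w.1 + δ) * φ w.2 * tr.Φ (u w) := by
    rw [eJ, integral_add_right_eq_self
      (fun w : ℝ × E n => θ w.1 * φ w.2 * tr.Φ (u (w + -(δ • e))))]
  have hζθ : ∀ w, ζ w = θ w.1 * φ w.2 * tr.h (r w ^ m) := fun w => by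
    rw [hζ]
    simp only [hθ]
    split_ifs <;> simp
  have iζ : Integrable fun w => (u w - u (w + -(δ • e))) * ζ w := by
    rw [← memLp_one_iff_integrable]
    simp only [hζθ]
    have hcm : Measurable fun w => tr.h (r w ^ m) :=
      (continuous_iff_continuousAt.2 fun s => (tr.hasDerivAt_h s).continuousAt).measurable.comp
        (hs.measurable.pow_const m)
    refine memLp_of_bounded_support (Q := Icc (-0) (T' - 0) ×ˢ Metric.closedBall (0 : E n) R)
      (C := max S K * (|T'| * 1 * tr.C))
      ((um.sub (um.comp sm)).mul (((θm.comp measurable_fst).mul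
        (hφ.comp measurable_snd)).mul hcm)).aestronglyMeasurable (fin _ _ _).1 (fin _ _ _).2
      (Eventually.of_forall fun w => ?_) fun w hw => ?_
    · rw [abs_mul]
      have h1 : |u w - u (w + -(δ • e))| ≤ max S K :=
        abs_sub_le_of_nonneg_of_le (u0 _) (ub _) (u0 _) (ub _)
      refine mul_le_mul h1 ?_ (abs_nonneg _) ((u0 w).trans (ub w))
      rw [abs_of_nonneg (mul_nonneg (mul_nonneg (θ0 _) (φ0 _)) (tr.h_nonneg _))]
      exact mul_le_mul (mul_le_mul (θb _) (φ1 _) (φ0 _) (abs_nonneg _)) (tr.h_le _)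
        (tr.h_nonneg _) (by positivity)
    · have := supp 0 w hw
      rw [add_zero] at this
      rw [this, zero_mul, mul_zero]
  -- Convexity of `Φ` has the right sign because the difference is backward and `h` is evaluated at
  -- the later time.
  have step1 : ∀ w, θ w.1 * φ w.2 * tr.Φ (u w) - θ w.1 * φ w.2 * tr.Φ (u (w + -(δ • e)))
      ≤ (u w - u (w + -(δ • e))) * ζ w := by
    intro w
    rw [hζθ, ← mul_sub]
    by_cases hw : w.1 ∈ Ioo 0 T'
    · have e1 : r w = u w := by simp [hu, extendInitial, not_le.2 hw.1]
      rw [e1]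
      have := mul_le_mul_of_nonneg_left (tr.Φ_sub_le _ _ (u0 w) (u0 (w + -(δ • e))))
        (mul_nonneg (θ0 w.1) (φ0 w.2))
      linarith
    · simp only [hθ, if_neg hw, zero_mul, mul_zero, le_refl]
  have step2 : ∀ z : ℝ × E n, δ * (if z.1 ∈ Ioo 0 T'' then φ z.2 * tr.Φ (r z) else 0)
      ≤ θ z.1 * φ z.2 * tr.Φ (u z) - θ (z.1 + δ) * φ z.2 * tr.Φ (u z) := by
    intro z
    -- At non-positive times the extension takes values `a₀ ≤ K ≤ k`, where `Φ` vanishes, so the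
    -- initial datum contributes nothing.
    rcases le_or_gt z.1 0 with hz | hz
    · have h1 : z.1 ∉ Ioo 0 T'' := fun h => absurd h.1 (not_lt.2 hz)
      have h2 : tr.Φ (u z) = 0 := by
        have : u z = a₀ z.2 := by simp [hu, extendInitial, hz]
        rw [this]
        exact tr.Φ_eq_zero _ (hs.nonneg₀ _) ((hs.le₀ _).trans hK)
      simp [h1, h2]
    · have e1 : u z = r z := by simp [hu, extendInitial, not_le.2 hz]
      have p : 0 ≤ φ z.2 * tr.Φ (u z) := mul_nonneg (φ0 _) (Φ0 _)
      -- For `t < T''` also `t + δ < T'`, so the weight drops by exactly `δ`; at other positive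
      -- times it does not increase.
      have key : (if z.1 ∈ Ioo 0 T'' then δ else 0) ≤ θ z.1 - θ (z.1 + δ) := by
        simp only [hθ, mem_Ioo]
        split_ifs with h1 h2 h3 h4 h5 h6 <;> grind
      rw [e1] at p ⊢
      have := mul_le_mul_of_nonneg_right key p
      split_ifs at this ⊢ <;> linarith
  have iI : Integrable fun z : ℝ × E n =>
      δ * (if z.1 ∈ Ioo 0 T'' then φ z.2 * tr.Φ (r z) else 0) := by
    refine (iJ.sub iJ3).mono' ?_ (Eventually.of_forall fun z => ?_)
    · exact (Measurable.const_mul (Measurable.ite (measurable_fst measurableSet_Ioo)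
        ((hφ.comp measurable_snd).mul (tr.continuous_Φ.measurable.comp hs.measurable))
        measurable_const) δ).aestronglyMeasurable
    · rw [Real.norm_of_nonneg]
      · exact step2 z
      · refine mul_nonneg hδ.le ?_
        split_ifs
        · exact mul_nonneg (φ0 _) (tr.Φ_nonneg _ (hs.nonneg _))
        · rfl
  calc _ = ∫ z : ℝ × E n, δ * (if z.1 ∈ Ioo 0 T'' then φ z.2 * tr.Φ (r z) else 0) :=
        (integral_const_mul _ _).symm
    _ ≤ ∫ z : ℝ × E n, (θ z.1 * φ z.2 * tr.Φ (u z) - θ (z.1 + δ) * φ z.2 * tr.Φ (u z)) :=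
        integral_mono iI (iJ.sub iJ3) step2
    _ = ∫ w : ℝ × E n, (θ w.1 * φ w.2 * tr.Φ (u w)
          - θ w.1 * φ w.2 * tr.Φ (u (w + -(δ • e)))) := by
        rw [integral_sub iJ iJ3, integral_sub iJ iJ2, eJ2]
    _ ≤ _ := integral_mono (iJ.sub iJ2) iζ step1

/-- The flux through the gradient of a cutoff function. -/
def cutoffFlux (A B lam T' : ℝ) (tr : Truncation m k) (r : ℝ × E n → ℝ) (G : ℝ × E n → E n)
    (φ : E n → ℝ) (z : ℝ × E n) : ℝ :=
  if z.1 ∈ Ioo 0 T' then (T' - z.1) * (tr.h (r z ^ m) * fderiv ℝ φ z.2 (G z)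
    + (r z * tr.h (r z ^ m) - tr.P (r z ^ m)) * fderiv ℝ φ z.2 (velocity A B lam r z)) else 0

lemma Truncation.continuous_h (tr : Truncation m k) : Continuous tr.h :=
  continuous_iff_continuousAt.2 fun s => (tr.hasDerivAt_h s).continuousAt

lemma Truncation.continuous_P (tr : Truncation m k) : Continuous tr.P :=
  continuous_iff_continuousAt.2 fun s => (tr.hasDerivAt_P s).continuousAt

lemma aestronglyMeasurable_cutoffFlux (hn : 2 ≤ n) (hB : B = 2 - (n : ℝ))
    (hs : IsSlabSolution m A B lam S M K T L r a₀ G) (tr : Truncation m k) {φ : E n → ℝ}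
    (hφ : ContDiff ℝ ∞ φ) :
    AEStronglyMeasurable (cutoffFlux A B lam T' tr r G φ) volume := by
  have cd : Continuous fun z : ℝ × E n => fderiv ℝ φ z.2 :=
    (hφ.continuous_fderiv (by simp)).comp continuous_snd
  have h3 : Continuous fun q : (E n →L[ℝ] ℝ) × E n => q.1 q.2 := by fun_prop
  have m1 : AEStronglyMeasurable (fun z : ℝ × E n => fderiv ℝ φ z.2 (G z)) volume :=
    h3.comp_aestronglyMeasurable (cd.aestronglyMeasurable.prodMk hs.memLp.1)
  have m2 : AEStronglyMeasurable
      (fun z : ℝ × E n => fderiv ℝ φ z.2 (velocity A B lam r z)) volume :=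
    h3.comp_aestronglyMeasurable (cd.aestronglyMeasurable.prodMk
      (stronglyMeasurable_velocity hn hB hs.measurable).aestronglyMeasurable)
  have mh : Measurable fun z => tr.h (r z ^ m) :=
    tr.continuous_h.measurable.comp (hs.measurable.pow_const m)
  have mP : Measurable fun z => tr.P (r z ^ m) :=
    tr.continuous_P.measurable.comp (hs.measurable.pow_const m)
  have mt : Measurable fun z : ℝ × E n => T' - z.1 := by fun_prop
  have := ((mt.aestronglyMeasurable (μ := volume)).mul ((mh.aestronglyMeasurable.mul m1).add
    (((hs.measurable.mul mh).sub mP).aestronglyMeasurable.mul m2))).indicator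
    (measurable_fst (measurableSet_Ioo (a := (0 : ℝ)) (b := T')))
  refine this.congr (Eventually.of_forall fun z => ?_)
  simp only [cutoffFlux, indicator, mem_preimage, Pi.mul_apply, Pi.add_apply, Pi.sub_apply]

/-- The flux through a cutoff function is dominated by an integrable function that does not depend
on the cutoff. -/
lemma exists_cutoffFlux_le (hn : 2 ≤ n) (hA : 2 - (n : ℝ) < A) (hA2 : A ≤ 2) (hlam : 0 < lam)
    (hB : B = 2 - (n : ℝ)) (hm : 0 < m) (hk : 0 < k)
    (hs : IsSlabSolution m A B lam S M K T L r a₀ G) (tr : Truncation m k) (T' Cφ : ℝ) :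
    ∃ D : ℝ × E n → ℝ, Integrable D ∧ ∀ φ : E n → ℝ,
      (∀ x, ‖fderiv ℝ φ x‖ * (1 + ‖x‖) ≤ Cφ) →
      ∀ᵐ z, ‖cutoffFlux A B lam T' tr r G φ z‖ ≤ D z := by
  obtain ⟨CV, CV0, hCV⟩ := exists_velocity_le hn hA hA2 hlam hB hs.density
  have C0 : 0 ≤ tr.C := (tr.h_nonneg 0).trans (tr.h_le 0)
  have rL2 : MemLp r 2 := by
    rw [memLp_two_iff_integrable_sq hs.measurable.aestronglyMeasurable]
    simp only [sq]
    refine hs.integrable.bdd_mul (c := S) hs.measurable.aestronglyMeasurable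
      (Eventually.of_forall fun z => ?_)
    rw [Real.norm_of_nonneg (hs.nonneg z)]
    exact hs.le z
  -- A bounded truncation that vanishes for `r ≤ k` is at most a multiple of `r`. This makes the
  -- flux integrable at infinity: `r ‖G‖` is a product of L² functions, and the growth of the
  -- velocity is absorbed by the decay of the gradient of `φ`.
  have h_small : ∀ q : ℝ → ℝ, (∀ s, q s ≤ tr.C) → (∀ s, s ≤ k ^ m → q s = 0) →
      ∀ z, q (r z ^ m) ≤ tr.C / k * r z := by
    intro q hq hq0 z
    rcases le_or_gt (r z) k with h | h
    · rw [hq0 _ (Real.rpow_le_rpow (hs.nonneg z) h hm.le)]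
      exact mul_nonneg (by positivity) (hs.nonneg z)
    · refine (hq _).trans ?_
      rw [div_mul_eq_mul_div, le_div_iff₀ hk]
      exact mul_le_mul_of_nonneg_left h.le C0
  refine ⟨fun z => |T'| * (tr.C / k * Cφ * (r z * ‖G z‖)
      + (tr.C + tr.C / k) * (Cφ * CV) * r z), ?_, fun φ hφ => ?_⟩
  · exact (((rL2.integrable_mul hs.memLp.norm).const_mul _).add
      (hs.integrable.const_mul _)).const_mul _
  · have Cφ0 : 0 ≤ Cφ := (by positivity : (0 : ℝ) ≤ _).trans (hφ 0)
    filter_upwards [hCV] with z hz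
    have hr := hs.nonneg z
    have hf : ‖fderiv ℝ φ z.2‖ ≤ Cφ := by
      refine le_trans ?_ (hφ z.2)
      nlinarith [norm_nonneg (fderiv ℝ φ z.2), norm_nonneg z.2]
    have b1 : |fderiv ℝ φ z.2 (G z)| ≤ Cφ * ‖G z‖ :=
      ((fderiv ℝ φ z.2).le_opNorm (G z)).trans (mul_le_mul_of_nonneg_right hf (norm_nonneg _))
    have b2 : |fderiv ℝ φ z.2 (velocity A B lam r z)| ≤ Cφ * CV := by
      refine ((fderiv ℝ φ z.2).le_opNorm _).trans ?_
      calc _ ≤ ‖fderiv ℝ φ z.2‖ * (CV * (1 + ‖z.2‖)) :=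
            mul_le_mul_of_nonneg_left hz (norm_nonneg _)
        _ = ‖fderiv ℝ φ z.2‖ * (1 + ‖z.2‖) * CV := by ring
        _ ≤ _ := mul_le_mul_of_nonneg_right (hφ _) CV0
    have h1 := h_small tr.h tr.h_le tr.h_eq_zero z
    have h2 := h_small tr.P tr.P_le tr.P_eq_zero z
    have h3 : |r z * tr.h (r z ^ m) - tr.P (r z ^ m)| ≤ (tr.C + tr.C / k) * r z := by
      have := mul_le_mul_of_nonneg_left (tr.h_le (r z ^ m)) hr
      have := mul_nonneg hr (tr.h_nonneg (r z ^ m))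
      have := tr.P_nonneg (r z ^ m)
      rw [abs_le]
      have : 0 ≤ tr.C / k * r z := mul_nonneg (by positivity) hr
      have : 0 ≤ tr.C * r z := mul_nonneg C0 hr
      constructor <;> linarith
    have D0 : 0 ≤ tr.C / k * Cφ * (r z * ‖G z‖) + (tr.C + tr.C / k) * (Cφ * CV) * r z := by
      positivity
    unfold cutoffFlux
    split_ifs with ht
    · rw [Real.norm_eq_abs, abs_mul]
      refine mul_le_mul ?_ ?_ (abs_nonneg _) (abs_nonneg _)
      · rw [abs_of_nonneg (by linarith [ht.2])]
        linarith [ht.1, le_abs_self T']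
      · refine (abs_add_le _ _).trans (add_le_add ?_ ?_)
        · rw [abs_mul, abs_of_nonneg (tr.h_nonneg _)]
          calc _ ≤ tr.C / k * r z * (Cφ * ‖G z‖) :=
                mul_le_mul h1 b1 (abs_nonneg _) (mul_nonneg (by positivity) hr)
            _ = _ := by ring
        · rw [abs_mul]
          calc _ ≤ (tr.C + tr.C / k) * r z * (Cφ * CV) :=
                mul_le_mul h3 b2 (abs_nonneg _) (mul_nonneg (by positivity) hr)
            _ = _ := by ring
    · rw [norm_zero]
      exact mul_nonneg (abs_nonneg _) D0

/-- The test functions `(T' - t) φ(x) p(f(t,x))` and their weak derivatives. -/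
lemma weakDeriv_testFunction {R C Cφ : ℝ} (h0T : 0 < T') {φ : E n → ℝ} (hφ : ContDiff ℝ ∞ φ)
    (φ0 : ∀ x, 0 ≤ φ x) (φ1 : ∀ x, φ x ≤ 1) (φR : ∀ x, R < ‖x‖ → φ x = 0 ∧ fderiv ℝ φ x = 0)
    (φC : ∀ x, ‖fderiv ℝ φ x‖ ≤ Cφ) {f : ℝ × E n → ℝ} {g : Fin n → ℝ × E n → ℝ}
    (hf : Measurable f) (hfl : LocallyIntegrable f volume) (hg : ∀ i, MemLp (g i) 2)
    (hf0 : ∀ z : ℝ × E n, z.1 ∉ Ioo 0 T' → f z = 0)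
    (hg0 : ∀ i (z : ℝ × E n), z.1 ∉ Ioo 0 T' → g i z = 0)
    (wd : ∀ i, HasWeakDeriv volume (spaceDir i) f (g i)) {p p' : ℝ → ℝ}
    (hp : ∀ s, HasDerivAt p (p' s) s) (hp' : Continuous p') (p0 : ∀ s, 0 ≤ p s)
    (pC : ∀ s, p s ≤ C) (p'C : ∀ s, |p' s| ≤ C) (pz : p 0 = 0) :
    (∀ z, z ∉ testSet n T' R → (T' - z.1) * φ z.2 * p (f z) = 0) ∧
    MemLp (fun z => (T' - z.1) * φ z.2 * p (f z)) 2 volume ∧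
    (∀ i, MemLp (fun z => (T' - z.1) * φ z.2 * (p' (f z) * g i z)
      + (T' - z.1) * fderiv ℝ φ z.2 (EuclideanSpace.single i 1) * p (f z)) 2 volume) ∧
    ∀ i, HasWeakDeriv volume (spaceDir i) (fun z => (T' - z.1) * φ z.2 * p (f z))
      (fun z => (T' - z.1) * φ z.2 * (p' (f z) * g i z)
        + (T' - z.1) * fderiv ℝ φ z.2 (EuclideanSpace.single i 1) * p (f z)) := by
  have C0 : 0 ≤ C := (p0 0).trans (pC 0)
  have Cφ0 : 0 ≤ Cφ := (norm_nonneg _).trans (φC 0)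
  set α : ℝ × E n → ℝ := fun z => (T' - z.1) * φ z.2 with hα
  have αs : ContDiff ℝ ∞ α := (contDiff_const.sub contDiff_fst).mul (hφ.comp contDiff_snd)
  have αd : ∀ z (i : Fin n), fderiv ℝ α z (spaceDir i)
      = (T' - z.1) * fderiv ℝ φ z.2 (EuclideanSpace.single i 1) := by
    intro z i
    have h := fderiv_slice αs z.1 z.2 (EuclideanSpace.single i 1)
    change fderiv ℝ α (z.1, z.2) (0, EuclideanSpace.single i 1) = _
    rw [← h]
    have : (fun x => α (z.1, x)) = fun x => (T' - z.1) * φ x := rfl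
    rw [this, fderiv_const_mul (hφ.differentiable (by simp)).differentiableAt]
    rfl
  have pc : Continuous p := continuous_iff_continuousAt.2 fun s => (hp s).continuousAt
  have pm : Measurable fun z => p (f z) := pc.measurable.comp hf
  -- The weight `α` is not cut off in time. Off the interval the test function vanishes because `f =
  -- 0` and `p 0 = 0`.
  have offQ : ∀ z : ℝ × E n, z ∉ testSet n T' R →
      z.1 ∉ Ioo 0 T' ∨ φ z.2 = 0 ∧ fderiv ℝ φ z.2 = 0 := by
    intro z hz
    by_cases h : z.1 ∈ Ioo 0 T'
    · refine Or.inr (φR _ ?_)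
      by_contra! h2
      exact hz ⟨Ioo_subset_Icc_self h, by simpa using h2⟩
    · exact Or.inl h
  have pout : ∀ z : ℝ × E n, z.1 ∉ Ioo 0 T' → p (f z) = 0 := fun z hz => by rw [hf0 z hz, pz]
  have θb : ∀ z : ℝ × E n, z.1 ∈ Ioo 0 T' → |T' - z.1| ≤ T' := fun z hz => by
    rw [abs_of_nonneg (by linarith [hz.2])]
    linarith [hz.1]
  have αb : ∀ z : ℝ × E n, z.1 ∈ Ioo 0 T' → |α z| ≤ T' := by
    intro z hz
    simp only [hα]
    rw [abs_mul, abs_of_nonneg (φ0 z.2)]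
    exact (mul_le_mul (θb z hz) (φ1 z.2) (φ0 z.2) h0T.le).trans_eq (mul_one _)
  have Qm := (isCompact_testSet (n := n) T' R).measurableSet
  have Qf := (isCompact_testSet (n := n) T' R).measure_lt_top (μ := volume)
  have m1 : MemLp (fun z => α z * p (f z)) 2 volume := by
    refine memLp_of_bounded_support (C := T' * C)
      (αs.continuous.measurable.mul pm).aestronglyMeasurable Qm Qf
      (Eventually.of_forall fun z => ?_) fun z hz => ?_
    · by_cases h : z.1 ∈ Ioo 0 T'
      · rw [abs_mul, abs_of_nonneg (p0 _)]
        exact mul_le_mul (αb z h) (pC _) (p0 _) h0T.le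
      · rw [pout z h, mul_zero, abs_zero]
        positivity
    · rcases offQ z hz with h | h
      · rw [pout z h, mul_zero]
      · simp [hα, h.1]
  have p'm : Measurable fun z => p' (f z) := hp'.measurable.comp hf
  have m0 : ∀ i, MemLp (fun z => p' (f z) * g i z) 2 volume := fun i => by
    refine (hg i).of_le_mul (c := C) (p'm.aestronglyMeasurable.mul (hg i).1)
      (Eventually.of_forall fun z => ?_)
    rw [norm_mul]
    exact mul_le_mul_of_nonneg_right (p'C _) (norm_nonneg _)
  have m2 : ∀ i, MemLp (fun z => α z * (p' (f z) * g i z)) 2 volume := fun i => by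
    refine (m0 i).of_le_mul (c := T') (αs.continuous.aestronglyMeasurable.mul (m0 i).1)
      (Eventually.of_forall fun z => ?_)
    by_cases h : z.1 ∈ Ioo 0 T'
    · rw [norm_mul]
      exact mul_le_mul_of_nonneg_right (αb z h) (norm_nonneg _)
    · simp [hg0 i z h]
  have cd : Continuous (fderiv ℝ φ) := hφ.continuous_fderiv (by simp)
  have m3 : ∀ i : Fin n, MemLp (fun z : ℝ × E n =>
      (T' - z.1) * fderiv ℝ φ z.2 (EuclideanSpace.single i 1) * p (f z)) 2 volume := fun i => by
    have hc : Continuous fun z : ℝ × E n =>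
        (T' - z.1) * fderiv ℝ φ z.2 (EuclideanSpace.single i 1) := by fun_prop
    refine memLp_of_bounded_support (C := T' * Cφ * C)
      (hc.measurable.mul pm).aestronglyMeasurable Qm Qf
      (Eventually.of_forall fun z => ?_) fun z hz => ?_
    · by_cases h : z.1 ∈ Ioo 0 T'
      · rw [abs_mul, abs_mul, abs_of_nonneg (p0 _)]
        have h1 : |fderiv ℝ φ z.2 (EuclideanSpace.single i 1)| ≤ Cφ := by
          have := (fderiv ℝ φ z.2).le_opNorm (EuclideanSpace.single i 1)
          rw [PiLp.norm_single, norm_one, mul_one] at this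
          exact this.trans (φC _)
        exact mul_le_mul (mul_le_mul (θb z h) h1 (abs_nonneg _) h0T.le) (pC _) (p0 _)
          (by positivity)
      · rw [pout z h, mul_zero, abs_zero]
        positivity
    · rcases offQ z hz with h | h
      · rw [pout z h, mul_zero]
      · simp [h.2]
  refine ⟨fun z hz => ?_, m1, fun i => (m2 i).add (m3 i), fun i => ?_⟩
  · rcases offQ z hz with h | h
    · rw [pout z h, mul_zero]
    · rw [h.1, mul_zero, zero_mul]
  · have hl : LocallyIntegrable (fun z => p (f z)) volume := by
      have hc : LocallyIntegrable (fun _ : ℝ × E n => C) volume := locallyIntegrable_const _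
      refine hc.mono pm.aestronglyMeasurable (Eventually.of_forall fun z => ?_)
      rw [Real.norm_of_nonneg (p0 _)]
      exact (pC _).trans (le_abs_self _)
    have := ((wd i).comp hfl (hg i) hp hp' (C₀ := C) (C₁ := C)
      (fun s => by rw [abs_of_nonneg (p0 s)]; exact pC s) p'C).smooth_mul αs hl
      ((m0 i).locallyIntegrable (by simp))
    simpa only [αd] using this

/-- The localized comparison inequality. -/
lemma IsSlabSolution.integral_le_neg_flux (hn : 2 ≤ n) (hA : 2 - (n : ℝ) < A) (hA2 : A ≤ 2)
    (hlam : 0 < lam) (hB : B = 2 - (n : ℝ)) (hm : 0 < m) (hk : 0 < k)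
    (hs : IsSlabSolution m A B lam S M K T L r a₀ G) (tr : Truncation m k) (hK : K ≤ k)
    (hdiv : ∀ᵐ z, k ≤ r z → velocityDiv A lam r z ≤ 0) {T'' R Cφ : ℝ} (h0T : 0 < T')
    (hT'' : T'' < T') (hT' : T' < T) (hR : 0 < R) {φ : E n → ℝ} (hφ : ContDiff ℝ ∞ φ)
    (φ0 : ∀ x, 0 ≤ φ x) (φ1 : ∀ x, φ x ≤ 1) (φR : ∀ x, R < ‖x‖ → φ x = 0 ∧ fderiv ℝ φ x = 0)
    (φC : ∀ x, ‖fderiv ℝ φ x‖ * (1 + ‖x‖) ≤ Cφ) :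
    ∫ z : ℝ × E n, (if z.1 ∈ Ioo 0 T'' then φ z.2 * tr.Φ (r z) else 0)
      ≤ - ∫ z, cutoffFlux A B lam T' tr r G φ z := by
  have C0 : 0 ≤ tr.C := (tr.h_nonneg 0).trans (tr.h_le 0)
  obtain ⟨CV, CV0, hCV⟩ := exists_velocity_le hn hA hA2 hlam hB hs.density
  obtain ⟨CD, hCD⟩ := exists_abs_velocityDiv_le hn hA hA2 hlam hs.density
  obtain ⟨D, hDi, hD⟩ := exists_cutoffFlux_le hn hA hA2 hlam hB hm hk hs tr T' Cφ
  have fi : Integrable (cutoffFlux A B lam T' tr r G φ) :=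
    hDi.mono' (aestronglyMeasurable_cutoffFlux hn hB hs tr hφ) (hD φ φC)
  set J : Set ℝ := Ioo 0 T' with hJ
  set PJ : Set (ℝ × E n) := Prod.fst ⁻¹' J with hPJ
  have mPJ : MeasurableSet PJ := measurable_fst measurableSet_Ioo
  set Q : Set (ℝ × E n) := testSet n T' R with hQ
  have Qc : IsCompact Q := isCompact_testSet T' R
  -- A bounded neighbourhood of the test set, reaching into negative times but staying below `T`.
  -- Cutting the merely locally bounded fields off outside `Z` puts them in L² and does not affect
  -- test functions supported in `Z`.
  set Z : Set (ℝ × E n) := Ioo (-1) T ×ˢ Metric.ball 0 (R + 1) with hZ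
  have mZ : MeasurableSet Z := measurableSet_Ioo.prod measurableSet_ball
  have Zf : volume Z < ⊤ := by
    refine (measure_mono (?_ : Z ⊆ Icc (-1) T ×ˢ Metric.closedBall 0 (R + 1))).trans_lt
      (isCompact_Icc.prod (isCompact_closedBall _ _)).measure_lt_top
    exact prod_mono Ioo_subset_Icc_self Metric.ball_subset_closedBall
  obtain ⟨ε, ε0, ε1, εT⟩ : ∃ ε : ℝ, 0 < ε ∧ ε < 1 ∧ ε < T - T' := by
    refine ⟨min 1 (T - T') / 2, ?_, ?_, ?_⟩
    · have : 0 < min 1 (T - T') := lt_min one_pos (by linarith)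
      linarith
    · linarith [min_le_left 1 (T - T')]
    · have := min_le_right 1 (T - T')
      linarith
  have hthick : Metric.cthickening ε Q ⊆ Z := by
    rw [Qc.cthickening_eq_biUnion_closedBall ε0.le]
    intro z hz
    simp only [mem_iUnion] at hz
    obtain ⟨y, hy, hzy⟩ := hz
    rw [Metric.mem_closedBall, Prod.dist_eq, max_le_iff, Real.dist_eq, abs_le] at hzy
    obtain ⟨⟨y1, y2⟩, y3⟩ := hy
    rw [mem_closedBall_zero_iff] at y3
    refine ⟨⟨by linarith, by linarith⟩, ?_⟩
    rw [mem_ball_zero_iff]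
    have := norm_le_norm_add_norm_sub y.2 z.2
    rw [← dist_eq_norm, dist_comm] at this
    linarith [hzy.2]
  have QZ : Q ⊆ Z := (Metric.self_subset_cthickening Q).trans hthick
  set f₀ : ℝ × E n → ℝ := PJ.indicator fun z => r z ^ m with hf₀
  set g₀ : Fin n → ℝ × E n → ℝ := fun i => PJ.indicator fun z => G z i with hg₀
  have f₀in : ∀ z, z.1 ∈ J → f₀ z = r z ^ m := fun z hz => indicator_of_mem (s := PJ) hz _
  have f₀out : ∀ z, z.1 ∉ J → f₀ z = 0 := fun z hz => indicator_of_notMem (s := PJ) hz _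
  have g₀in : ∀ i z, z.1 ∈ J → g₀ i z = G z i := fun i z hz => indicator_of_mem (s := PJ) hz _
  have g₀out : ∀ i z, z.1 ∉ J → g₀ i z = 0 := fun i z hz => indicator_of_notMem (s := PJ) hz _
  have km : 0 ≤ k ^ m := by positivity
  have rmm : Measurable fun z => r z ^ m := hs.measurable.pow_const m
  have rml : LocallyIntegrable (fun z => r z ^ m) volume := by
    have hc : LocallyIntegrable (fun _ : ℝ × E n => S ^ m) volume :=
      locallyIntegrable_const _
    refine hc.mono rmm.aestronglyMeasurable (Eventually.of_forall fun z => ?_)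
    rw [Real.norm_of_nonneg (Real.rpow_nonneg (hs.nonneg z) m)]
    exact (Real.rpow_le_rpow (hs.nonneg z) (hs.le z) hm.le).trans (le_abs_self _)
  have f₀m : Measurable f₀ := rmm.indicator mPJ
  have f₀l : LocallyIntegrable f₀ volume := rml.indicator mPJ
  have GiL : ∀ i : Fin n, MemLp (fun z => G z i) 2 := fun i =>
    hs.memLp.mono ((EuclideanSpace.proj (𝕜 := ℝ) i).continuous.comp_aestronglyMeasurable
      hs.memLp.1) (Eventually.of_forall fun z => PiLp.norm_apply_le _ i)
  have g₀L : ∀ i, MemLp (g₀ i) 2 := fun i => (GiL i).indicator mPJ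
  have wd : ∀ i, HasWeakDeriv volume (spaceDir i) f₀ (g₀ i) := fun i =>
    hasWeakDeriv_indicator measurableSet_Ioo
      (ae_restrict_of_ae_restrict_of_subset (Ioo_subset_Ioo_right hT'.le) hs.weakGradient)
      rml (hs.memLp.locallyIntegrable (by simp)) i
  have φC' : ∀ x, ‖fderiv ℝ φ x‖ ≤ Cφ := fun x => by
    refine le_trans ?_ (φC x)
    nlinarith [norm_nonneg (fderiv ℝ φ x), norm_nonneg x]
  -- Two test functions: `ζ`, built from `h`, for the evolution equation, and `ξ`, built from `P`,
  -- for the divergence of the drift.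
  obtain ⟨ζ0, ζL, HζL, ζw⟩ := weakDeriv_testFunction h0T hφ φ0 φ1 φR φC' f₀m f₀l g₀L f₀out
    g₀out wd tr.hasDerivAt_h tr.continuous_h' tr.h_nonneg tr.h_le
    (fun s => by rw [abs_of_nonneg (tr.h'_nonneg s)]; exact tr.h'_le s) (tr.h_eq_zero 0 km)
  obtain ⟨ξ0, ξL, HξL, ξw⟩ := weakDeriv_testFunction h0T hφ φ0 φ1 φR φC' f₀m f₀l g₀L f₀out
    g₀out wd tr.hasDerivAt_P tr.continuous_P' tr.P_nonneg tr.P_le tr.abs_P'_le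
    (tr.P_eq_zero 0 km)
  set ζ : ℝ × E n → ℝ := fun z => (T' - z.1) * φ z.2 * tr.h (f₀ z) with hζ
  set ξ : ℝ × E n → ℝ := fun z => (T' - z.1) * φ z.2 * tr.P (f₀ z) with hξ
  set Hζ : Fin n → ℝ × E n → ℝ := fun i z => (T' - z.1) * φ z.2 * (tr.h' (f₀ z) * g₀ i z)
      + (T' - z.1) * fderiv ℝ φ z.2 (EuclideanSpace.single i 1) * tr.h (f₀ z) with hHζ
  set Hξ : Fin n → ℝ × E n → ℝ := fun i z => (T' - z.1) * φ z.2 * (tr.P' (f₀ z) * g₀ i z)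
      + (T' - z.1) * fderiv ℝ φ z.2 (EuclideanSpace.single i 1) * tr.P (f₀ z) with hHξ
  have supζ : Function.support ζ ⊆ Q := fun z hz => by
    by_contra h; exact hz (ζ0 z h)
  have supξ : Function.support ξ ⊆ Q := fun z hz => by
    by_contra h; exact hz (ξ0 z h)
  set V : ℝ × E n → E n := velocity A B lam r with hV
  set u : ℝ × E n → ℝ := extendInitial r a₀ with hu
  have Vm : StronglyMeasurable V := stronglyMeasurable_velocity hn hB hs.measurable
  have Vim : ∀ i : Fin n, Measurable fun z => V z i := fun i =>
    ((EuclideanSpace.proj (𝕜 := ℝ) i).continuous.comp_stronglyMeasurable Vm).measurable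
  have Vib : ∀ᵐ z, z ∈ Z → ∀ i, |V z i| ≤ CV * (2 + R) := by
    filter_upwards [hCV] with z hz hzZ i
    refine (PiLp.norm_apply_le (V z) i).trans (hz.trans ?_)
    have := mem_ball_zero_iff.1 hzZ.2
    exact mul_le_mul_of_nonneg_left (by linarith) CV0
  set FV : Fin n → ℝ × E n → ℝ := fun i => Z.indicator fun z => V z i with hFV
  have FVL : ∀ i, MemLp (FV i) 2 := fun i => by
    refine memLp_of_bounded_support (C := CV * (2 + R)) ((Vim i).indicator mZ).aestronglyMeasurable
      mZ Zf ?_ fun z hz => indicator_of_notMem hz _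
    filter_upwards [Vib] with z hz
    by_cases h : z ∈ Z
    · simpa [hFV, h] using hz h i
    · simp [hFV, h]
      positivity
  set F : Fin n → ℝ × E n → ℝ := fun i => Z.indicator fun z => G z i + r z * V z i with hF
  have FL : ∀ i, MemLp (F i) 2 := fun i => by
    have h1 : MemLp (fun z => r z * FV i z) 2 volume := by
      refine (FVL i).of_le_mul (c := S) (hs.measurable.aestronglyMeasurable.mul (FVL i).1)
        (Eventually.of_forall fun z => ?_)
      rw [norm_mul, Real.norm_of_nonneg (hs.nonneg z)]
      exact mul_le_mul_of_nonneg_right (hs.le z) (norm_nonneg _)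
    have h2 := ((GiL i).indicator mZ).add h1
    refine h2.ae_eq (Eventually.of_forall fun z => ?_)
    by_cases h : z ∈ Z <;> simp [hF, hFV, h]
  set gD : ℝ × E n → ℝ := Z.indicator (velocityDiv A lam r) with hgD
  have gDL : MemLp gD 2 := by
    refine memLp_of_bounded_support (C := |CD|)
      ((measurable_velocityDiv hs.measurable).indicator mZ).aestronglyMeasurable
      mZ Zf ?_ fun z hz => indicator_of_notMem hz _
    filter_upwards [hCD] with z hz
    by_cases h : z ∈ Z
    · simpa [hgD, h] using hz.trans (le_abs_self _)
    · simp [hgD, h]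
  set a : ℝ × E n → ℝ := Z.indicator u with ha
  have aL : MemLp a 2 := by
    refine memLp_of_bounded_support (C := max S K) (hs.measurable_extend.indicator
      mZ).aestronglyMeasurable mZ Zf (Eventually.of_forall fun z => ?_)
      fun z hz => indicator_of_notMem hz _
    by_cases h : z ∈ Z
    · simp only [ha, h, indicator_of_mem]
      rw [abs_of_nonneg (hs.extend_nonneg z)]
      exact hs.extend_le z
    · simp only [ha, h, not_false_eq_true, indicator_of_notMem, abs_zero]
      exact (hs.extend_nonneg z).trans (hs.extend_le z)
  have χoff : ∀ χ : ℝ × E n → ℝ, tsupport χ ⊆ Z → ∀ z, z ∉ Z → fderiv ℝ χ z = 0 ∧ χ z = 0 :=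
    fun χ hχ z hz => ⟨by
      by_contra h
      exact hz (hχ (support_fderiv_subset ℝ h)), image_eq_zero_of_notMem_tsupport
        fun h => hz (hχ h)⟩
  have χL : ∀ χ : ℝ × E n → ℝ, ContDiff ℝ ∞ χ → HasCompactSupport χ → ∀ v,
      MemLp (fun z => fderiv ℝ χ z v) 2 (volume : Measure (ℝ × E n)) := fun χ hχ hc v =>
    ((hχ.continuous_fderiv (by simp)).clm_apply continuous_const).memLp_of_hasCompactSupport
      (hc.fderiv_apply ℝ v)
  have t2 := tendsto_difference_quotient (e := ((1, 0) : ℝ × E n)) ε0 Qc supζ hthick FL aL ζL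
    HζL ζw fun χ hχ hc hsup => by
      have i1 : ∀ i, Integrable fun z => F i z * fderiv ℝ χ z (spaceDir i) := fun i =>
        (FL i).integrable_mul (χL χ hχ hc _)
      have i2 : Integrable fun z => a z * fderiv ℝ χ z (1, 0) :=
        aL.integrable_mul (χL χ hχ hc _)
      have h := hs.equation χ hχ hc (hsup.trans fun z hz => hz.1.2)
      rw [← integral_finsetSum _ fun i _ => i1 i, eq_comm, ← sub_eq_zero,
        ← integral_sub i2 (integrable_finsetSum _ fun i _ => i1 i), ← h]
      refine integral_congr_ae (Eventually.of_forall fun z => ?_)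
      by_cases hz : z ∈ Z
      · simp only [ha, hF, hz, indicator_of_mem]
        rw [← sum_mul_apply_spaceDir]
        rfl
      · simp [(χoff χ hsup z hz).1]
  have t1 := sum_integral_mul_weakDeriv ε0 Qc supξ hthick FVL gDL ξL HξL ξw
    fun χ hχ hc hsup => by
      have i1 : ∀ i, Integrable fun z => FV i z * fderiv ℝ χ z (spaceDir i) := fun i =>
        (FVL i).integrable_mul (χL χ hχ hc _)
      have h := integral_fderiv_velocity hn hA hA2 hlam hB hs.measurable hs.density hχ hc
      rw [← integral_finsetSum _ fun i _ => i1 i]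
      have e1 : ∀ z, ∑ i, FV i z * fderiv ℝ χ z (spaceDir i)
          = fderiv ℝ χ z (0, velocity A B lam r z) := fun z => by
        by_cases hz : z ∈ Z
        · simp only [hFV, hz, indicator_of_mem]
          rw [sum_mul_apply_spaceDir]
        · simp [(χoff χ hsup z hz).1]
      have e2 : ∀ z, gD z * χ z = velocityDiv A lam r z * χ z := fun z => by
        by_cases hz : z ∈ Z
        · simp [hgD, hz]
        · simp [(χoff χ hsup z hz).2]
      simp only [e1, e2]
      exact h
  have lower : ∫ z : ℝ × E n, (if z.1 ∈ Ioo 0 T'' then φ z.2 * tr.Φ (r z) else 0)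
      ≤ - ∑ i, ∫ z, F i z * Hζ i z := by
    refine ge_of_tendsto t2 ?_
    have hev : ∀ᶠ δ : ℝ in 𝓝[>] 0, δ < min ε (T' - T'') :=
      (tendsto_id.mono_left nhdsWithin_le_nhds).eventually_lt_const
        (lt_min ε0 (by linarith))
    filter_upwards [hev, self_mem_nhdsWithin] with δ hδ (hδ0 : 0 < δ)
    have h := hs.mul_integral_le (T' := T') (ζ := ζ) (T'' := T'') tr hK hδ0
      (by linarith [min_le_right ε (T' - T'')]) hφ.continuous.measurable φ0 φ1
      (fun x hx => (φR x hx).1) fun z => by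
        by_cases hz : z.1 ∈ Ioo 0 T'
        · simp only [hζ, if_pos hz, f₀in z hz]
        · simp only [hζ, if_neg hz, f₀out z hz, tr.h_eq_zero 0 km, mul_zero]
    rw [le_inv_mul_iff₀ hδ0]
    refine h.trans_eq ?_
    have i0 : ∀ e, Integrable fun w => a (w + e) * ζ w := fun e =>
      (memLp_comp_add_right aL e).integrable_mul ζL
    rw [corr, corr, ← integral_sub (i0 _) (i0 _)]
    refine integral_congr_ae (Eventually.of_forall fun w => ?_)
    simp only [add_zero]
    by_cases hw : w ∈ Q
    · have hw1 : w ∈ Z := QZ hw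
      have hw2 : w + -(δ • ((1, 0) : ℝ × E n)) ∈ Z := by
        refine hthick (Metric.mem_cthickening_of_dist_le _ w _ _ hw ?_)
        rw [dist_eq_norm, add_sub_cancel_left, norm_neg, norm_smul, Prod.norm_def]
        simp
        rw [abs_of_pos hδ0]
        linarith [min_le_left ε (T' - T'')]
      simp only [ha, hw1, hw2, indicator_of_mem]
      ring
    · have h0 : ζ w = 0 := ζ0 w hw
      simp only [h0, mul_zero, sub_zero]
  have iF : ∀ i, Integrable fun z => F i z * Hζ i z := fun i => (FL i).integrable_mul (HζL i)
  have iFV : ∀ i, Integrable fun z => FV i z * Hξ i z := fun i => (FVL i).integrable_mul (HξL i)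
  -- Since `P' = s ^ (1 / m) h'`, the terms `r h' G·V` cancel between the two test functions. What
  -- remains is the cutoff flux and the non-negative dissipation `h' |G|²`, which is dropped.
  have pointwise : ∀ z, cutoffFlux A B lam T' tr r G φ z
      ≤ ∑ i, (F i z * Hζ i z - FV i z * Hξ i z) := by
    intro z
    by_cases hz : z.1 ∈ Ioo 0 T'
    · by_cases hzZ : z ∈ Z
      · have e : ∀ i, F i z * Hζ i z - FV i z * Hξ i z
            = (T' - z.1) * φ z.2 * tr.h' (r z ^ m) * (G z i) ^ 2
              + (T' - z.1) * (tr.h (r z ^ m) * (G z i * fderiv ℝ φ z.2 (EuclideanSpace.single i 1))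
              + (r z * tr.h (r z ^ m) - tr.P (r z ^ m))
                * (V z i * fderiv ℝ φ z.2 (EuclideanSpace.single i 1))) := fun i => by
          simp only [hF, hFV, hHζ, hHξ, hzZ, indicator_of_mem, f₀in z hz, g₀in i z hz,
            tr.P'_rpow _ (hs.nonneg z)]
          ring
        simp only [e]
        rw [Finset.sum_add_distrib, ← Finset.mul_sum, ← Finset.mul_sum, Finset.sum_add_distrib,
          ← Finset.mul_sum, ← Finset.mul_sum, sum_mul_apply_single, sum_mul_apply_single,
          cutoffFlux, if_pos hz]
        have : 0 ≤ (T' - z.1) * φ z.2 * tr.h' (r z ^ m) * ∑ i, (G z i) ^ 2 :=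
          mul_nonneg (mul_nonneg (mul_nonneg (by linarith [hz.2]) (φ0 _)) (tr.h'_nonneg _))
            (Finset.sum_nonneg fun i _ => sq_nonneg _)
        linarith
      · have hR2 : R < ‖z.2‖ := by
          by_contra! h
          exact hzZ (QZ ⟨Ioo_subset_Icc_self hz, by simpa using h⟩)
        simp [cutoffFlux, hHζ, hHξ, (φR _ hR2).1, (φR _ hR2).2]
    · have hz' : ¬ (0 < z.1 ∧ z.1 < T') := hz
      simp [cutoffFlux, hHζ, hHξ, hz', f₀out z hz, g₀out _ z hz, tr.h_eq_zero 0 km,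
        tr.P_eq_zero 0 km]
  have compare : ∫ z, cutoffFlux A B lam T' tr r G φ z
      ≤ (∑ i, ∫ z, F i z * Hζ i z) - ∑ i, ∫ z, FV i z * Hξ i z := by
    refine (integral_mono fi (integrable_finsetSum _ fun i _ => (iF i).sub (iFV i))
      pointwise).trans_eq ?_
    rw [integral_finsetSum _ fun i _ => (iF i).sub (iFV i), ← Finset.sum_sub_distrib]
    exact Finset.sum_congr rfl fun i _ => integral_sub (iF i) (iFV i)
  -- `P` vanishes where `r < k`; elsewhere the divergence is non-positive by hypothesis.
  have sign : ∫ z, gD z * ξ z ≤ 0 := by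
    refine integral_nonpos_of_ae ?_
    filter_upwards [hdiv] with z hz
    by_cases hzJ : z.1 ∈ Ioo 0 T'
    · by_cases hzZ : z ∈ Z
      · rcases lt_or_ge (r z) k with h | h
        · simp [hξ, f₀in z hzJ,
            tr.P_eq_zero _ (Real.rpow_le_rpow (hs.nonneg z) h.le hm.le)]
        · have e1 : gD z = velocityDiv A lam r z := indicator_of_mem hzZ _
          have e2 : 0 ≤ ξ z :=
            mul_nonneg (mul_nonneg (by linarith [hzJ.2]) (φ0 _)) (tr.P_nonneg _)
          simp only [e1, Pi.zero_apply]
          exact mul_nonpos_of_nonpos_of_nonneg (hz h) e2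
      · simp [hgD, hzZ]
    · simp [hξ, f₀out z hzJ, tr.P_eq_zero 0 km]
  linarith

end Comparison

end AggregationDiffusion

end

noncomputable section

namespace AggregationDiffusion

open Filter Topology

/-! ### Comparison with constants and the a priori estimate on a slab. -/

section Bound

variable {n : ℕ} {m A B lam S M K T k : ℝ} {L : ℝ≥0} {r : ℝ × E n → ℝ} {a₀ : E n → ℝ}
  {G : ℝ × E n → E n}

/-- Comparison with a constant: wherever a solution exceeds `k` its drift has non-positive
divergence, so it cannot exceed `k`. -/
lemma IsSlabSolution.ae_le (hn : 2 ≤ n) (hA : 2 - (n : ℝ) < A) (hA2 : A ≤ 2)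
    (hlam : 0 < lam) (hB : B = 2 - (n : ℝ)) (hm : 0 < m) (hk : 0 < k)
    (hs : IsSlabSolution m A B lam S M K T L r a₀ G) (hK : K ≤ k)
    (hdiv : ∀ᵐ z, k ≤ r z → velocityDiv A lam r z ≤ 0) {T'' : ℝ} (h0 : 0 < T'') (hT'' : T'' < T) :
    ∀ᵐ z : ℝ × E n, z.1 ∈ Ioo 0 T'' → r z ≤ k := by
  obtain ⟨tr⟩ := nonempty_truncation hm hk
  obtain ⟨T', h1, h2⟩ := exists_between hT''
  obtain ⟨Cφ, -, hex⟩ := exists_cutoff n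
  choose φ hφ φ0 φ1 φin φout φC using fun N : ℕ => hex (N + 1) (by simp)
  obtain ⟨D, hDi, hD⟩ := exists_cutoffFlux_le hn hA hA2 hlam hB hm hk hs tr T' Cφ
  have hev : ∀ x : E n, ∀ᶠ N : ℕ in atTop, φ N x = 1 ∧ fderiv ℝ (φ N) x = 0 := fun x => by
    filter_upwards [tendsto_natCast_atTop_atTop.eventually_gt_atTop ‖x‖] with N hN
    exact φin N x (by linarith)
  -- At each fixed point the gradient of the cutoff is eventually zero, and the dominating function
  -- `D` does not depend on the cutoff.
  have flux : Tendsto (fun N => ∫ z, cutoffFlux A B lam T' tr r G (φ N) z) atTop (𝓝 0) := by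
    have := tendsto_integral_of_dominated_convergence (f := fun _ : ℝ × E n => (0 : ℝ)) D
      (fun N => aestronglyMeasurable_cutoffFlux (T' := T') hn hB hs tr (hφ N)) hDi
      (fun N => hD (φ N) (φC N)) (Eventually.of_forall fun z => by
        refine tendsto_const_nhds.congr' ?_
        filter_upwards [hev z.2] with N hN
        simp [cutoffFlux, hN.2])
    simpa using this
  set F : ℝ × E n → ℝ := fun z => if z.1 ∈ Ioo 0 T'' then tr.Φ (r z) else 0 with hF
  have mJ : MeasurableSet {z : ℝ × E n | z.1 ∈ Ioo 0 T''} := measurable_fst measurableSet_Ioo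
  have mΦ : Measurable fun z => tr.Φ (r z) := tr.continuous_Φ.measurable.comp hs.measurable
  have F0 : ∀ z, 0 ≤ F z := fun z => by
    simp only [hF]
    split_ifs
    exacts [tr.Φ_nonneg _ (hs.nonneg z), le_rfl]
  have C0 : 0 ≤ tr.C := (tr.h_nonneg 0).trans (tr.h_le 0)
  have Fle : ∀ z, F z ≤ tr.C * r z := fun z => by
    simp only [hF]
    split_ifs
    exacts [tr.Φ_le _ (hs.nonneg z), mul_nonneg C0 (hs.nonneg z)]
  have Fm : Measurable F := Measurable.ite mJ mΦ measurable_const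
  have Fi : Integrable F := (hs.integrable.const_mul tr.C).mono' Fm.aestronglyMeasurable
    (Eventually.of_forall fun z => by rw [Real.norm_of_nonneg (F0 z)]; exact Fle z)
  have mass : Tendsto (fun N => ∫ z : ℝ × E n,
      (if z.1 ∈ Ioo 0 T'' then φ N z.2 * tr.Φ (r z) else 0)) atTop (𝓝 (∫ z, F z)) := by
    refine tendsto_integral_of_dominated_convergence (fun z => tr.C * r z)
      (fun N => (Measurable.ite mJ (((hφ N).continuous.measurable.comp measurable_snd).mul mΦ)
        measurable_const).aestronglyMeasurable) (hs.integrable.const_mul _)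
      (fun N => Eventually.of_forall fun z => ?_) (Eventually.of_forall fun z => ?_)
    · split_ifs with hz
      · have := tr.Φ_nonneg _ (hs.nonneg z)
        rw [Real.norm_of_nonneg (mul_nonneg (φ0 N _) this)]
        exact (mul_le_of_le_one_left this (φ1 N _)).trans (tr.Φ_le _ (hs.nonneg z))
      · simpa using mul_nonneg C0 (hs.nonneg z)
    · refine tendsto_const_nhds.congr' ?_
      filter_upwards [hev z.2] with N hN
      simp [hF, hN.1]
  have hle : ∫ z, F z ≤ 0 := by
    have := le_of_tendsto_of_tendsto' mass flux.neg fun N =>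
      hs.integral_le_neg_flux hn hA hA2 hlam hB hm hk tr hK hdiv (h0.trans h1) h1 h2
        (R := 2 * (N + 1)) (by positivity) (hφ N) (φ0 N) (φ1 N) (φout N) (φC N)
    simpa using this
  -- A non-negative function with non-positive integral vanishes almost everywhere, and `Φ` is
  -- positive above `k`.
  have hz := (integral_eq_zero_iff_of_nonneg F0 Fi).1 (hle.antisymm (integral_nonneg F0))
  filter_upwards [hz] with z hz hzt
  by_contra! hkr
  have := tr.Φ_pos _ hkr
  simp only [hF, if_pos hzt, Pi.zero_apply] at hz
  linarith

/-- The a priori bound: with a threshold comparable to half of the supremum, the repulsion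
dominates the attraction. -/
lemma exists_slab_bound (hn : 2 ≤ n) (hA : 2 - (n : ℝ) < A) (hA2 : A ≤ 2) (hlam : 0 < lam)
    (hB : B = 2 - (n : ℝ)) (hm : 0 < m) (M K : ℝ) :
    ∃ D : ℝ, 0 ≤ D ∧ ∀ (S T : ℝ) (L : ℝ≥0) (r : ℝ × E n → ℝ) (a₀ : E n → ℝ) (G : ℝ × E n → E n),
      IsSlabSolution m A B lam S M K T L r a₀ G → ∀ T'', 0 < T'' → T'' < T →
        ∀ᵐ z : ℝ × E n, z.1 ∈ Ioo 0 T'' → r z ≤ max K (S / 2 + D) := by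
  have hc := sphereArea_pos hn
  have ha : 0 < A + n - 2 := by linarith
  -- With this `η` the attraction contributes at most `lam * sphereArea n * (S / 2)` plus a
  -- constant, which the repulsion at height `S / 2 + D'` absorbs.
  have hq : 0 < lam * sphereArea n / (2 * (A + n - 2)) := by positivity
  obtain ⟨D, hD⟩ := exists_attraction_le hn hA hA2 M hq
  -- The added `1` keeps the threshold positive even when `S = 0` and `K = 0`.
  refine ⟨|(A + n - 2) * D / (lam * sphereArea n)| + 1, by positivity,
    fun S T L r a₀ G hs T'' h0 hT'' => ?_⟩
  set D' := |(A + n - 2) * D / (lam * sphereArea n)| + 1 with hD'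
  have S0 : 0 ≤ S := (hs.nonneg 0).trans (hs.le 0)
  have D0 : 0 < D' := by positivity
  refine hs.ae_le hn hA hA2 hlam hB hm (lt_max_of_lt_right (by linarith)) (le_max_left _ _) ?_
    h0 hT''
  filter_upwards [ae_prod_of_ae_fst hs.density] with z hz hkr
  have h1 := hD lam S L _ hz z.2
  have h2 : S / 2 + D' ≤ r z := (le_max_right _ _).trans hkr
  have h3 : (A + n - 2) * D / (lam * sphereArea n) ≤ D' := by
    linarith [le_abs_self ((A + n - 2) * D / (lam * sphereArea n))]
  rw [div_le_iff₀ (by positivity)] at h3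
  have h4 := mul_le_mul_of_nonneg_left h1 ha.le
  have h5 := mul_le_mul_of_nonneg_left h2 (mul_pos hlam hc).le
  have h6 : (A + n - 2) * (lam * sphereArea n / (2 * (A + n - 2)) * S + D)
      = lam * sphereArea n * (S / 2) + (A + n - 2) * D := by
    field_simp
  rw [velocityDiv]
  linarith

end Bound

end AggregationDiffusion

end

noncomputable section

namespace AggregationDiffusion

open Filter Topology

/-! ### From global weak solutions to slab solutions, and absorption of the supremum. -/

section Reduction

variable {n : ℕ} {m A B lam : ℝ}

lemma slab_eq (n : ℕ) (T : ℝ) :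
    slab n T = (volume : Measure (ℝ × E n)).restrict (Prod.fst ⁻¹' Ioo 0 T) := by
  rw [slab, ← prod_univ, Measure.volume_eq_prod, ← Measure.prod_restrict, Measure.restrict_univ]

lemma spaceTime_eq (n : ℕ) :
    spaceTime n = (volume : Measure (ℝ × E n)).restrict (Prod.fst ⁻¹' Ioi 0) := by
  rw [spaceTime, ← prod_univ, Measure.volume_eq_prod, ← Measure.prod_restrict,
    Measure.restrict_univ]

lemma ae_slab_iff {T : ℝ} {p : ℝ × E n → Prop} :
    (∀ᵐ z ∂(slab n T), p z) ↔ ∀ᵐ z : ℝ × E n, z.1 ∈ Ioo 0 T → p z := by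
  rw [slab_eq, ae_restrict_iff' (measurable_fst measurableSet_Ioo)]
  rfl

lemma ae_spaceTime_iff {p : ℝ × E n → Prop} :
    (∀ᵐ z ∂(spaceTime n), p z) ↔ ∀ᵐ z : ℝ × E n, 0 < z.1 → p z := by
  rw [spaceTime_eq, ae_restrict_iff' (measurable_fst measurableSet_Ioi)]
  rfl

/-- Clamping a measurable representative turns almost everywhere bounds into bounds at every point,
as slab solutions require. -/
lemma exists_measurable_mem_Icc {α : Type*} [MeasurableSpace α] {μ : Measure α} {f : α → ℝ}
    {S : ℝ} (hf : AEStronglyMeasurable f μ) (hS : 0 ≤ S) (h0 : ∀ᵐ x ∂μ, 0 ≤ f x)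
    (h1 : ∀ᵐ x ∂μ, f x ≤ S) :
    ∃ g : α → ℝ, Measurable g ∧ (∀ x, 0 ≤ g x) ∧ (∀ x, g x ≤ S) ∧ ∀ᵐ x ∂μ, f x = g x := by
  refine ⟨fun x => max 0 (min S (hf.mk f x)),
    measurable_const.max (measurable_const.min hf.stronglyMeasurable_mk.measurable),
    fun x => le_max_left _ _, fun x => max_le hS (min_le_left _ _), ?_⟩
  filter_upwards [hf.ae_eq_mk, h0, h1] with x hx h0 h1
  rw [← hx, min_eq_right h1, max_eq_right h0]

lemma ae_abs_le_of_eLpNorm_top_le {α : Type*} [MeasurableSpace α] {μ : Measure α} {f : α → ℝ}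
    {S : ℝ} (hS : 0 ≤ S) (h : eLpNorm f ⊤ μ ≤ ENNReal.ofReal S) : ∀ᵐ x ∂μ, |f x| ≤ S := by
  rw [eLpNorm_exponent_top] at h
  filter_upwards [ae_le_eLpNormEssSup (f := f) (μ := μ)] with x hx
  have := hx.trans h
  rwa [Real.enorm_eq_ofReal_abs, ENNReal.ofReal_le_ofReal_iff hS] at this

lemma HasWeakGradient.congr_ae {f f' : E n → ℝ} {g : E n → E n} (h : HasWeakGradient f g)
    (hf : f =ᵐ[volume] f') : HasWeakGradient f' g := by
  refine ⟨h.1.congr hf, h.2.1, fun φ hφ hc => ?_⟩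
  rw [← h.2.2 φ hφ hc]
  refine integral_congr_ae ?_
  filter_upwards [hf] with x hx
  rw [hx]

lemma deriv_time_slice {ψ : ℝ × E n → ℝ} (hψ : ContDiff ℝ ∞ ψ) (t : ℝ) (x : E n) :
    HasDerivAt (fun s => ψ (s, x)) (fderiv ℝ ψ (t, x) (1, 0)) t := by
  have h1 : HasFDerivAt ψ (fderiv ℝ ψ (t, x)) (t, x) :=
    (hψ.differentiable (by simp)).differentiableAt.hasFDerivAt
  exact h1.comp_hasDerivAt t ((hasDerivAt_id t).prodMk (hasDerivAt_const t x))

lemma integrable_fderiv_apply {ψ : ℝ × E n → ℝ} (hψ : ContDiff ℝ ∞ ψ) (hc : HasCompactSupport ψ)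
    {w : ℝ × E n → E n} (hw : LocallyIntegrable w) :
    Integrable fun z => fderiv ℝ ψ z (0, w z) := by
  have cd : Continuous (fderiv ℝ ψ) := hψ.continuous_fderiv (by simp)
  simp only [← sum_mul_apply_spaceDir]
  refine integrable_finsetSum _ fun i _ => ?_
  have hi : LocallyIntegrable fun z => w z i := fun z => by
    obtain ⟨s, hs, hws⟩ := hw z
    exact ⟨s, hs, (EuclideanSpace.proj i : E n →L[ℝ] ℝ).integrable_comp hws⟩
  have h := hi.integrable_smul_left_of_hasCompactSupport
    (g := fun z => fderiv ℝ ψ z (spaceDir i)) (by fun_prop)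
    ((hc.fderiv ℝ).comp_left (g := fun l : ℝ × E n →L[ℝ] ℝ => l (spaceDir i)) rfl)
  simpa [mul_comm] using h

/-- The contribution of the negative times is the initial term of the weak formulation. -/
lemma integral_negative_times {ψ : ℝ × E n → ℝ} (hψ : ContDiff ℝ ∞ ψ) (hc : HasCompactSupport ψ)
    {a : E n → ℝ} (ha : LocallyIntegrable (fun z : ℝ × E n => a z.2)) :
    ∫ z in Prod.fst ⁻¹' Iic 0, a z.2 * fderiv ℝ ψ z (1, 0) = ∫ x, a x * ψ (0, x) := by
  have cd : Continuous (fderiv ℝ ψ) := hψ.continuous_fderiv (by simp)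
  have hi : Integrable fun z : ℝ × E n => a z.2 * fderiv ℝ ψ z (1, 0) := by
    have h := ha.integrable_smul_left_of_hasCompactSupport
      (g := fun z => fderiv ℝ ψ z (1, 0)) (by fun_prop)
      ((hc.fderiv ℝ).comp_left (g := fun l : ℝ × E n →L[ℝ] ℝ => l (1, 0)) rfl)
    simpa [mul_comm] using h
  have e : (volume : Measure (ℝ × E n)).restrict (Prod.fst ⁻¹' Iic 0)
      = (volume.restrict (Iic (0 : ℝ))).prod volume := by
    rw [← prod_univ, Measure.volume_eq_prod, ← Measure.prod_restrict, Measure.restrict_univ]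
  have hi' := hi.restrict (s := Prod.fst ⁻¹' Iic 0)
  rw [e] at hi' ⊢
  -- Integrating in time first, the fundamental theorem of calculus on `(-∞, 0]` produces the value
  -- of `ψ` at time `0`.
  rw [integral_prod_symm _ hi']
  refine integral_congr_ae (Eventually.of_forall fun x => ?_)
  simp only
  rw [integral_const_mul]
  congr 1
  have hcx : HasCompactSupport fun t => ψ (t, x) :=
    HasCompactSupport.of_support_subset_isCompact (hc.image continuous_fst) fun t ht =>
      ⟨(t, x), subset_tsupport _ ht, rfl⟩
  have hcd : ContDiff ℝ 1 fun t => ψ (t, x) :=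
    (hψ.comp (contDiff_id.prodMk contDiff_const)).of_le (by simp)
  rw [← hcx.integral_Iic_deriv_eq hcd 0]
  exact integral_congr_ae (Eventually.of_forall fun t => (deriv_time_slice hψ t x).deriv.symm)

variable {ρ₀ : E n → ℝ} {ρ : ℝ → E n → ℝ} {M K : ℝ≥0}

lemma integral_le_of_eLpNorm_one_le (h : eLpNorm ρ₀ 1 volume ≤ M) : ∫ x, ρ₀ x ≤ M := by
  rw [eLpNorm_one_eq_lintegral_enorm] at h
  have h1 := (enorm_integral_le_lintegral_enorm ρ₀).trans h
  rw [Real.enorm_eq_ofReal_abs, ENNReal.ofReal_le_iff_le_toReal (by simp)] at h1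
  exact (le_abs_self _).trans h1

/-- The supremum of `ρ` on a slab. -/
def slabSup (ρ : ℝ → E n → ℝ) (T : ℝ) : ℝ :=
  (eLpNorm (fun z : ℝ × E n => ρ z.1 z.2) ⊤ (slab n T)).toReal

lemma IsGlobalWeakSolution.ae_abs_le (hρ : IsGlobalWeakSolution m A B lam ρ₀ ρ) {T : ℝ}
    (hT : 0 < T) : ∀ᵐ z ∂(slab n T), |ρ z.1 z.2| ≤ slabSup ρ T :=
  ae_abs_le_of_eLpNorm_top_le ENNReal.toReal_nonneg
    (ENNReal.ofReal_toReal (hρ.bounded T hT).2.ne).ge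

/-- The slices of a weak solution are densities with a uniform bound on the drift. -/
lemma IsGlobalWeakSolution.exists_isDensity (hn : 2 ≤ n) (hB : B = 2 - (n : ℝ))
    (hρ : IsGlobalWeakSolution m A B lam ρ₀ ρ) (hM : ∫ x, ρ₀ x ≤ M) {T S : ℝ} (hT : 0 < T)
    {r : ℝ × E n → ℝ} (hr : Measurable r) (r0 : ∀ z, 0 ≤ r z) (rS : ∀ z, r z ≤ S)
    (rout : ∀ z, z.1 ∉ Ioo 0 T → r z = 0)
    (hρr : ∀ᵐ t, t ∈ Ioo 0 T → ∀ᵐ x, ρ t x = r (t, x)) :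
    ∃ L : ℝ≥0, ∀ᵐ t, IsDensity A lam S M L fun x => r (t, x) := by
  have := nontrivial_E hn
  obtain ⟨L, hL⟩ := hρ.drift_finite T 1 hT one_pos
  have hL' := (ae_restrict_iff' measurableSet_Ioo).1 (Measure.ae_ae_of_ae_prod hL)
  have hmass := (ae_restrict_iff' measurableSet_Ioi).1 hρ.mass
  refine ⟨L, ?_⟩
  filter_upwards [hL', hmass, hρr] with t hLt hmt hrt
  have hmeas : Measurable fun x => r (t, x) := hr.comp measurable_prodMk_left
  by_cases ht : t ∈ Ioo 0 T
  · obtain ⟨h1, h2⟩ := hmt ht.1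
    have h3 := hrt ht
    -- The drift bound holds only for almost every point, but the unit ball has positive measure, so
    -- some point of it qualifies.
    have h4 : ∃ᵐ x : E n, ‖x‖ < 1 := by
      rw [frequently_ae_iff]
      have := Metric.measure_ball_pos (volume : Measure (E n)) 0 one_pos
      have e : {x : E n | ‖x‖ < 1} = Metric.ball 0 1 := by ext; simp
      rw [e]
      exact this.ne'
    obtain ⟨x, hx1, hx⟩ := (h4.and_eventually (hLt ht)).exists
    refine ⟨hmeas, fun x => r0 _, fun x => rS _, h1.congr h3, ?_, x, hx1, ?_⟩
    · rw [← integral_congr_ae h3, h2]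
      exact hM
    · refine (lintegral_congr_ae ?_).trans_le (hx hx1)
      have hne : ∀ᵐ y : E n, y ≠ x := by simp [ae_iff]
      filter_upwards [h3, hne] with y hy hyx
      simp only [hy]
      rw [gradient_potential hB (sub_ne_zero.2 hyx.symm)]
  -- Outside the time interval the slice is zero, which is trivially a density; the bound thus holds
  -- for almost every real `t`.
  · have e : ∀ x, r (t, x) = 0 := fun x => rout _ ht
    refine ⟨hmeas, fun x => r0 _, fun x => rS _, ?_, ?_, 0, by simp, ?_⟩ <;> simp [e]

lemma integrable_of_ae_isDensity {T S : ℝ} {L : ℝ≥0} {r : ℝ × E n → ℝ} (hr : Measurable r)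
    (rout : ∀ z, z.1 ∉ Ioo 0 T → r z = 0)
    (hd : ∀ᵐ t, IsDensity A lam S M L fun x => r (t, x)) : Integrable r := by
  rw [Measure.volume_eq_prod, integrable_prod_iff hr.aestronglyMeasurable]
  refine ⟨hd.mono fun t ht => ht.integrable, ?_⟩
  have hi : Integrable ((Ioo 0 T).indicator fun _ : ℝ => (M : ℝ)) :=
    (integrable_indicator_iff measurableSet_Ioo).2 (integrableOn_const (by simp))
  refine hi.mono' (hr.norm.stronglyMeasurable.integral_prod_right'
    (ν := (volume : Measure (E n)))).aestronglyMeasurable ?_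
  filter_upwards [hd] with t ht
  rw [Real.norm_of_nonneg (integral_nonneg fun x => norm_nonneg _)]
  by_cases h : t ∈ Ioo 0 T
  · rw [indicator_of_mem h]
    simp only [Real.norm_of_nonneg (ht.nonneg _)]
    exact ht.mass_le
  · have e : ∀ x, r (t, x) = 0 := fun x => rout _ h
    simp [e, h]

/-- The restriction of a global weak solution to a time slab. -/
lemma IsGlobalWeakSolution.exists_isSlabSolution (hn : 2 ≤ n) (hA : 2 - (n : ℝ) < A) (hA2 : A ≤ 2)
    (hlam : 0 < lam) (hB : B = 2 - (n : ℝ)) (h0 : ∀ᵐ x, 0 ≤ ρ₀ x)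
    (hmeas : AEStronglyMeasurable ρ₀ volume) (hM : eLpNorm ρ₀ 1 volume ≤ M)
    (hK : eLpNorm ρ₀ ⊤ volume ≤ K) (hρ : IsGlobalWeakSolution m A B lam ρ₀ ρ) {T : ℝ}
    (hT : 0 < T) :
    ∃ (L : ℝ≥0) (r : ℝ × E n → ℝ) (a₀ : E n → ℝ) (G : ℝ × E n → E n),
      IsSlabSolution m A B lam (slabSup ρ T) M K T L r a₀ G ∧
        ∀ᵐ z ∂(slab n T), ρ z.1 z.2 = r z := by
  have mJ : MeasurableSet (Prod.fst ⁻¹' Ioo 0 T : Set (ℝ × E n)) :=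
    measurable_fst measurableSet_Ioo
  have hS : 0 ≤ slabSup ρ T := ENNReal.toReal_nonneg
  have hab := hρ.ae_abs_le hT
  have hpos : ∀ᵐ z ∂(slab n T), 0 ≤ ρ z.1 z.2 := by
    rw [ae_slab_iff]
    filter_upwards [ae_spaceTime_iff.1 hρ.nonneg] with z hz hzT using hz hzT.1
  obtain ⟨r₁, r₁m, r₁0, r₁S, hr₁⟩ := exists_measurable_mem_Icc (hρ.bounded T hT).1 hS hpos
    (hab.mono fun z hz => (le_abs_self _).trans hz)
  obtain ⟨a₀, a₀m, a₀0, a₀K, ha₀⟩ := exists_measurable_mem_Icc hmeas K.2 h0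
    ((ae_abs_le_of_eLpNorm_top_le K.2 (hK.trans (by simp))).mono
      fun z hz => (le_abs_self _).trans hz)
  obtain ⟨G₁, hG₁, hw, heq⟩ := hρ.weak_form
  set r : ℝ × E n → ℝ := (Prod.fst ⁻¹' Ioo 0 T).indicator r₁ with hr
  set G : ℝ × E n → E n := (Prod.fst ⁻¹' Ioo 0 T).indicator fun z => G₁ z.1 z.2 with hG
  have rin : ∀ z : ℝ × E n, z.1 ∈ Ioo 0 T → r z = r₁ z := fun z hz =>
    indicator_of_mem (s := Prod.fst ⁻¹' Ioo 0 T) hz _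
  have rout : ∀ z : ℝ × E n, z.1 ∉ Ioo 0 T → r z = 0 := fun z hz =>
    indicator_of_notMem (s := Prod.fst ⁻¹' Ioo 0 T) hz _
  have Gin : ∀ z : ℝ × E n, z.1 ∈ Ioo 0 T → G z = G₁ z.1 z.2 := fun z hz =>
    indicator_of_mem (s := Prod.fst ⁻¹' Ioo 0 T) hz _
  have Gout : ∀ z : ℝ × E n, z.1 ∉ Ioo 0 T → G z = 0 := fun z hz =>
    indicator_of_notMem (s := Prod.fst ⁻¹' Ioo 0 T) hz _
  have rm : Measurable r := r₁m.indicator mJ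
  have r0 : ∀ z, 0 ≤ r z := fun z => indicator_nonneg (fun z _ => r₁0 z) z
  have rS : ∀ z, r z ≤ slabSup ρ T := fun z => indicator_le' (fun z _ => r₁S z) (fun _ _ => hS) z
  have hρr : ∀ᵐ z ∂(slab n T), ρ z.1 z.2 = r z := by
    rw [ae_slab_iff] at hr₁ ⊢
    filter_upwards [hr₁] with z hz hzT
    rw [hz hzT, rin z hzT]
  have hρt : ∀ᵐ t, t ∈ Ioo 0 T → ∀ᵐ x, ρ t x = r (t, x) :=
    (ae_restrict_iff' measurableSet_Ioo).1 (Measure.ae_ae_of_ae_prod hρr)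
  obtain ⟨L, hd⟩ := hρ.exists_isDensity hn hB (integral_le_of_eLpNorm_one_le hM) hT rm r0 rS
    rout hρt
  have ri := integrable_of_ae_isDensity rm rout hd
  have hGL : MemLp G 2 := by
    rw [hG, memLp_indicator_iff_restrict mJ, ← slab_eq]
    exact hG₁ T hT
  refine ⟨L, r, a₀, G, ⟨rm, r0, rS, ri, hd, a₀m, a₀0, a₀K, hGL, ?_, fun ψ hψ hc hψT => ?_⟩, hρr⟩
  · rw [ae_restrict_iff' measurableSet_Ioo]
    filter_upwards [hρt, (ae_restrict_iff' measurableSet_Ioi).1 hw] with t h1 h2 ht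
    have e : (fun x => G (t, x)) = G₁ t := funext fun x => Gin _ ht
    rw [e]
    exact (h2 ht.1).congr_ae ((h1 ht).mono fun x hx => by simp only [hx])
  · have cd : Continuous (fderiv ℝ ψ) := hψ.continuous_fderiv (by simp)
    obtain ⟨C, -, hC⟩ := exists_velocity_le hn hA hA2 hlam hB hd
    have Vl : LocallyIntegrable fun z => r z • velocity A B lam r z := by
      have hc1 : LocallyIntegrable fun z : ℝ × E n => slabSup ρ T * (C * (1 + ‖z.2‖)) :=
        Continuous.locallyIntegrable (by fun_prop)
      refine hc1.mono (rm.aestronglyMeasurable.smul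
        (stronglyMeasurable_velocity hn hB rm).aestronglyMeasurable) ?_
      filter_upwards [hC] with z hz
      rw [norm_smul, Real.norm_of_nonneg (r0 z)]
      exact (mul_le_mul (rS z) hz (norm_nonneg _) hS).trans (le_abs_self _)
    have al : LocallyIntegrable (extendInitial r a₀) := by
      have hc1 : LocallyIntegrable fun _ : ℝ × E n => max (slabSup ρ T) K :=
        Continuous.locallyIntegrable (by fun_prop)
      refine hc1.mono (Measurable.ite (measurableSet_le measurable_fst measurable_const)
        (a₀m.comp measurable_snd) rm).aestronglyMeasurable (Eventually.of_forall fun z => ?_)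
      refine le_trans ?_ (le_abs_self _)
      unfold extendInitial
      split_ifs
      · rw [Real.norm_of_nonneg (a₀0 _)]
        exact (a₀K _).trans (le_max_right _ _)
      · rw [Real.norm_of_nonneg (r0 _)]
        exact (rS _).trans (le_max_left _ _)
    have a₀l : LocallyIntegrable fun z : ℝ × E n => a₀ z.2 := by
      have hc1 : LocallyIntegrable fun _ : ℝ × E n => (K : ℝ) :=
        Continuous.locallyIntegrable (by fun_prop)
      refine hc1.mono (a₀m.comp measurable_snd).aestronglyMeasurable
        (Eventually.of_forall fun z => ?_)
      rw [Real.norm_of_nonneg (a₀0 _)]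
      exact (a₀K _).trans (le_abs_self _)
    have i1 : Integrable fun z => extendInitial r a₀ z * fderiv ℝ ψ z (1, 0) := by
      have h := al.integrable_smul_left_of_hasCompactSupport
        (g := fun z => fderiv ℝ ψ z (1, 0)) (by fun_prop)
        ((hc.fderiv ℝ).comp_left (g := fun l : ℝ × E n →L[ℝ] ℝ => l (1, 0)) rfl)
      simpa [mul_comm] using h
    have i2 := integrable_fderiv_apply hψ hc ((hGL.locallyIntegrable one_le_two).add Vl)
    have m0 : MeasurableSet (Prod.fst ⁻¹' Iic 0 : Set (ℝ × E n)) :=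
      measurable_fst measurableSet_Iic
    have i12 : Integrable fun z => extendInitial r a₀ z * fderiv ℝ ψ z (1, 0)
        - fderiv ℝ ψ z (0, G z + r z • velocity A B lam r z) := i1.sub i2
    rw [← integral_add_compl m0 i12]
    have neg : ∫ z in Prod.fst ⁻¹' Iic 0, (extendInitial r a₀ z * fderiv ℝ ψ z (1, 0)
        - fderiv ℝ ψ z (0, G z + r z • velocity A B lam r z)) = ∫ x, ρ₀ x * ψ (0, x) := by
      have e1 : ∫ x, ρ₀ x * ψ (0, x) = ∫ x, a₀ x * ψ (0, x) :=
        integral_congr_ae (ha₀.mono fun x hx => by simp only [hx])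
      rw [e1, ← integral_negative_times hψ hc a₀l]
      refine setIntegral_congr_fun m0 fun z (hz : z.1 ≤ 0) => ?_
      have hz' : z.1 ∉ Ioo 0 T := fun h => absurd h.1 (not_lt.2 hz)
      have e2 : ((0 : ℝ), (0 : E n)) = 0 := rfl
      simp [extendInitial, hz, rout z hz', Gout z hz', e2]
    have hcompl : (Prod.fst ⁻¹' Iic 0 : Set (ℝ × E n))ᶜ = Prod.fst ⁻¹' Ioi 0 := by
      ext z; simp
    have pos : ∫ z in (Prod.fst ⁻¹' Iic 0)ᶜ, (extendInitial r a₀ z * fderiv ℝ ψ z (1, 0)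
        - fderiv ℝ ψ z (0, G z + r z • velocity A B lam r z))
        = ∫ z, (ρ z.1 z.2 * deriv (fun s => ψ (s, z.2)) z.1
          - inner ℝ (G₁ z.1 z.2) (gradient (fun x => ψ (z.1, x)) z.2)
          - ρ z.1 z.2 * inner ℝ (drift A B lam (ρ z.1) z.2)
              (gradient (fun x => ψ (z.1, x)) z.2)) ∂(spaceTime n) := by
      rw [hcompl, ← spaceTime_eq]
      refine integral_congr_ae ?_
      rw [EventuallyEq, ae_spaceTime_iff]
      filter_upwards [ae_slab_iff.1 hρr, ae_prod_of_ae_fst hρt] with z h1 h2 hz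
      simp only [inner_gradient, fderiv_slice hψ, (deriv_time_slice hψ z.1 z.2).deriv]
      -- Beyond `T` the truncated fields differ from the solution, but there `ψ` and its derivatives
      -- vanish.
      by_cases hzT : z.1 < T
      · have hzJ : z.1 ∈ Ioo 0 T := ⟨hz, hzT⟩
        have e1 : drift A B lam (ρ z.1) z.2 = velocity A B lam r z :=
          integral_congr_ae ((h2 hzJ).mono fun y hy => by simp only [hy])
        have e2 : ((0 : ℝ), G z + r z • velocity A B lam r z)
            = (0, G z) + r z • (0, velocity A B lam r z) := by simp
        rw [e1, h1 hzJ, ← Gin z hzJ, e2, map_add, map_smul, extendInitial, if_neg (not_le.2 hz),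
          smul_eq_mul]
        ring
      · have h3 : fderiv ℝ ψ z = 0 := by
          by_contra h
          exact hzT (hψT (support_fderiv_subset ℝ h))
        simp [h3]
    rw [neg, pos, add_comm]
    exact heq ψ hψ hc

/-- The uniform bound on a time slab. -/
lemma exists_slabSup_le (hn : 2 ≤ n) (hA : 2 - (n : ℝ) < A) (hA2 : A ≤ 2)
    (hlam : 0 < lam) (hB : B = 2 - (n : ℝ)) (hm : 0 < m) (M K : ℝ≥0) :
    ∃ C : ℝ≥0, ∀ (ρ₀ : E n → ℝ) (ρ : ℝ → E n → ℝ), (∀ᵐ x, 0 ≤ ρ₀ x) →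
      AEStronglyMeasurable ρ₀ volume → eLpNorm ρ₀ 1 volume ≤ M → eLpNorm ρ₀ ⊤ volume ≤ K →
      IsGlobalWeakSolution m A B lam ρ₀ ρ → ∀ T : ℝ, 0 < T → slabSup ρ T ≤ C := by
  obtain ⟨D, D0, hD⟩ := exists_slab_bound hn hA hA2 hlam hB hm M K
  refine ⟨max K (2 * ⟨D, D0⟩), fun ρ₀ ρ h0 hmeas hM hK hρ T hT => ?_⟩
  obtain ⟨L, r, a₀, G, hs, hρr⟩ :=
    hρ.exists_isSlabSolution hn hA hA2 hlam hB h0 hmeas hM hK hT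
  set S := slabSup ρ T with hS
  have S0 : 0 ≤ S := ENNReal.toReal_nonneg
  -- The comparison stops strictly before `T`; countably many shorter intervals exhaust the slab.
  have h1 : ∀ᵐ z : ℝ × E n, ∀ j : ℕ, z.1 ∈ Ioo 0 (T - 1 / ((j : ℝ) + 1)) →
      r z ≤ max (K : ℝ) (S / 2 + D) := by
    rw [ae_all_iff]
    intro j
    have hj : 0 < 1 / ((j : ℝ) + 1) := by positivity
    rcases le_or_gt (T - 1 / ((j : ℝ) + 1)) 0 with h | h
    · exact Eventually.of_forall fun z hz => absurd (hz.1.trans hz.2) (not_lt.2 h)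
    · exact hD _ _ _ _ _ _ hs _ h (by linarith)
  have h2 : ∀ᵐ z ∂(slab n T), ‖ρ z.1 z.2‖ ≤ max (K : ℝ) (S / 2 + D) := by
    rw [ae_slab_iff] at hρr ⊢
    filter_upwards [h1, hρr] with z hz1 hz2 hzT
    obtain ⟨j, hj⟩ := exists_nat_one_div_lt (sub_pos.2 hzT.2)
    rw [hz2 hzT, Real.norm_of_nonneg (hs.nonneg z)]
    exact hz1 j ⟨hzT.1, by linarith⟩
  -- `S` is a finite real number, so `S / 2` can be absorbed on the left. The resulting bound does
  -- not depend on `T`.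
  have h3 : S ≤ max (K : ℝ) (S / 2 + D) := by
    refine ENNReal.toReal_le_of_le_ofReal (le_max_of_le_left K.2) ?_
    rw [eLpNorm_exponent_top]
    exact eLpNormEssSup_le_of_ae_bound h2
  push_cast
  rcases le_max_iff.1 h3 with h | h
  · exact le_max_of_le_left h
  · refine le_max_of_le_right ?_
    change S ≤ 2 * D
    linarith

end Reduction

end AggregationDiffusion

end

theorem theorem2p2 (n : ℕ) (hn : 2 ≤ n) (m A B lam : ℝ) (hm : 1 - 2 / (n : ℝ) < m)
    (hB : B = 2 - (n : ℝ)) (hBA : B < A) (hA : A ≤ 2) (hlam : 0 < lam) (M K : ℝ≥0) :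
    ∃ C : ℝ≥0, ∀ ρ₀ : AggregationDiffusion.E n → ℝ,
      (∀ᵐ x, 0 ≤ ρ₀ x) → MemLp ρ₀ 1 volume → MemLp ρ₀ ∞ volume →
      eLpNorm ρ₀ 1 volume ≤ M → eLpNorm ρ₀ ∞ volume ≤ K →
      ∀ ρ : ℝ → AggregationDiffusion.E n → ℝ,
        AggregationDiffusion.IsGlobalWeakSolution m A B lam ρ₀ ρ →
        eLpNorm (fun z : ℝ × AggregationDiffusion.E n => ρ z.1 z.2) ∞
          (AggregationDiffusion.spaceTime n) ≤ C := by
  -- As `n ≥ 2`, the lower bound `1 - 2 / n` is non-negative.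
  have hm0 : 0 < m := by
    have h1 : (2 : ℝ) ≤ n := by exact_mod_cast hn
    have h2 : 2 / (n : ℝ) ≤ 1 := (div_le_one (by linarith)).2 h1
    linarith
  obtain ⟨C, hC⟩ := AggregationDiffusion.exists_slabSup_le hn (hB ▸ hBA) hA hlam hB hm0 M K
  refine ⟨C, fun ρ₀ h0 h1 _ hM hK ρ hρ => ?_⟩
  rw [eLpNorm_exponent_top, ← ENNReal.ofReal_coe_nnreal]
  refine eLpNormEssSup_le_of_ae_bound ?_
  rw [AggregationDiffusion.ae_spaceTime_iff]
  -- The constant is the same for all slabs, so a countable exhaustion of the half-line gives the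
  -- global bound.
  have h : ∀ᵐ z : ℝ × AggregationDiffusion.E n, ∀ j : ℕ, z.1 ∈ Ioo 0 ((j : ℝ) + 1) →
      ‖ρ z.1 z.2‖ ≤ C := by
    rw [ae_all_iff]
    intro j
    rw [← AggregationDiffusion.ae_slab_iff]
    filter_upwards [hρ.ae_abs_le (T := (j : ℝ) + 1) (by positivity)] with z hz
    exact hz.trans (hC ρ₀ ρ h0 h1.1 hM hK hρ _ (by positivity))
  filter_upwards [h] with z hz hz0
  obtain ⟨j, hj⟩ := exists_nat_gt z.1
  exact hz j ⟨hz0, by linarith⟩
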